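/- Let $d\ge 0$ be an integer, $T>0$, $A>0$, let $\Omega\subset\mathbb R^d\times\mathbb R^d$ be compact, and let $f:\mathbb R^d\to[1,\infty)$ satisfy $f(k)\to+\infty$ as $|k|\to\infty$. For $F:\mathbb R^d\to\mathbb R^d$, a solution of Newton's equation is a pair $(X,V)$ of maps $\mathbb R\times\mathbb R^{2d}\to\mathbb R^d$ such that, for almost every $p=(x,v)$, one has $\partial_tX(t,p)=V(t,p)$ for all $t\in\mathbb R$, and $s\mapsto F(X(s,p))$ is locally integrable with $V(t,p)=V(0,p)+\int_0^tF(X(s,p))\,ds$ for all $t\in\mathbb R$. For two solutions $(X,V)$, $(X^\delta,V^\delta)$ and $\delta>0$, put $$Q_\delta(T)=\iint_\Omega\log\Big(1+\frac1{\delta^2}\Big(\sup_{0\le t\le T}|X(t,x,v)-X^\delta(t,x,v)|^2+\int_0^T|V(t,x,v)-V^\delta(t,x,v)|^2\,dt\Big)\Big)\,dx\,dv .$$ Then there exists a function $\varepsilon:[0,\infty)\to\mathbb R$, depending only on $d,T,A,\Omega,f$, which is continuous, strictly increasing (so it decreases to $0$ as $\delta\downarrow0$) and satisfies $\varepsilon(0)=0$,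 such that the following holds. Let $F\in H^{3/4}(\mathbb R^d;\mathbb R^d)\cap L^\infty$ with $\|F\|_{L^\infty}\le A$, let $\alpha(k)=(2\pi)^{-d}\int F(x)e^{-ik\cdot x}\,dx$ be its ($L^2$-)Fourier transform, let $0<\delta<1/e$, and let $(X,V)$ and $(X^\delta,V^\delta)$ be two solutions of Newton's equation with force $F$ such that - for every $t\in\mathbb R$, the maps $p\mapsto(X,V)(t,p)$ and $p\mapsto(X^\delta,V^\delta)(t,p)$ of $\mathbb R^{2d}$ are invertible with Jacobian $1$, in the sense that they preserve Lebesgue measure and have a measure preserving inverse up to null sets; - $(X,V)$ has the semigroup property: for all $s,t\in\mathbb R$, $(X,V)(t+s,p)=(X,V)\big(s,(X,V)(t,p)\big)$ for almost every $p$; - for almost every $(x,v)$, $X(0,x,v)=x$, $V(0,x,v)=v$, $|X(0,x,v)-X^\delta(0,x,v)|\le\delta$ and $|V(0,x,v)-V^\delta(0,x,v)|\le\delta$. Then $$Q_\delta(T)\le|\log\delta|\;\varepsilon(\delta)\;\Big(1+\int_{\mathbb R^d}|k|^{3/2}\,|\alpha(k)|^2\,f(k)\,dk\Big)^{1/2},$$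 where the right-hand side is $+\infty$ if the integral diverges. -/

import Mathlib

open MeasureTheory Filter Topology
open scoped ENNReal FourierTransform SchwartzMap

/-- The position (or velocity) space `ℝ^d` with its Euclidean norm. -/
abbrev Space (d : ℕ) : Type := EuclideanSpace ℝ (Fin d)

/-- The space `ℂ^d` with its Hermitian norm, in which Fourier transforms of force fields live. -/
abbrev CSpace (d : ℕ) : Type := EuclideanSpace ℂ (Fin d)

/-- A real vector regarded as a complex vector. -/
noncomputable def toCSpace {d : ℕ} (x : Space d) : CSpace d :=
  WithLp.toLp 2 (fun i => ((x i : ℝ) : ℂ))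

theorem norm_toCSpace {d : ℕ} (x : Space d) : ‖toCSpace x‖ = ‖x‖ := by
  simp [toCSpace, EuclideanSpace.norm_eq]

theorem continuous_toCSpace {d : ℕ} : Continuous (toCSpace (d := d)) := by
  unfold toCSpace
  fun_prop

theorem memLp_toCSpace {d : ℕ} {F : Space d → Space d} (hF : MemLp F 2 volume) :
    MemLp (fun x => toCSpace (F x)) 2 volume :=
  hF.of_le (continuous_toCSpace.comp_aestronglyMeasurable hF.1)
    (Eventually.of_forall fun x => (norm_toCSpace (F x)).le)

/-- A square integrable force field as an element of the complex Hilbert space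
`L²(ℝ^d; ℂ^d)`. -/
noncomputable def forceL2 {d : ℕ} (F : Space d → Space d) (hF : MemLp F 2 volume) :
    Lp (CSpace d) 2 (volume : Measure (Space d)) :=
  (memLp_toCSpace hF).toLp (fun x => toCSpace (F x))

/-- `F ∈ H^s(ℝ^d; ℝ^d)` for a square integrable `F`: its Bessel potential of order `s` is
in `L²`. -/
def ForceMemSobolev {d : ℕ} (s : ℝ) (F : Space d → Space d) (hF : MemLp F 2 volume) : Prop :=
  TemperedDistribution.MemSobolev s 2 (forceL2 F hF : 𝓢'(Space d, CSpace d))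

/-- The (Plancherel) Fourier transform `α` of `F`, normalised so that
`F(x) = ∫ α(k) e^{i k·x} dk`, that is `α(k) = (2π)^{-d} ∫ F(x) e^{-i k·x} dx`.
The transform `𝓕` has the kernel `e^{-2πi k·x}`. -/
noncomputable def forceFourier {d : ℕ} (F : Space d → Space d) (hF : MemLp F 2 volume)
    (k : Space d) : CSpace d :=
  ((2 * Real.pi) ^ d)⁻¹ • (𝓕 (forceL2 F hF) : Lp (CSpace d) 2 (volume : Measure (Space d)))
    ((2 * Real.pi)⁻¹ • k)

/-- The weighted energy `∫ |k|^{3/2} |α(k)|² f(k) dk ∈ [0, ∞]`. -/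
noncomputable def weightedEnergy {d : ℕ} (f : Space d → ℝ) (F : Space d → Space d)
    (hF : MemLp F 2 volume) : ℝ≥0∞ :=
  ∫⁻ k, ENNReal.ofReal (‖k‖ ^ (3 / 2 : ℝ) * ‖forceFourier F hF k‖ ^ 2 * f k)

/-- `(X, V)` solves `∂ₜX = V`, `∂ₜV = F(X)` for almost every label `p = (x, v)`. As `F` is only
bounded and measurable, the second equation is taken in integrated form. -/
def IsNewtonSolution {d : ℕ} (F : Space d → Space d)
    (X V : ℝ → Space d × Space d → Space d) : Prop :=
  ∀ᵐ p : Space d × Space d,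
    (∀ t : ℝ, HasDerivAt (fun s => X s p) (V t p) t) ∧
    (∀ t : ℝ, IntervalIntegrable (fun s => F (X s p)) volume 0 t) ∧
    (∀ t : ℝ, V t p = V 0 p + ∫ s in (0 : ℝ)..t, F (X s p))

/-- A map of phase space that is invertible and has Jacobian one, for maps
defined up to null sets: it preserves Lebesgue measure and has a measure preserving inverse. -/
def InvertibleJacobianOne {d : ℕ} (Φ : Space d × Space d → Space d × Space d) : Prop :=
  MeasurePreserving Φ volume volume ∧
    ∃ Ψ : Space d × Space d → Space d × Space d, MeasurePreserving Ψ volume volume ∧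
      (∀ᵐ p, Ψ (Φ p) = p) ∧ (∀ᵐ p, Φ (Ψ p) = p)

/-- The semigroup property of a flow. -/
def IsSemigroup {d : ℕ} (X V : ℝ → Space d × Space d → Space d) : Prop :=
  ∀ s t : ℝ, ∀ᵐ p : Space d × Space d,
    X (t + s) p = X s (X t p, V t p) ∧ V (t + s) p = V s (X t p, V t p)

/-- The functional
`Q_δ(T) = ∬_Ω log (1 + δ⁻² (sup_{0≤t≤T} |X - X'|² + ∫₀ᵀ |V - V'|² dt)) dx dv`. -/
noncomputable def QFunctional {d : ℕ} (T : ℝ) (Ω : Set (Space d × Space d)) (δ : ℝ)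
    (X V X' V' : ℝ → Space d × Space d → Space d) : ℝ≥0∞ :=
  ∫⁻ p in Ω, ENNReal.ofReal (Real.log (1 + 1 / δ ^ 2 *
    ((⨆ t : Set.Icc (0 : ℝ) T, ‖X t p - X' t p‖ ^ 2) +
      ∫ t in (0 : ℝ)..T, ‖V t p - V' t p‖ ^ 2)))

/-! ### Plancherel transform on L²: integral formula, band-limited approximation, normalisation of
the energy -/

section FourierL2

variable {d : ℕ}

/-! The proof is a Grönwall argument on the logarithm. For two trajectories put w = X' - X and η =
V' - V, and let G be the majorant `pathMajorant` of |w|² + δ² + ∫|η|². If |η|² ≤ G·P on [0,T], then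
log(G(T)/δ²) ≤ log 2 + T + 2∫P (`log_pathMajorant_le`), so it remains to bound P on average over Ω.
For a Lipschitz force P would be a constant; here F has only 3/4 of a derivative, and the missing
quarter has to be gained from transport.

The gain comes from the fact that η involves F only through time integrals along trajectories. For a
plane wave e(x) = exp(2πi ξ·x) and σ = λ + 2πi ξ·v, the derivative of e(X)/σ(V) along a trajectory
is e - λe/σ - 2πi(ξ·F)e/σ². Hence ∫e(X)ds equals boundary terms and integrals with symbols of size
at most a constant times λ/|σ|; the choice λ = √(1+|ξ|) makes |ξ|/|σ|² ≤ λ/|σ|. Since ∫|σ|⁻²dv over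
a ball is O(λ⁻³) (`lintegral_inv_norm_transportSymbol_sq_le`), Plancherel in x shows that one
derivative of such a term costs |ξ|²λ²λ⁻³ ≤ |ξ|^{3/2} in the squared L² norm of phase space
(`exists_lintegral_mode_sq_le`). This is where the exponent 3/4 arises. As the flows preserve
Lebesgue measure, phase space norms control averages along trajectories.

Two trajectories at distance at most W are compared at an averaging scale r with W ≤ r ≤ 2W. The
part of the field averaged at scale r has increments bounded by W times local averages of a
gradient; the complementary part is not differenced but bounded on each trajectory separately, its
symbol 1 - ψ̂(rξ) being at most 2πr|ξ|, so that it too is O(W) times a first derivative. Both are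
collected in `scaleBound`, whose L² norm is bounded uniformly in r (`exists_eLpNorm_scaleBound_le`).
The scale depends on the trajectory and on time, so P is bounded by the sum over the O(|log δ|)
dyadic scales between δ and a fixed constant; this produces the factor |log δ|.

To make its coefficient small, F is first split (`exists_force_decomposition`) into an average at a
fixed scale, which is Lipschitz, a band-limited field, and an L² remainder with squared norm at most
δ². The low frequencies of the band-limited field are damped, while at high frequencies f is large,
so its energy is at most any prescribed multiple of the weighted energy E
(`exists_scale_frequencyEnergy_le`). With L = |log δ| this gives Q ≤ C₂ + LηE, where C₂ depends on η
but not on δ. Multiplying by the trivial bound Q ≤ C₁L and taking square roots yields Q ≤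
cL(1+E)^{1/2} for every c > 0 once δ is small. `exists_strictMonoOn_modulus` turns these eventual
bounds into one modulus ε. -/

theorem integral_fourierInv_smul_eq_flip {f : Space d → ℂ} {g : Space d → CSpace d}
    (hf : Integrable f) (hg : Integrable g) :
    ∫ ξ, 𝓕⁻ f ξ • g ξ = ∫ x, f x • 𝓕⁻ g x := by
  have h := VectorFourier.integral_fourierIntegral_smul_eq_flip (L := -innerₗ (Space d))
    (μ := volume) (ν := volume) Real.continuous_fourierChar
    (by simp only [LinearMap.neg_apply, innerₗ_apply_apply]; fun_prop) hf hg
  simpa [VectorFourier.fourierIntegral, Real.fourierInv_eq, real_inner_comm] using h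

/-- On `L¹ ∩ L²` the Plancherel inverse Fourier transform is given by the integral. -/
theorem coeFn_fourierInv_toLp {h : Space d → CSpace d} (h1 : Integrable h) (h2 : MemLp h 2) :
    (𝓕⁻ (h2.toLp h) : Lp (CSpace d) 2 (volume : Measure (Space d))) =ᵐ[volume] 𝓕⁻ h := by
  have hcont : Continuous (𝓕⁻ h) := by
    have := VectorFourier.fourierIntegral_continuous (L := -innerₗ (Space d)) (μ := volume)
      Real.continuous_fourierChar
      (by simp only [LinearMap.neg_apply, innerₗ_apply_apply]; fun_prop) h1
    exact this
  -- Both sides are locally integrable, so equality can be tested against smooth compactly supported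
  -- functions. Such a test function is a Schwartz function, for which the L² transform is defined
  -- by duality.
  refine ae_eq_of_integral_contDiff_smul_eq
    ((Lp.memLp _).locallyIntegrable (by norm_num)) hcont.locallyIntegrable ?_
  intro g hg hgs
  have hgc : HasCompactSupport (fun x => (g x : ℂ)) := hgs.comp_left (g := fun r : ℝ => (r : ℂ)) (by simp)
  have hgd : ContDiff ℝ (⊤ : ℕ∞) (fun x => (g x : ℂ)) := Complex.ofRealCLM.contDiff.comp hg
  set φ : 𝓢(Space d, ℂ) := hgc.toSchwartzMap hgd with hφ
  have hφa : ∀ x, φ x = (g x : ℂ) := fun x => rfl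
  have e1 := congrArg (fun D => D φ) (Lp.fourierInv_toTemperedDistribution_eq (h2.toLp h))
  simp only [TemperedDistribution.fourierInv_apply, Lp.toTemperedDistribution_apply] at e1
  have e2 : ∫ x, (𝓕⁻ φ) x • (h2.toLp h) x = ∫ x, (𝓕⁻ (φ : Space d → ℂ)) x • h x := by
    refine integral_congr_ae ?_
    filter_upwards [h2.coeFn_toLp] with x hx
    rw [hx, SchwartzMap.fourierInv_coe]
  rw [e2, integral_fourierInv_smul_eq_flip φ.integrable h1] at e1
  simpa [hφa] using e1.symm

theorem lintegral_enorm_sq_coeFn (u : Lp (CSpace d) 2 (volume : Measure (Space d))) :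
    ∫⁻ x, ‖u x‖ₑ ^ 2 = ‖u‖ₑ ^ 2 := by
  rw [Lp.enorm_def, eLpNorm_eq_lintegral_rpow_enorm_toReal (by norm_num) (by norm_num)]
  rw [← ENNReal.rpow_natCast, ← ENNReal.rpow_mul]
  simp

/-- Plancherel for the inverse transform given by the integral; this pointwise form is needed
because modes are evaluated along individual trajectories. -/
theorem lintegral_enorm_fourierInv_sq {h : Space d → CSpace d} (h1 : Integrable h)
    (h2 : MemLp h 2) : ∫⁻ x, ‖𝓕⁻ h x‖ₑ ^ 2 = ∫⁻ ξ, ‖h ξ‖ₑ ^ 2 := by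
  have e1 := lintegral_enorm_sq_coeFn (𝓕⁻ (h2.toLp h))
  have e2 := lintegral_enorm_sq_coeFn (h2.toLp h)
  have e3 : ‖(𝓕⁻ (h2.toLp h) : Lp (CSpace d) 2 (volume : Measure (Space d)))‖ₑ
      = ‖h2.toLp h‖ₑ := by
    rw [← ofReal_norm, ← ofReal_norm, ← Lp.norm_fourier_eq (𝓕⁻ (h2.toLp h)),
      FourierTransform.fourier_fourierInv_eq]
  rw [e3, ← e2] at e1
  have l1 := lintegral_congr_ae ((coeFn_fourierInv_toLp h1 h2).mono
    fun x hx => congrArg (fun y => ‖y‖ₑ ^ 2) hx)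
  have l2 := lintegral_congr_ae (h2.coeFn_toLp.mono fun x hx => congrArg (fun y => ‖y‖ₑ ^ 2) hx)
  rw [← l1, ← l2, e1]

/-- Band limited approximation of square integrable functions. -/
theorem exists_bandLimited_approx (u : Lp (CSpace d) 2 (volume : Measure (Space d)))
    {ε : ℝ≥0∞} (hε : ε ≠ 0) :
    ∃ K : ℝ, 0 < K ∧ ∫⁻ x, ‖u x - 𝓕⁻ ((Metric.closedBall 0 K).indicator
      (𝓕 u : Lp (CSpace d) 2 (volume : Measure (Space d)))) x‖ₑ ^ 2 ≤ ε := by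
  set û : Lp (CSpace d) 2 (volume : Measure (Space d)) := 𝓕 u with hû
  have hm : MemLp û 2 := Lp.memLp û
  have hfin : ∫⁻ ξ, ‖û ξ‖ₑ ^ 2 ≠ ∞ := by
    rw [lintegral_enorm_sq_coeFn]; simp
  have htail : Tendsto (fun n : ℕ => ∫⁻ ξ, ‖û ξ - (Metric.closedBall 0 ((n : ℝ) + 1)).indicator
      û ξ‖ₑ ^ 2) atTop (𝓝 (∫⁻ _ : Space d, 0)) := by
    refine tendsto_lintegral_of_dominated_convergence' (fun ξ => ‖û ξ‖ₑ ^ 2) ?_ ?_ hfin ?_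
    · intro n
      exact ((hm.1.sub (hm.1.indicator measurableSet_closedBall)).enorm).pow_const 2
    · intro n
      refine Eventually.of_forall fun ξ => ?_
      by_cases h : ξ ∈ Metric.closedBall (0 : Space d) ((n : ℝ) + 1) <;> simp [h]
    · refine Eventually.of_forall fun ξ => tendsto_const_nhds.congr' ?_
      obtain ⟨n, hn⟩ := exists_nat_ge ‖ξ‖
      filter_upwards [eventually_ge_atTop n] with m hm
      have : ξ ∈ Metric.closedBall (0 : Space d) ((m : ℝ) + 1) := by
        have : (n : ℝ) ≤ m := by exact_mod_cast hm
        simp; linarith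
      simp [this]
  rw [lintegral_zero] at htail
  obtain ⟨n, hn⟩ := (htail.eventually (ge_mem_nhds (pos_iff_ne_zero.2 hε))).exists
  refine ⟨n + 1, by positivity, ?_⟩
  set a := (Metric.closedBall (0 : Space d) ((n : ℝ) + 1)).indicator û with ha
  have ha2 : MemLp a 2 := hm.indicator measurableSet_closedBall
  have ha1 : Integrable a := by
    rw [ha, integrable_indicator_iff measurableSet_closedBall]
    exact (hm.locallyIntegrable (by norm_num)).integrableOn_isCompact (isCompact_closedBall _ _)
  have e : u - 𝓕⁻ (ha2.toLp a) = 𝓕⁻ (û - ha2.toLp a) := by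
    have := map_sub (Lp.fourierTransformₗᵢ (Space d) (CSpace d)).symm û (ha2.toLp a)
    rw [show 𝓕⁻ (û - ha2.toLp a) = 𝓕⁻ û - 𝓕⁻ (ha2.toLp a) from this, hû,
      FourierTransform.fourierInv_fourier_eq]
  have e1 : ∫⁻ x, ‖u x - 𝓕⁻ a x‖ₑ ^ 2 = ‖u - 𝓕⁻ (ha2.toLp a)‖ₑ ^ 2 := by
    rw [← lintegral_enorm_sq_coeFn]
    refine lintegral_congr_ae ?_
    filter_upwards [Lp.coeFn_sub u (𝓕⁻ (ha2.toLp a)), coeFn_fourierInv_toLp ha1 ha2] with x h1 h2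
    rw [h1, Pi.sub_apply, h2]
  have e2 : ∫⁻ ξ, ‖û ξ - a ξ‖ₑ ^ 2 = ‖û - ha2.toLp a‖ₑ ^ 2 := by
    rw [← lintegral_enorm_sq_coeFn]
    refine lintegral_congr_ae ?_
    filter_upwards [Lp.coeFn_sub û (ha2.toLp a), ha2.coeFn_toLp] with x h1 h2
    rw [h1, Pi.sub_apply, h2]
  have e3 : ‖(𝓕⁻ (û - ha2.toLp a) : Lp (CSpace d) 2 (volume : Measure (Space d)))‖ₑ
      = ‖û - ha2.toLp a‖ₑ := by
    rw [← ofReal_norm, ← ofReal_norm, ← Lp.norm_fourier_eq (𝓕⁻ (û - ha2.toLp a)),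
      FourierTransform.fourier_fourierInv_eq]
  rw [e1, e, e3, ← e2]
  exact hn

/-- The weighted energy in terms of the Fourier transform with kernel `e^{-2πi ξ·x}`. -/
theorem exists_lintegral_fourier_eq_weightedEnergy (d : ℕ) : ∃ c : ℝ, 0 < c ∧
    ∀ (f : Space d → ℝ) (F : Space d → Space d) (hF : MemLp F 2 volume),
      ∫⁻ ξ, ENNReal.ofReal (‖ξ‖ ^ (3 / 2 : ℝ) *
        ‖(𝓕 (forceL2 F hF) : Lp (CSpace d) 2 (volume : Measure (Space d))) ξ‖ ^ 2 *
          f ((2 * Real.pi) • ξ)) = ENNReal.ofReal c * weightedEnergy f F hF := by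
  have hpi : 0 < 2 * Real.pi := by positivity
  -- With k = 2πξ, `b` collects the powers of 2π from |k|^{3/2} and from the normalisation of α; the
  -- other factor of the constant below is the Jacobian.
  set b : ℝ := (2 * Real.pi) ^ (3 / 2 : ℝ) * (((2 * Real.pi) ^ d)⁻¹) ^ 2 with hb
  have hb0 : 0 < b := by positivity
  refine ⟨b⁻¹ * |((2 * Real.pi) ^ Module.finrank ℝ (Space d))⁻¹|, by positivity, ?_⟩
  intro f F hF
  set û : Lp (CSpace d) 2 (volume : Measure (Space d)) := 𝓕 (forceL2 F hF) with hû
  set g : Space d → ℝ≥0∞ := fun k =>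
    ENNReal.ofReal (‖k‖ ^ (3 / 2 : ℝ) * ‖forceFourier F hF k‖ ^ 2 * f k) with hg
  have h1 : ∀ ξ : Space d, ENNReal.ofReal (‖ξ‖ ^ (3 / 2 : ℝ) * ‖û ξ‖ ^ 2 *
      f ((2 * Real.pi) • ξ)) = ENNReal.ofReal b⁻¹ * g ((2 * Real.pi) • ξ) := by
    intro ξ
    rw [hg, ← ENNReal.ofReal_mul (by positivity)]
    congr 1
    have : forceFourier F hF ((2 * Real.pi) • ξ) = ((2 * Real.pi) ^ d)⁻¹ • û ξ := by
      rw [forceFourier, smul_smul, inv_mul_cancel₀ hpi.ne', one_smul]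
    rw [this, norm_smul, norm_smul, Real.norm_of_nonneg hpi.le,
      Real.norm_of_nonneg (by positivity : (0 : ℝ) ≤ ((2 * Real.pi) ^ d)⁻¹),
      Real.mul_rpow hpi.le (norm_nonneg _), mul_pow]
    rw [eq_inv_mul_iff_mul_eq₀ hb0.ne', hb]
    ring
  have h2 : ∫⁻ ξ, g ((2 * Real.pi) • ξ) =
      ENNReal.ofReal |((2 * Real.pi) ^ Module.finrank ℝ (Space d))⁻¹| * ∫⁻ k, g k := by
    have e := lintegral_map_equiv g (MeasurableEquiv.smul₀ (2 * Real.pi) hpi.ne' : Space d ≃ᵐ Space d)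
      (μ := volume)
    have e' := Measure.map_addHaar_smul (volume : Measure (Space d)) hpi.ne'
    simp only [MeasurableEquiv.coe_smul₀] at e
    rw [← e, e', lintegral_smul_measure]
    rfl
  simp_rw [h1]
  rw [lintegral_const_mul' _ _ ENNReal.ofReal_ne_top, h2, ← mul_assoc,
    ← ENNReal.ofReal_mul (by positivity)]
  rfl

end FourierL2

/-! ### Plane waves, the damped transport symbol and the gain of a quarter derivative by velocity
averaging -/

section Modes

variable {d : ℕ}

/-- The plane wave `e^{2πi ξ·x}`. -/
noncomputable def planeWave (ξ x : Space d) : ℂ :=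
  Complex.exp (((2 * Real.pi * inner ℝ ξ x : ℝ) : ℂ) * Complex.I)

/-- The inverse time scale over which waves of frequency `ξ` are averaged along trajectories. -/
noncomputable def waveRate (ξ : Space d) : ℝ := √(1 + ‖ξ‖)

/-- The symbol `λ(ξ) + 2πi ξ·v` of the damped transport operator. -/
noncomputable def transportSymbol (ξ v : Space d) : ℂ :=
  (waveRate ξ : ℂ) + ((2 * Real.pi * inner ℝ ξ v : ℝ) : ℂ) * Complex.I

theorem norm_planeWave (ξ x : Space d) : ‖planeWave ξ x‖ = 1 :=
  Complex.norm_exp_ofReal_mul_I _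

theorem continuous_planeWave : Continuous fun q : Space d × Space d => planeWave q.1 q.2 := by
  unfold planeWave; fun_prop

@[fun_prop]
theorem continuous_planeWave_comp {α : Type*} [TopologicalSpace α] {f g : α → Space d}
    (hf : Continuous f) (hg : Continuous g) : Continuous fun x => planeWave (f x) (g x) :=
  Continuous.comp (g := fun q : Space d × Space d => planeWave q.1 q.2) continuous_planeWave
    (hf.prodMk hg)

theorem planeWave_add (ξ x y : Space d) :
    planeWave ξ (x + y) = planeWave ξ x * planeWave ξ y := by
  simp only [planeWave, ← Complex.exp_add, inner_add_right]
  congr 1; push_cast; ring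

theorem continuous_waveRate : Continuous (waveRate (d := d)) := by
  unfold waveRate; fun_prop

@[fun_prop]
theorem continuous_waveRate_comp {α : Type*} [TopologicalSpace α] {f : α → Space d}
    (hf : Continuous f) : Continuous fun x => waveRate (f x) :=
  continuous_waveRate.comp hf

theorem waveRate_sq (ξ : Space d) : waveRate ξ ^ 2 = 1 + ‖ξ‖ := by
  unfold waveRate; exact Real.sq_sqrt (by positivity)

theorem one_le_waveRate (ξ : Space d) : 1 ≤ waveRate ξ := by
  unfold waveRate; rw [Real.one_le_sqrt]; linarith [norm_nonneg ξ]

theorem waveRate_pos (ξ : Space d) : 0 < waveRate ξ := by linarith [one_le_waveRate ξ]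


@[fun_prop]
theorem continuous_transportSymbol_comp {α : Type*} [TopologicalSpace α] {f g : α → Space d}
    (hf : Continuous f) (hg : Continuous g) : Continuous fun x => transportSymbol (f x) (g x) := by
  unfold transportSymbol; fun_prop

theorem norm_transportSymbol_sq (ξ v : Space d) :
    ‖transportSymbol ξ v‖ ^ 2 = waveRate ξ ^ 2 + (2 * Real.pi * inner ℝ ξ v) ^ 2 := by
  rw [← Complex.normSq_eq_norm_sq, transportSymbol, Complex.normSq_add_mul_I]

theorem waveRate_le_norm_transportSymbol (ξ v : Space d) :
    waveRate ξ ≤ ‖transportSymbol ξ v‖ := by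
  refine le_of_sq_le_sq ?_ (norm_nonneg _)
  rw [norm_transportSymbol_sq]; nlinarith [sq_nonneg (2 * Real.pi * inner ℝ ξ v)]

theorem one_le_norm_transportSymbol (ξ v : Space d) : 1 ≤ ‖transportSymbol ξ v‖ :=
  (one_le_waveRate ξ).trans (waveRate_le_norm_transportSymbol ξ v)

theorem transportSymbol_ne_zero (ξ v : Space d) : transportSymbol ξ v ≠ 0 := by
  rw [← norm_pos_iff]; linarith [one_le_norm_transportSymbol ξ v]

@[fun_prop]
theorem continuous_inv_transportSymbol_comp {α : Type*} [TopologicalSpace α] {f g : α → Space d}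
    (hf : Continuous f) (hg : Continuous g) :
    Continuous fun x => (transportSymbol (f x) (g x))⁻¹ :=
  (continuous_transportSymbol_comp hf hg).inv₀ fun _ => transportSymbol_ne_zero _ _

/-- Averaging in velocity: the gain of the free transport operator. -/
theorem lintegral_inv_norm_transportSymbol_sq_le (d : ℕ) (R : ℝ) : ∃ C : ℝ, 0 ≤ C ∧
    ∀ ξ : Space d, ∫⁻ v in Metric.closedBall (0 : Space d) R,
      ENNReal.ofReal ((‖transportSymbol ξ v‖ ^ 2)⁻¹) ≤ ENNReal.ofReal (C / waveRate ξ ^ 3) := by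
  set m : ℝ≥0∞ := volume (Metric.closedBall (0 : Space d) (R + 1)) with hm
  have hmfin : m ≠ ∞ := (isCompact_closedBall _ _).measure_lt_top.ne
  -- The ball is enlarged to radius R + 1 to leave room for translations by vectors of length at
  -- most one. The factor 2 covers both cases: l⁻² ≤ 2l⁻³ if |ξ| ≤ 1, and (2l|ξ|)⁻¹ ≤ 2l⁻³ if |ξ| >
  -- 1.
  refine ⟨2 * m.toReal, by positivity, fun ξ => ?_⟩
  set l := waveRate ξ with hl
  have hl1 : 1 ≤ l := one_le_waveRate ξ
  have hl0 : 0 < l := by linarith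
  have hmul : ∀ c : ℝ, 0 ≤ c → c ≤ 2 / l ^ 3 → ENNReal.ofReal c * m ≤
      ENNReal.ofReal (2 * m.toReal / l ^ 3) := by
    intro c hc0 hc
    rw [← ENNReal.ofReal_toReal hmfin, ← ENNReal.ofReal_mul hc0, ENNReal.toReal_ofReal (by positivity)]
    refine ENNReal.ofReal_le_ofReal ?_
    calc c * m.toReal ≤ 2 / l ^ 3 * m.toReal := by gcongr
      _ = _ := by ring
  rcases le_or_gt ‖ξ‖ 1 with hξ | hξ
  · calc ∫⁻ v in Metric.closedBall (0 : Space d) R, ENNReal.ofReal ((‖transportSymbol ξ v‖ ^ 2)⁻¹)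
        ≤ ∫⁻ v in Metric.closedBall (0 : Space d) R, ENNReal.ofReal ((l ^ 2)⁻¹) := by
          refine lintegral_mono fun v => ENNReal.ofReal_le_ofReal ?_
          have := waveRate_le_norm_transportSymbol ξ v
          gcongr
      _ ≤ ENNReal.ofReal ((l ^ 2)⁻¹) * m := by
          rw [setLIntegral_const]
          gcongr
          exact measure_mono (Metric.closedBall_subset_closedBall (by linarith))
      _ ≤ _ := by
          refine hmul _ (by positivity) ?_
          have : l ≤ 2 := by nlinarith [waveRate_sq ξ]
          rw [inv_eq_one_div, div_le_div_iff₀ (by positivity) (by positivity)]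
          nlinarith [pow_pos hl0 2]
  · have hξ0 : 0 < ‖ξ‖ := by linarith
    set e : Space d := ‖ξ‖⁻¹ • ξ with he
    have hinner : inner ℝ ξ e = ‖ξ‖ := by
      rw [he, inner_smul_right, real_inner_self_eq_norm_sq]; field_simp
    have hnorm : ‖e‖ = 1 := by
      rw [he, norm_smul, norm_inv, norm_norm, inv_mul_cancel₀ hξ0.ne']
    set h : ℝ → ℝ := fun u => (l ^ 2 + (2 * Real.pi * u) ^ 2)⁻¹ with hh
    have hsym : ∀ v, (‖transportSymbol ξ v‖ ^ 2)⁻¹ = h (inner ℝ ξ v) := fun v => by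
      rw [norm_transportSymbol_sq]
    have hhc : Continuous h := by
      refine Continuous.inv₀ (by fun_prop) fun u => by positivity
    -- On a line parallel to ξ the integrand is a rescaled 1/(1+u²), whose integral over the line is
    -- explicit.
    have hline : ∀ c : ℝ, ∫⁻ s, ENNReal.ofReal (h (c + s * ‖ξ‖)) =
        ENNReal.ofReal ((2 * l * ‖ξ‖)⁻¹) := by
      intro c
      have hp : (2 * Real.pi * ‖ξ‖ / l) ≠ 0 := by positivity
      have hform : ∀ s, h (c + s * ‖ξ‖) = (l ^ 2)⁻¹ *
          (1 + (2 * Real.pi * c / l + (2 * Real.pi * ‖ξ‖ / l) * s) ^ 2)⁻¹ := by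
        intro s
        rw [hh, ← mul_inv]; field_simp
      have hint : Integrable fun s : ℝ => (1 + (2 * Real.pi * c / l + (2 * Real.pi * ‖ξ‖ / l) * s) ^ 2)⁻¹ :=
        ((integrable_inv_one_add_sq).comp_add_left (2 * Real.pi * c / l)).comp_mul_left' hp
      simp_rw [hform]
      rw [← ofReal_integral_eq_lintegral_ofReal (hint.const_mul _)
        (Eventually.of_forall fun s => by positivity), integral_const_mul,
        Measure.integral_comp_mul_left (fun y => (1 + (2 * Real.pi * c / l + y) ^ 2)⁻¹),
        integral_add_left_eq_self (fun y => (1 + y ^ 2)⁻¹), integral_univ_inv_one_add_sq,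
        abs_of_pos (by positivity), smul_eq_mul]
      congr 1
      field_simp
    -- Averaging over translations by s·e, with s in [0,1], produces an integral along the direction
    -- of ξ without splitting ℝ^d into a line and its orthogonal complement.
    have hshift : ∀ s ∈ Set.Icc (0 : ℝ) 1, ∫⁻ v in Metric.closedBall (0 : Space d) R,
        ENNReal.ofReal (h (inner ℝ ξ v)) ≤ ∫⁻ v in Metric.closedBall (0 : Space d) (R + 1),
        ENNReal.ofReal (h (inner ℝ ξ v + s * ‖ξ‖)) := by
      intro s hs
      rw [← lintegral_indicator measurableSet_closedBall,
        ← lintegral_indicator measurableSet_closedBall,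
        ← lintegral_add_right_eq_self _ (s • e)]
      refine lintegral_mono fun v => ?_
      by_cases hv : v + s • e ∈ Metric.closedBall (0 : Space d) R
      · have hv' : v ∈ Metric.closedBall (0 : Space d) (R + 1) := by
          simp only [Metric.mem_closedBall, dist_zero_right] at hv ⊢
          calc ‖v‖ = ‖(v + s • e) - s • e‖ := by simp
            _ ≤ ‖v + s • e‖ + ‖s • e‖ := norm_sub_le _ _
            _ ≤ R + 1 := by
              rw [norm_smul, hnorm, Real.norm_of_nonneg hs.1]; linarith [hs.2]
        rw [Set.indicator_of_mem hv, Set.indicator_of_mem hv', inner_add_right, inner_smul_right,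
          hinner]
      · rw [Set.indicator_of_notMem hv]; exact zero_le
    simp_rw [hsym]
    calc ∫⁻ v in Metric.closedBall (0 : Space d) R, ENNReal.ofReal (h (inner ℝ ξ v))
        = ∫⁻ _ in Set.Icc (0 : ℝ) 1, ∫⁻ v in Metric.closedBall (0 : Space d) R,
            ENNReal.ofReal (h (inner ℝ ξ v)) := by
          rw [setLIntegral_const, Real.volume_Icc]; norm_num
      _ ≤ ∫⁻ s in Set.Icc (0 : ℝ) 1, ∫⁻ v in Metric.closedBall (0 : Space d) (R + 1),
            ENNReal.ofReal (h (inner ℝ ξ v + s * ‖ξ‖)) :=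
          setLIntegral_mono' measurableSet_Icc hshift
      _ = ∫⁻ v in Metric.closedBall (0 : Space d) (R + 1), ∫⁻ s in Set.Icc (0 : ℝ) 1,
            ENNReal.ofReal (h (inner ℝ ξ v + s * ‖ξ‖)) := by
          refine lintegral_lintegral_swap (Measurable.aemeasurable ?_)
          refine ENNReal.measurable_ofReal.comp (Continuous.measurable ?_)
          exact hhc.comp (by fun_prop :
            Continuous fun q : ℝ × Space d => inner ℝ ξ q.2 + q.1 * ‖ξ‖)
      _ ≤ ∫⁻ v in Metric.closedBall (0 : Space d) (R + 1), ENNReal.ofReal ((2 * l * ‖ξ‖)⁻¹) := by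
          refine lintegral_mono fun v => ?_
          rw [← hline (inner ℝ ξ v)]
          exact setLIntegral_le_lintegral _ _
      _ = ENNReal.ofReal ((2 * l * ‖ξ‖)⁻¹) * m := by rw [setLIntegral_const]
      _ ≤ _ := by
          refine hmul _ (by positivity) ?_
          rw [inv_eq_one_div, div_le_div_iff₀ (by positivity) (by positivity)]
          have : l ^ 2 = 1 + ‖ξ‖ := waveRate_sq ξ
          have : l ^ 3 = l * (1 + ‖ξ‖) := by rw [← this]; ring
          rw [this]; nlinarith

attribute [irreducible] planeWave waveRate transportSymbol

/-- A square integrable frequency profile with bounded support. -/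
structure BandLimited (a : Space d → CSpace d) : Prop where
  measurable : Measurable a
  memLp : MemLp a 2
  exists_support : ∃ K : ℝ, ∀ ξ, K < ‖ξ‖ → a ξ = 0

/-- Bounded frequency support makes every polynomial weight harmless: modes converge absolutely, are
continuous and may be differentiated under the integral. The size of the support never enters the
quantitative estimates. -/
theorem BandLimited.integrable_pow_norm {a : Space d → CSpace d} (ha : BandLimited a) (n : ℕ) :
    Integrable fun ξ => (1 + ‖ξ‖) ^ n * ‖a ξ‖ := by
  obtain ⟨K, hK⟩ := ha.exists_support
  have hsupp : ∀ ξ, ξ ∉ Metric.closedBall (0 : Space d) K → (1 + ‖ξ‖) ^ n * ‖a ξ‖ = 0 := by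
    intro ξ hξ
    rw [hK ξ (by simpa using hξ)]; simp
  rw [← integrableOn_iff_integrable_of_support_subset
    (fun ξ hξ => by by_contra h; exact hξ (hsupp ξ h))]
  have h1 : IntegrableOn (fun ξ => ‖a ξ‖) (Metric.closedBall (0 : Space d) K) :=
    ((ha.memLp.locallyIntegrable (by norm_num)).integrableOn_isCompact
      (isCompact_closedBall _ _)).norm
  exact h1.continuousOn_mul (by fun_prop) (isCompact_closedBall _ _)

theorem BandLimited.integrable {a : Space d → CSpace d} (ha : BandLimited a) : Integrable a := by
  have := ha.integrable_pow_norm 0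
  simp only [pow_zero, one_mul] at this
  exact (integrable_norm_iff ha.measurable.aestronglyMeasurable).1 this

/-- The superposition of the plane waves of profile `a` with symbol `b`. -/
noncomputable def mode (a : Space d → CSpace d) (b : Space d → ℂ) (x : Space d) : CSpace d :=
  ∫ ξ, (b ξ * planeWave ξ x) • a ξ

theorem mode_eq_fourierInv (a : Space d → CSpace d) (b : Space d → ℂ) (x : Space d) :
    mode a b x = 𝓕⁻ (fun ξ => b ξ • a ξ) x := by
  rw [Real.fourierInv_eq', mode]
  refine integral_congr_ae (Eventually.of_forall fun ξ => ?_)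
  simp only [planeWave, smul_smul]
  rw [mul_comm]

theorem BandLimited.integrable_smul {a : Space d → CSpace d} (ha : BandLimited a)
    {β : Space d → ℂ} (hβ : Measurable β) {M : ℝ} {n : ℕ}
    (hM : ∀ ξ, ‖β ξ‖ ≤ M * (1 + ‖ξ‖) ^ n) : Integrable fun ξ => β ξ • a ξ := by
  refine ((ha.integrable_pow_norm n).const_mul M).mono'
    (hβ.smul ha.measurable).aestronglyMeasurable (Eventually.of_forall fun ξ => ?_)
  rw [norm_smul, ← mul_assoc]
  gcongr
  exact hM ξ

theorem BandLimited.integrable_mode {a : Space d → CSpace d} (ha : BandLimited a)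
    {b : Space d → ℂ} (hb : Measurable b) {M : ℝ} {n : ℕ}
    (hM : ∀ ξ, ‖b ξ‖ ≤ M * (1 + ‖ξ‖) ^ n) (x : Space d) :
    Integrable fun ξ => (b ξ * planeWave ξ x) • a ξ := by
  refine ha.integrable_smul (M := M) (n := n)
    (hb.mul (by fun_prop : Continuous fun ξ => planeWave ξ x).measurable) ?_
  intro ξ
  rw [norm_mul, norm_planeWave, mul_one]; exact hM ξ

theorem BandLimited.continuous_mode {a : Space d → CSpace d} (ha : BandLimited a)
    {b : Space d → Space d → ℂ} (hb : Continuous fun q : Space d × Space d => b q.1 q.2)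
    {M : ℝ} {n : ℕ} (hM : ∀ ξ v, ‖b ξ v‖ ≤ M * (1 + ‖ξ‖) ^ n) :
    Continuous fun z : Space d × Space d => mode a (fun ξ => b ξ z.2) z.1 := by
  unfold mode
  refine continuous_of_dominated (bound := fun ξ => M * ((1 + ‖ξ‖) ^ n * ‖a ξ‖)) ?_ ?_
    ((ha.integrable_pow_norm n).const_mul M) ?_
  · intro z
    have h1 : Continuous fun ξ => b ξ z.2 := hb.comp (by fun_prop : Continuous fun ξ => (ξ, z.2))
    exact (ha.integrable_mode h1.measurable (fun ξ => hM ξ z.2) z.1).aestronglyMeasurable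
  · intro z
    refine Eventually.of_forall fun ξ => ?_
    rw [norm_smul, norm_mul, norm_planeWave, mul_one, ← mul_assoc]
    gcongr
    exact hM ξ z.2
  · refine Eventually.of_forall fun ξ => ?_
    have h1 : Continuous fun z : Space d × Space d => b ξ z.2 :=
      hb.comp (by fun_prop : Continuous fun z : Space d × Space d => (ξ, z.2))
    have h2 : Continuous fun z : Space d × Space d => planeWave ξ z.1 := by fun_prop
    exact (h1.mul h2).smul continuous_const

/-- Plancherel's identity for superpositions of plane waves. -/
theorem BandLimited.lintegral_enorm_mode_sq {a : Space d → CSpace d} (ha : BandLimited a)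
    {b : Space d → ℂ} (hb : Measurable b) {M : ℝ} {n : ℕ}
    (hM : ∀ ξ, ‖b ξ‖ ≤ M * (1 + ‖ξ‖) ^ n) :
    ∫⁻ x, ‖mode a b x‖ₑ ^ 2 = ∫⁻ ξ, ‖b ξ‖ₑ ^ 2 * ‖a ξ‖ₑ ^ 2 := by
  have h2 : MemLp (fun ξ => b ξ • a ξ) 2 := by
    obtain ⟨K, hK⟩ := ha.exists_support
    refine ha.memLp.of_le_mul (c := |M| * (1 + |K|) ^ n) (hb.smul ha.measurable).aestronglyMeasurable
      (Eventually.of_forall fun ξ => ?_)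
    rw [norm_smul]
    by_cases h : K < ‖ξ‖
    · simp [hK ξ h]
    · gcongr
      refine (hM ξ).trans ?_
      gcongr
      · exact le_abs_self M
      · exact (not_lt.1 h).trans (le_abs_self K)
  simp_rw [mode_eq_fourierInv]
  rw [lintegral_enorm_fourierInv_sq (ha.integrable_smul hb hM) h2]
  simp_rw [enorm_smul, mul_pow]

/-- Lebesgue measure on the part of phase space with bounded velocities. -/
noncomputable def phaseMeasure (d : ℕ) (R : ℝ) : Measure (Space d × Space d) :=
  volume.prod (volume.restrict (Metric.closedBall 0 R))

instance (R : ℝ) : SFinite (phaseMeasure d R) := by unfold phaseMeasure; infer_instance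

/-- The symbols obtained from `‖ξ‖ λ / (λ + 2πi ξ·v)` lose only `3/4` of a derivative in `L²` of
phase space. -/
theorem exists_lintegral_mode_sq_le (d : ℕ) (R : ℝ) : ∃ C : ℝ, 0 ≤ C ∧
    ∀ (a : Space d → CSpace d), BandLimited a → ∀ (b : Space d → Space d → ℂ),
      (Continuous fun q : Space d × Space d => b q.1 q.2) → ∀ M : ℝ, 0 ≤ M →
      (∀ ξ v, ‖b ξ v‖ ≤ M * (‖ξ‖ * waveRate ξ / ‖transportSymbol ξ v‖)) →
      ∫⁻ z, ‖mode a (fun ξ => b ξ z.2) z.1‖ₑ ^ 2 ∂(phaseMeasure d R) ≤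
        ENNReal.ofReal (M ^ 2 * C) * ∫⁻ ξ, ENNReal.ofReal (‖ξ‖ ^ (3 / 2 : ℝ) * ‖a ξ‖ ^ 2) := by
  obtain ⟨C, hC0, hC⟩ := lintegral_inv_norm_transportSymbol_sq_le d R
  refine ⟨C, hC0, fun a ha b hb M hM0 hM => ?_⟩
  -- This crude bound is used for integrability and continuity only.
  have hM1 : ∀ ξ v, ‖b ξ v‖ ≤ M * (1 + ‖ξ‖) ^ 1 := by
    intro ξ v
    refine (hM ξ v).trans ?_
    gcongr
    rw [div_le_iff₀ (by linarith [one_le_norm_transportSymbol ξ v]), pow_one]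
    have := waveRate_le_norm_transportSymbol ξ v
    have := waveRate_pos ξ
    gcongr
    linarith
  have hbv : ∀ v, Measurable fun ξ => b ξ v := fun v =>
    (hb.comp (by fun_prop : Continuous fun ξ => (ξ, v))).measurable
  have hcont := ha.continuous_mode hb hM1
  -- At frozen v the mode is an inverse Fourier transform in x, so Plancherel applies; the integrals
  -- are then exchanged in order to average in v at frozen ξ.
  rw [phaseMeasure, lintegral_prod_symm _ ((hcont.measurable.enorm.pow_const 2).aemeasurable)]
  simp_rw [ha.lintegral_enorm_mode_sq (hbv _) (fun ξ => hM1 ξ _)]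
  rw [lintegral_lintegral_swap]
  swap
  · refine Measurable.aemeasurable ?_
    simp only [Function.uncurry_def]
    have h1 : Measurable fun q : Space d × Space d => b q.2 q.1 :=
      (hb.comp continuous_swap).measurable
    exact (h1.enorm.pow_const 2).mul ((ha.measurable.comp measurable_snd).enorm.pow_const 2)
  rw [← lintegral_const_mul' _ _ ENNReal.ofReal_ne_top]
  refine lintegral_mono fun ξ => ?_
  have hl := waveRate_pos ξ
  calc ∫⁻ v in Metric.closedBall 0 R, ‖b ξ v‖ₑ ^ 2 * ‖a ξ‖ₑ ^ 2
      ≤ ∫⁻ v in Metric.closedBall 0 R, ENNReal.ofReal (M ^ 2 * ‖ξ‖ ^ 2 * waveRate ξ ^ 2 *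
          ‖a ξ‖ ^ 2) * ENNReal.ofReal ((‖transportSymbol ξ v‖ ^ 2)⁻¹) := by
        refine lintegral_mono fun v => ?_
        rw [← ENNReal.ofReal_mul (by positivity), ← ofReal_norm, ← ofReal_norm,
          ← ENNReal.ofReal_pow (norm_nonneg _), ← ENNReal.ofReal_pow (norm_nonneg _),
          ← ENNReal.ofReal_mul (by positivity)]
        refine ENNReal.ofReal_le_ofReal ?_
        calc ‖b ξ v‖ ^ 2 * ‖a ξ‖ ^ 2
            ≤ (M * (‖ξ‖ * waveRate ξ / ‖transportSymbol ξ v‖)) ^ 2 * ‖a ξ‖ ^ 2 := by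
              gcongr; exact hM ξ v
          _ = _ := by rw [div_eq_mul_inv]; ring
    _ ≤ ENNReal.ofReal (M ^ 2 * ‖ξ‖ ^ 2 * waveRate ξ ^ 2 * ‖a ξ‖ ^ 2) *
          ENNReal.ofReal (C / waveRate ξ ^ 3) := by
        rw [lintegral_const_mul' _ _ ENNReal.ofReal_ne_top]
        gcongr
        exact hC ξ
    _ ≤ _ := by
        rw [← ENNReal.ofReal_mul (by positivity), ← ENNReal.ofReal_mul (by positivity)]
        refine ENNReal.ofReal_le_ofReal ?_
        -- The exponent 3/2 comes from λ ≥ |ξ|^{1/2}.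
        have key : ‖ξ‖ ^ 2 / waveRate ξ ≤ ‖ξ‖ ^ (3 / 2 : ℝ) := by
          rcases (norm_nonneg ξ).eq_or_lt with h | h
          · rw [← h]; simp
          rw [div_le_iff₀ hl]
          have h1 : ‖ξ‖ ^ (1 / 2 : ℝ) ≤ waveRate ξ := by
            rw [waveRate, ← Real.sqrt_eq_rpow]
            exact Real.sqrt_le_sqrt (by linarith)
          calc ‖ξ‖ ^ 2 = ‖ξ‖ ^ (3 / 2 : ℝ) * ‖ξ‖ ^ (1 / 2 : ℝ) := by
                rw [← Real.rpow_add h, ← Real.rpow_natCast]; norm_num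
            _ ≤ _ := by gcongr
        calc M ^ 2 * ‖ξ‖ ^ 2 * waveRate ξ ^ 2 * ‖a ξ‖ ^ 2 * (C / waveRate ξ ^ 3)
            = M ^ 2 * C * ((‖ξ‖ ^ 2 / waveRate ξ) * ‖a ξ‖ ^ 2) := by field_simp
          _ ≤ _ := by gcongr

end Modes

/-! ### The corrector identity for one plane wave -/

section Paths

variable {d : ℕ}

/-- The fundamental theorem of calculus for absolutely continuous functions. -/
theorem AbsolutelyContinuousOnInterval.integral_eq_sub_of_ae_hasDerivAt {E : Type*}
    [NormedAddCommGroup E] [NormedSpace ℝ E] [CompleteSpace E] {f g : ℝ → E} {a b M : ℝ}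
    (hf : AbsolutelyContinuousOnInterval f a b) (hg : IntervalIntegrable g volume a b)
    (hM : ∀ s ∈ Set.uIcc a b, ‖g s‖ ≤ M)
    (hd : ∀ᵐ s, s ∈ Set.uIcc a b → HasDerivAt f (g s) s) :
    ∫ s in a..b, g s = f b - f a := by
  have hsub : ∀ x ∈ Set.uIcc a b, ∀ y ∈ Set.uIcc a b, IntervalIntegrable g volume x y :=
    fun x hx y hy => hg.mono_set (Set.uIcc_subset_uIcc hx hy)
  have hG : AbsolutelyContinuousOnInterval (fun x => ∫ s in a..x, g s) a b := by
    refine LipschitzOnWith.absolutelyContinuousOnInterval (K := M.toNNReal) ?_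
    refine LipschitzOnWith.of_dist_le_mul fun x hx y hy => ?_
    have hM0 : 0 ≤ M := (norm_nonneg _).trans (hM x hx)
    rw [dist_eq_norm, intervalIntegral.integral_interval_sub_left
      (hsub a Set.left_mem_uIcc x hx) (hsub a Set.left_mem_uIcc y hy), Real.coe_toNNReal _ hM0,
      Real.dist_eq]
    refine intervalIntegral.norm_integral_le_of_norm_le_const fun s hs => hM s ?_
    exact Set.uIcc_subset_uIcc hy hx (Set.uIoc_subset_uIcc hs)
  obtain ⟨C, hC⟩ := (hf.sub hG).const_of_ae_hasDerivAt_zero (by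
    filter_upwards [hd, hg.ae_hasDerivAt_integral] with s h1 h2 hs
    simpa using (h1 hs).sub (h2 hs a Set.left_mem_uIcc))
  have ha := hC a Set.left_mem_uIcc
  have hb := hC b Set.right_mem_uIcc
  simp only [Pi.sub_apply, intervalIntegral.integral_same, sub_zero] at ha hb
  rw [ha, ← hb]; abel

/-- `V` has the bounded measurable derivative `Φ`. -/
structure BoundedAcceleration (A : ℝ) (V Φ : ℝ → Space d) : Prop where
  measurable : Measurable Φ
  norm_le : ∀ s, ‖Φ s‖ ≤ A
  eq_integral : ∀ t, V t = V 0 + ∫ s in (0 : ℝ)..t, Φ s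

namespace BoundedAcceleration

variable {A : ℝ} {V Φ : ℝ → Space d}

theorem locallyIntegrable (h : BoundedAcceleration A V Φ) : LocallyIntegrable Φ :=
  (locallyIntegrable_const A).mono h.measurable.aestronglyMeasurable
    (Eventually.of_forall fun s => (h.norm_le s).trans (le_abs_self A))

theorem intervalIntegrable (h : BoundedAcceleration A V Φ) (s t : ℝ) :
    IntervalIntegrable Φ volume s t :=
  (intervalIntegrable_const (c := A)).mono_fun h.measurable.aestronglyMeasurable
    (Eventually.of_forall fun s => (h.norm_le s).trans (le_abs_self A))

theorem norm_sub_le (h : BoundedAcceleration A V Φ) (s t : ℝ) :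
    ‖V s - V t‖ ≤ A * |s - t| := by
  rw [h.eq_integral s, h.eq_integral t, add_sub_add_left_eq_sub,
    intervalIntegral.integral_interval_sub_left (h.intervalIntegrable _ _)
      (h.intervalIntegrable _ _)]
  exact intervalIntegral.norm_integral_le_of_norm_le_const fun r _ => h.norm_le r

theorem continuous (h : BoundedAcceleration A V Φ) : Continuous V := by
  refine (LipschitzWith.of_dist_le_mul (K := A.toNNReal) fun s t => ?_).continuous
  rw [dist_eq_norm, Real.coe_toNNReal _ ((norm_nonneg _).trans (h.norm_le 0)), Real.dist_eq]
  exact h.norm_sub_le s t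

theorem ae_hasDerivAt (h : BoundedAcceleration A V Φ) : ∀ᵐ s, HasDerivAt V (Φ s) s := by
  filter_upwards [_root_.LocallyIntegrable.ae_hasDerivAt_integral h.locallyIntegrable] with s hs
  have := (hs 0).const_add (V 0)
  rwa [show V = fun t => V 0 + ∫ s in (0 : ℝ)..t, Φ s from funext h.eq_integral]

end BoundedAcceleration

/-- The symbol of the `l`-th partial derivative. -/
noncomputable def derivSymbol (l : Fin d) (ξ : Space d) : ℂ :=
  ((2 * Real.pi * ξ l : ℝ) : ℂ) * Complex.I

theorem continuous_derivSymbol (l : Fin d) : Continuous (derivSymbol l) := by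
  unfold derivSymbol; fun_prop

@[fun_prop]
theorem continuous_derivSymbol_comp {α : Type*} [TopologicalSpace α] {f : α → Space d}
    (hf : Continuous f) (l : Fin d) : Continuous fun x => derivSymbol l (f x) :=
  (continuous_derivSymbol l).comp hf

theorem norm_derivSymbol_le (l : Fin d) (ξ : Space d) :
    ‖derivSymbol l ξ‖ ≤ 2 * Real.pi * ‖ξ‖ := by
  rw [derivSymbol, norm_mul, Complex.norm_I, mul_one, Complex.norm_real, norm_mul,
    Real.norm_of_nonneg (by positivity)]
  gcongr
  exact PiLp.norm_apply_le ξ l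

theorem inner_mul_I_eq_sum (ξ y : Space d) :
    ((2 * Real.pi * inner ℝ ξ y : ℝ) : ℂ) * Complex.I = ∑ l, (y l : ℂ) * derivSymbol l ξ := by
  simp only [derivSymbol, PiLp.inner_apply, RCLike.inner_apply, conj_trivial]
  push_cast
  rw [Finset.mul_sum, Finset.sum_mul]
  refine Finset.sum_congr rfl fun l _ => by ring

theorem hasDerivAt_planeWave {Y : ℝ → Space d} {y : Space d} {s : ℝ} (hY : HasDerivAt Y y s)
    (ξ : Space d) : HasDerivAt (fun s => planeWave ξ (Y s))
      ((((2 * Real.pi * inner ℝ ξ y : ℝ) : ℂ) * Complex.I) * planeWave ξ (Y s)) s := by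
  have h1 : HasDerivAt (fun s => inner ℝ ξ (Y s)) (inner ℝ ξ y) s := by
    simpa using (hasDerivAt_const s ξ).inner ℝ hY
  have h2 := (((h1.const_mul (2 * Real.pi)).ofReal_comp).mul_const Complex.I).cexp
  simp only [planeWave]
  exact h2.congr_deriv (mul_comm _ _)

theorem hasDerivAt_transportSymbol {V : ℝ → Space d} {y : Space d} {s : ℝ} (hV : HasDerivAt V y s)
    (ξ : Space d) : HasDerivAt (fun s => transportSymbol ξ (V s))
      (((2 * Real.pi * inner ℝ ξ y : ℝ) : ℂ) * Complex.I) s := by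
  have h1 : HasDerivAt (fun s => inner ℝ ξ (V s)) (inner ℝ ξ y) s := by
    simpa using (hasDerivAt_const s ξ).inner ℝ hV
  simp only [transportSymbol]
  exact (((h1.const_mul (2 * Real.pi)).ofReal_comp).mul_const Complex.I).const_add _

/-- A velocity with bounded measurable acceleration is only Lipschitz in time, so this is the
regularity that makes the reciprocal of the symbol absolutely continuous along a path. -/
theorem lipschitzWith_inv_transportSymbol (ξ : Space d) :
    LipschitzWith (2 * Real.pi * ‖ξ‖).toNNReal fun v => (transportSymbol ξ v)⁻¹ := by
  refine LipschitzWith.of_dist_le_mul fun v w => ?_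
  rw [Real.coe_toNNReal _ (by positivity), dist_eq_norm, dist_eq_norm,
    inv_sub_inv (transportSymbol_ne_zero _ _) (transportSymbol_ne_zero _ _), norm_div, norm_mul]
  have h1 := one_le_norm_transportSymbol ξ v
  have h2 := one_le_norm_transportSymbol ξ w
  have h3 : transportSymbol ξ w - transportSymbol ξ v =
      ((2 * Real.pi * inner ℝ ξ (w - v) : ℝ) : ℂ) * Complex.I := by
    rw [inner_sub_right]; simp only [transportSymbol]; push_cast; ring
  refine (div_le_self (norm_nonneg _) (by nlinarith)).trans ?_
  rw [h3, norm_mul, Complex.norm_I, mul_one, Complex.norm_real, norm_mul,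
    Real.norm_of_nonneg (by positivity : 0 ≤ 2 * Real.pi), norm_sub_rev v w]
  calc 2 * Real.pi * ‖(inner ℝ ξ (w - v) : ℝ)‖ ≤ 2 * Real.pi * (‖ξ‖ * ‖w - v‖) := by
        gcongr; exact norm_inner_le_norm (𝕜 := ℝ) ξ (w - v)
    _ = _ := by ring

/-- The corrector identity for one plane wave along a path. -/
theorem planeWave_path_identity {A : ℝ} {Y V η Φ : ℝ → Space d}
    (hV : BoundedAcceleration A V Φ) (hη : Continuous η)
    (hY : ∀ s, HasDerivAt Y (V s + η s) s) (ξ : Space d) (t : ℝ) :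
    ∫ s in (0 : ℝ)..t, (planeWave ξ (Y s)
        - waveRate ξ * (transportSymbol ξ (V s))⁻¹ * planeWave ξ (Y s)
        + ((2 * Real.pi * inner ℝ ξ (η s) : ℝ) : ℂ) * Complex.I * (transportSymbol ξ (V s))⁻¹ *
          planeWave ξ (Y s)
        - ((2 * Real.pi * inner ℝ ξ (Φ s) : ℝ) : ℂ) * Complex.I * (transportSymbol ξ (V s))⁻¹ ^ 2 *
          planeWave ξ (Y s)) =
      planeWave ξ (Y t) * (transportSymbol ξ (V t))⁻¹ -
        planeWave ξ (Y 0) * (transportSymbol ξ (V 0))⁻¹ := by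
  have hYc : Continuous Y := continuous_iff_continuousAt.2 fun s => (hY s).continuousAt
  have hVc := hV.continuous
  have hec : Continuous fun s => planeWave ξ (Y s) := by fun_prop
  have hDc : Continuous fun s => (transportSymbol ξ (V s))⁻¹ := by fun_prop
  have hD1 : ∀ v, ‖(transportSymbol ξ v)⁻¹‖ ≤ 1 := fun v => by
    rw [norm_inv]; exact inv_le_one_of_one_le₀ (one_le_norm_transportSymbol ξ v)
  have hcont : Continuous fun s => planeWave ξ (Y s)
        - waveRate ξ * (transportSymbol ξ (V s))⁻¹ * planeWave ξ (Y s)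
        + ((2 * Real.pi * inner ℝ ξ (η s) : ℝ) : ℂ) * Complex.I * (transportSymbol ξ (V s))⁻¹ *
          planeWave ξ (Y s) := by fun_prop
  have hmeas : Measurable fun s => ((2 * Real.pi * inner ℝ ξ (Φ s) : ℝ) : ℂ) * Complex.I *
      (transportSymbol ξ (V s))⁻¹ ^ 2 * planeWave ξ (Y s) := by
    have := hV.measurable
    have := hDc.measurable
    have := hec.measurable
    have h1 : Measurable fun s => inner ℝ ξ (Φ s) :=
      (by fun_prop : Continuous fun y : Space d => inner ℝ ξ y).measurable.comp hV.measurable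
    fun_prop
  have hbound : ∀ s, ‖((2 * Real.pi * inner ℝ ξ (Φ s) : ℝ) : ℂ) * Complex.I *
      (transportSymbol ξ (V s))⁻¹ ^ 2 * planeWave ξ (Y s)‖ ≤ 2 * Real.pi * (‖ξ‖ * A) := by
    intro s
    rw [norm_mul, norm_planeWave, mul_one, norm_mul, norm_mul, Complex.norm_I, mul_one,
      Complex.norm_real, norm_mul, Real.norm_of_nonneg (by positivity : 0 ≤ 2 * Real.pi), norm_pow]
    refine (mul_le_of_le_one_right (by positivity) (pow_le_one₀ (norm_nonneg _) (hD1 _))).trans ?_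
    gcongr
    exact (norm_inner_le_norm (𝕜 := ℝ) ξ (Φ s)).trans (by gcongr; exact hV.norm_le s)
  obtain ⟨M, hM⟩ := (isCompact_uIcc (a := (0 : ℝ)) (b := t)).exists_bound_of_continuousOn
    hcont.continuousOn
  -- The wave is C¹ along `Y`, because `V + η` is continuous, whereas the reciprocal symbol is
  -- merely Lipschitz along `V`.
  have hf : AbsolutelyContinuousOnInterval
      (fun s => planeWave ξ (Y s) * (transportSymbol ξ (V s))⁻¹) 0 t := by
    refine AbsolutelyContinuousOnInterval.smul (f := fun s => planeWave ξ (Y s))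
      (g := fun s => (transportSymbol ξ (V s))⁻¹) ?_ ?_
    · refine ContDiffOn.absolutelyContinuousOnInterval (ContDiff.contDiffOn ?_)
      rw [contDiff_one_iff_deriv]
      refine ⟨fun s => (hasDerivAt_planeWave (hY s) ξ).differentiableAt, ?_⟩
      rw [show deriv (fun s => planeWave ξ (Y s)) = _ from
        funext fun s => (hasDerivAt_planeWave (hY s) ξ).deriv]
      fun_prop
    · have hl : LipschitzWith A.toNNReal V := LipschitzWith.of_dist_le_mul fun s t => by
        rw [dist_eq_norm, Real.coe_toNNReal _ ((norm_nonneg _).trans (hV.norm_le 0)), Real.dist_eq]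
        exact hV.norm_sub_le s t
      exact (((lipschitzWith_inv_transportSymbol ξ).comp hl).lipschitzOnWith
        (s := Set.uIcc 0 t)).absolutelyContinuousOnInterval
  refine hf.integral_eq_sub_of_ae_hasDerivAt (M := M + 2 * Real.pi * (‖ξ‖ * A)) ?_ ?_ ?_
  · refine (hcont.intervalIntegrable 0 t).sub ?_
    exact (intervalIntegrable_const (c := 2 * Real.pi * (‖ξ‖ * A))).mono_fun
      hmeas.aestronglyMeasurable
      (Eventually.of_forall fun s => (hbound s).trans (le_abs_self _))
  · intro s hs
    exact (norm_sub_le _ _).trans (add_le_add (hM s hs) (hbound s))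
  · filter_upwards [hV.ae_hasDerivAt] with s hs _
    have h1 := (hasDerivAt_planeWave (hY s) ξ).mul
      ((hasDerivAt_transportSymbol hs ξ).inv (transportSymbol_ne_zero _ _))
    refine h1.congr_deriv ?_
    have hD := transportSymbol_ne_zero ξ (V s)
    -- The transport term is the symbol minus its rate; multiplied by the reciprocal symbol it gives
    -- back the wave itself minus the rate term.
    have h2 : ((2 * Real.pi * inner ℝ ξ (V s) : ℝ) : ℂ) * Complex.I =
        transportSymbol ξ (V s) - waveRate ξ := by simp [transportSymbol]
    have h3 : ((2 * Real.pi * inner ℝ ξ (V s + η s) : ℝ) : ℂ) * Complex.I =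
        transportSymbol ξ (V s) - waveRate ξ +
          ((2 * Real.pi * inner ℝ ξ (η s) : ℝ) : ℂ) * Complex.I := by
      rw [← h2, inner_add_right]; push_cast; ring
    rw [h3, Pi.inv_apply]
    field_simp
    ring

end Paths

/-! ### The corrector identity for superpositions of plane waves -/

section ModePaths

variable {d : ℕ}

/-- Fubini's theorem for modes along a path, with a time dependent weight. -/
theorem BandLimited.intervalIntegral_smul_mode {a : Space d → CSpace d} (ha : BandLimited a)
    {b : Space d → Space d → ℂ} (hb : Continuous fun q : Space d × Space d => b q.1 q.2)
    {M : ℝ} {n : ℕ} (hM : ∀ ξ v, ‖b ξ v‖ ≤ M * (1 + ‖ξ‖) ^ n) {Y V : ℝ → Space d}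
    (hY : Continuous Y) (hV : Continuous V) {ρ : ℝ → ℝ} {t : ℝ}
    (hρ : IntervalIntegrable ρ volume 0 t) :
    (Integrable fun ξ => (∫ s in (0 : ℝ)..t, (ρ s : ℂ) * (b ξ (V s) * planeWave ξ (Y s))) • a ξ) ∧
    (IntervalIntegrable (fun s => ρ s • mode a (fun ξ => b ξ (V s)) (Y s)) volume 0 t) ∧
    ∫ ξ, (∫ s in (0 : ℝ)..t, (ρ s : ℂ) * (b ξ (V s) * planeWave ξ (Y s))) • a ξ =
      ∫ s in (0 : ℝ)..t, ρ s • mode a (fun ξ => b ξ (V s)) (Y s) := by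
  set G : ℝ → Space d → CSpace d := fun s ξ =>
    ((ρ s : ℂ) * (b ξ (V s) * planeWave ξ (Y s))) • a ξ with hG
  have hint : Integrable (Function.uncurry G)
      ((volume.restrict (Set.uIoc 0 t)).prod (volume : Measure (Space d))) := by
    have h1 : Integrable (fun q : ℝ × Space d => ‖ρ q.1‖ * (M * ((1 + ‖q.2‖) ^ n * ‖a q.2‖)))
        ((volume.restrict (Set.uIoc 0 t)).prod (volume : Measure (Space d))) :=
      (intervalIntegrable_iff.1 hρ).norm.mul_prod ((ha.integrable_pow_norm n).const_mul M)
    refine h1.mono' ?_ (Eventually.of_forall fun q => ?_)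
    · have hβ : Continuous fun q : ℝ × Space d => b q.2 (V q.1) * planeWave q.2 (Y q.1) := by
        refine (hb.comp (by fun_prop : Continuous fun q : ℝ × Space d => (q.2, V q.1))).mul
          (by fun_prop)
      have hρ' : AEStronglyMeasurable (fun q : ℝ × Space d => (ρ q.1 : ℂ))
          ((volume.restrict (Set.uIoc 0 t)).prod (volume : Measure (Space d))) :=
        (Complex.continuous_ofReal.comp_aestronglyMeasurable
          (intervalIntegrable_iff.1 hρ).aestronglyMeasurable).comp_fst
      exact (hρ'.mul hβ.aestronglyMeasurable).smul
        (ha.measurable.comp measurable_snd).aestronglyMeasurable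
    · simp only [Function.uncurry_def, hG]
      rw [norm_smul, norm_mul, norm_mul, norm_planeWave, mul_one, Complex.norm_real, mul_assoc,
        ← mul_assoc M]
      gcongr
      exact hM _ _
  have hinner : ∀ ξ, (∫ s in (0 : ℝ)..t, (ρ s : ℂ) * (b ξ (V s) * planeWave ξ (Y s))) • a ξ =
      ∫ s in (0 : ℝ)..t, G s ξ := fun ξ => (intervalIntegral.integral_smul_const _ _).symm
  have hmode : ∀ s, ρ s • mode a (fun ξ => b ξ (V s)) (Y s) = ∫ ξ, G s ξ := by
    intro s
    rw [mode, ← integral_smul]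
    refine integral_congr_ae (Eventually.of_forall fun ξ => ?_)
    simp only [hG]
    rw [mul_smul (ρ s : ℂ), Complex.coe_smul]
  simp_rw [hinner, hmode]
  refine ⟨?_, intervalIntegrable_iff.2 hint.integral_prod_left, 
    (intervalIntegral_integral_swap hint).symm⟩
  have h2 := hint.integral_prod_right
  rcases le_total 0 t with ht | ht
  · simp_rw [intervalIntegral.integral_of_le ht]
    rwa [Set.uIoc_of_le ht] at h2
  · simp_rw [intervalIntegral.integral_of_ge ht]
    rw [Set.uIoc_of_ge ht] at h2
    exact h2.neg

/-- The symbols of the corrector, its rate term and its derivatives in position and velocity. -/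
noncomputable def correctorSymbol (c : Space d → ℂ) (ξ v : Space d) : ℂ :=
  c ξ * (transportSymbol ξ v)⁻¹

noncomputable def rateSymbol (c : Space d → ℂ) (ξ v : Space d) : ℂ :=
  c ξ * (waveRate ξ * (transportSymbol ξ v)⁻¹)

noncomputable def gradSymbol (c : Space d → ℂ) (l : Fin d) (ξ v : Space d) : ℂ :=
  c ξ * (derivSymbol l ξ * (transportSymbol ξ v)⁻¹)

noncomputable def velocitySymbol (c : Space d → ℂ) (l : Fin d) (ξ v : Space d) : ℂ :=
  c ξ * (derivSymbol l ξ * (transportSymbol ξ v)⁻¹ ^ 2)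

theorem norm_inv_transportSymbol_le_one (ξ v : Space d) : ‖(transportSymbol ξ v)⁻¹‖ ≤ 1 := by
  rw [norm_inv]; exact inv_le_one_of_one_le₀ (one_le_norm_transportSymbol ξ v)

section Bounds

variable {c : Space d → ℂ} {M : ℝ}

theorem continuous_correctorSymbol (hc : Continuous c) :
    Continuous fun q : Space d × Space d => correctorSymbol c q.1 q.2 := by
  unfold correctorSymbol; fun_prop

theorem continuous_rateSymbol (hc : Continuous c) :
    Continuous fun q : Space d × Space d => rateSymbol c q.1 q.2 := by
  unfold rateSymbol; fun_prop

theorem continuous_gradSymbol (hc : Continuous c) (l : Fin d) :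
    Continuous fun q : Space d × Space d => gradSymbol c l q.1 q.2 := by
  unfold gradSymbol; fun_prop

theorem continuous_velocitySymbol (hc : Continuous c) (l : Fin d) :
    Continuous fun q : Space d × Space d => velocitySymbol c l q.1 q.2 := by
  unfold velocitySymbol; fun_prop

theorem norm_correctorSymbol_le (hM : ∀ ξ, ‖c ξ‖ ≤ M) (ξ v : Space d) :
    ‖correctorSymbol c ξ v‖ ≤ M * (1 + ‖ξ‖) ^ 0 := by
  rw [correctorSymbol, norm_mul, pow_zero]
  have := (norm_nonneg _).trans (hM ξ)
  gcongr
  · exact hM ξ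
  · exact norm_inv_transportSymbol_le_one ξ v

theorem norm_rateSymbol_le (hM : ∀ ξ, ‖c ξ‖ ≤ M) (ξ v : Space d) :
    ‖rateSymbol c ξ v‖ ≤ M * (1 + ‖ξ‖) ^ 0 := by
  rw [rateSymbol, norm_mul, pow_zero]
  have := (norm_nonneg _).trans (hM ξ)
  gcongr
  · exact hM ξ
  · rw [norm_mul, Complex.norm_real, Real.norm_of_nonneg (waveRate_pos ξ).le, norm_inv,
      ← div_eq_mul_inv]
    exact div_le_one_of_le₀ (waveRate_le_norm_transportSymbol ξ v) (norm_nonneg _)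

theorem norm_gradSymbol_le (hM : ∀ ξ, ‖c ξ‖ ≤ M) (l : Fin d) (ξ v : Space d) :
    ‖gradSymbol c l ξ v‖ ≤ (M * (2 * Real.pi)) * (1 + ‖ξ‖) ^ 1 := by
  rw [gradSymbol, norm_mul, pow_one, mul_assoc]
  have := (norm_nonneg _).trans (hM ξ)
  gcongr
  · exact hM ξ
  · rw [norm_mul]
    calc _ ≤ 2 * Real.pi * ‖ξ‖ * 1 := by
          gcongr
          · exact norm_derivSymbol_le l ξ
          · exact norm_inv_transportSymbol_le_one ξ v
      _ ≤ _ := by rw [mul_one]; gcongr; linarith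

theorem norm_velocitySymbol_le (hM : ∀ ξ, ‖c ξ‖ ≤ M) (l : Fin d) (ξ v : Space d) :
    ‖velocitySymbol c l ξ v‖ ≤ (M * (2 * Real.pi)) * (1 + ‖ξ‖) ^ 1 := by
  rw [velocitySymbol, norm_mul, pow_one, mul_assoc]
  have := (norm_nonneg _).trans (hM ξ)
  gcongr
  · exact hM ξ
  · rw [norm_mul, norm_pow]
    calc _ ≤ 2 * Real.pi * ‖ξ‖ * 1 := by
          gcongr
          · exact norm_derivSymbol_le l ξ
          · exact pow_le_one₀ (norm_nonneg _) (norm_inv_transportSymbol_le_one ξ v)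
      _ ≤ _ := by rw [mul_one]; gcongr; linarith

end Bounds

theorem integral_sub_add_sub_add {α E : Type*} [MeasurableSpace α] {μ : Measure α}
    [NormedAddCommGroup E] [NormedSpace ℝ E] {u₁ u₂ u₃ u₄ u₅ : α → E} (h₁ : Integrable u₁ μ)
    (h₂ : Integrable u₂ μ) (h₃ : Integrable u₃ μ) (h₄ : Integrable u₄ μ) (h₅ : Integrable u₅ μ) :
    ∫ x, u₁ x ∂μ - ∫ x, u₂ x ∂μ + ∫ x, u₃ x ∂μ - ∫ x, u₄ x ∂μ + ∫ x, u₅ x ∂μ =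
      ∫ x, (u₁ x - u₂ x + u₃ x - u₄ x + u₅ x) ∂μ := by
  have e := integral_add' (((h₁.sub h₂).add h₃).sub h₄) h₅
  rw [integral_sub' ((h₁.sub h₂).add h₃) h₄, integral_add' (h₁.sub h₂) h₃,
    integral_sub' h₁ h₂] at e
  exact e.symm

/-- The corrector identity for a single frequency with weight `c ξ`. -/
theorem integral_planeWave_path {c : Space d → ℂ} {A : ℝ}
    {Y V η Φ : ℝ → Space d} (hV : BoundedAcceleration A V Φ) (hη : Continuous η)
    (hY : ∀ s, HasDerivAt Y (V s + η s) s) (ξ : Space d) (t : ℝ)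
    (hΦl : ∀ l, IntervalIntegrable (fun s => Φ s l) volume 0 t) :
    ∫ s in (0 : ℝ)..t, c ξ * planeWave ξ (Y s) =
      correctorSymbol c ξ (V t) * planeWave ξ (Y t) - correctorSymbol c ξ (V 0) * planeWave ξ (Y 0)
      + (∫ s in (0 : ℝ)..t, rateSymbol c ξ (V s) * planeWave ξ (Y s)) -
      (∑ l, ∫ s in (0 : ℝ)..t, (η s l : ℂ) * (gradSymbol c l ξ (V s) * planeWave ξ (Y s))) +
      ∑ l, ∫ s in (0 : ℝ)..t, (Φ s l : ℂ) * (velocitySymbol c l ξ (V s) * planeWave ξ (Y s)) := by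
  have hYc : Continuous Y := continuous_iff_continuousAt.2 fun s => (hY s).continuousAt
  have hVc := hV.continuous
  have key := planeWave_path_identity hV hη hY ξ t
  have hJ : ∀ l, IntervalIntegrable (fun s => (η s l : ℂ) *
      (gradSymbol c l ξ (V s) * planeWave ξ (Y s))) volume 0 t := fun l =>
    (by unfold gradSymbol; fun_prop : Continuous fun s => (η s l : ℂ) *
      (gradSymbol c l ξ (V s) * planeWave ξ (Y s))).intervalIntegrable _ _
  have hK : ∀ l, IntervalIntegrable (fun s => (Φ s l : ℂ) *
      (velocitySymbol c l ξ (V s) * planeWave ξ (Y s))) volume 0 t := fun l => by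
    have h1 : IntervalIntegrable (fun s => (Φ s l : ℂ)) volume 0 t := by
      exact intervalIntegrable_iff.2 (Integrable.ofReal (intervalIntegrable_iff.1 (hΦl l)))
    have h2 : Continuous fun s => velocitySymbol c l ξ (V s) * planeWave ξ (Y s) := by
      unfold velocitySymbol; fun_prop
    exact h1.mul_continuousOn h2.continuousOn
  have hR : IntervalIntegrable (fun s => rateSymbol c ξ (V s) * planeWave ξ (Y s)) volume 0 t :=
    (by unfold rateSymbol; fun_prop : Continuous fun s => rateSymbol c ξ (V s) *
      planeWave ξ (Y s)).intervalIntegrable _ _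
  have hS : IntervalIntegrable (fun s => c ξ * planeWave ξ (Y s)) volume 0 t :=
    (by fun_prop : Continuous fun s => c ξ * planeWave ξ (Y s)).intervalIntegrable _ _
  have hJ' : IntervalIntegrable (fun s => ∑ l, (η s l : ℂ) *
      (gradSymbol c l ξ (V s) * planeWave ξ (Y s))) volume 0 t := by
    have h := IntervalIntegrable.sum Finset.univ fun l _ => hJ l
    rwa [Finset.sum_fn] at h
  have hK' : IntervalIntegrable (fun s => ∑ l, (Φ s l : ℂ) *
      (velocitySymbol c l ξ (V s) * planeWave ξ (Y s))) volume 0 t := by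
    have h := IntervalIntegrable.sum Finset.univ fun l _ => hK l
    rwa [Finset.sum_fn] at h
  -- The identity for the plane wave multiplied by the weight, with the inner products ξ·η and ξ·Φ
  -- expanded in coordinates so that each factor depending on time alone can later leave the
  -- frequency integral.
  have split : c ξ * (planeWave ξ (Y t) * (transportSymbol ξ (V t))⁻¹ -
        planeWave ξ (Y 0) * (transportSymbol ξ (V 0))⁻¹) =
      (∫ s in (0 : ℝ)..t, c ξ * planeWave ξ (Y s)) -
      (∫ s in (0 : ℝ)..t, rateSymbol c ξ (V s) * planeWave ξ (Y s)) +
      (∫ s in (0 : ℝ)..t, ∑ l, (η s l : ℂ) * (gradSymbol c l ξ (V s) * planeWave ξ (Y s))) -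
      ∫ s in (0 : ℝ)..t, ∑ l, (Φ s l : ℂ) * (velocitySymbol c l ξ (V s) * planeWave ξ (Y s)) := by
    rw [← key, ← intervalIntegral.integral_const_mul, ← intervalIntegral.integral_sub hS hR,
      ← intervalIntegral.integral_add (hS.sub hR) hJ',
      ← intervalIntegral.integral_sub ((hS.sub hR).add hJ') hK']
    refine intervalIntegral.integral_congr fun s _ => ?_
    simp only [inner_mul_I_eq_sum, Finset.sum_mul, mul_add, mul_sub, Finset.mul_sum, rateSymbol,
      gradSymbol, velocitySymbol]
    congr 1
    · congr 1
      · ring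
      · exact Finset.sum_congr rfl fun l _ => by ring
    · exact Finset.sum_congr rfl fun l _ => by ring
  rw [← intervalIntegral.integral_finsetSum fun l _ => hJ l,
    ← intervalIntegral.integral_finsetSum fun l _ => hK l]
  simp only [correctorSymbol]
  linear_combination (-1 : ℂ) * split

/-- The corrector identity: along a path `Y` with `Y' = V + η` and `V' = Φ`, the time integral of
a field is the increment of its corrector up to better behaved remainders. -/
theorem BandLimited.integral_mode_path {a : Space d → CSpace d} (ha : BandLimited a)
    {c : Space d → ℂ} (hc : Continuous c) {M : ℝ} (hM : ∀ ξ, ‖c ξ‖ ≤ M) {A : ℝ}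
    {Y V η Φ : ℝ → Space d} (hV : BoundedAcceleration A V Φ) (hη : Continuous η)
    (hY : ∀ s, HasDerivAt Y (V s + η s) s) (t : ℝ) :
    ∫ s in (0 : ℝ)..t, mode a c (Y s) =
      mode a (fun ξ => correctorSymbol c ξ (V t)) (Y t) -
        mode a (fun ξ => correctorSymbol c ξ (V 0)) (Y 0) +
      (∫ s in (0 : ℝ)..t, mode a (fun ξ => rateSymbol c ξ (V s)) (Y s)) -
      (∑ l, ∫ s in (0 : ℝ)..t, η s l • mode a (fun ξ => gradSymbol c l ξ (V s)) (Y s)) +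
      ∑ l, ∫ s in (0 : ℝ)..t, Φ s l • mode a (fun ξ => velocitySymbol c l ξ (V s)) (Y s) := by
  have hYc : Continuous Y := continuous_iff_continuousAt.2 fun s => (hY s).continuousAt
  have hVc := hV.continuous
  have hηl : ∀ l, IntervalIntegrable (fun s => η s l) volume 0 t := fun l =>
    (by fun_prop : Continuous fun s => η s l).intervalIntegrable _ _
  have hΦl : ∀ l, IntervalIntegrable (fun s => Φ s l) volume 0 t := fun l => by
    refine (intervalIntegrable_const (c := A)).mono_fun ?_ (Eventually.of_forall fun s => ?_)
    · exact ((by fun_prop : Continuous fun y : Space d => y l).measurable.comp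
        hV.measurable).aestronglyMeasurable
    · exact (PiLp.norm_apply_le (Φ s) l).trans ((hV.norm_le s).trans (le_abs_self A))
  have h1 : IntervalIntegrable (fun _ : ℝ => (1 : ℝ)) volume 0 t := intervalIntegrable_const
  have hM0 : ∀ ξ v : Space d, ‖(fun ξ _ => c ξ) ξ v‖ ≤ M * (1 + ‖ξ‖) ^ 0 := fun ξ _ => by
    simpa using hM ξ
  obtain ⟨i0, -, e0⟩ := ha.intervalIntegral_smul_mode (b := fun ξ _ => c ξ) (by fun_prop) hM0
    hYc hVc h1
  obtain ⟨i1, -, e1⟩ := ha.intervalIntegral_smul_mode (continuous_rateSymbol hc)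
    (norm_rateSymbol_le hM) hYc hVc h1
  have g2 := fun l => ha.intervalIntegral_smul_mode (continuous_gradSymbol hc l)
    (norm_gradSymbol_le hM l) hYc hVc (hηl l)
  have g3 := fun l => ha.intervalIntegral_smul_mode (continuous_velocitySymbol hc l)
    (norm_velocitySymbol_le hM l) hYc hVc (hΦl l)
  have hcv : ∀ v, Measurable fun ξ => correctorSymbol c ξ v := fun v =>
    ((continuous_correctorSymbol hc).comp (by fun_prop : Continuous fun ξ => (ξ, v))).measurable
  have i4 := ha.integrable_mode (hcv (V t)) (fun ξ => norm_correctorSymbol_le hM ξ _) (Y t)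
  have i5 := ha.integrable_mode (hcv (V 0)) (fun ξ => norm_correctorSymbol_le hM ξ _) (Y 0)
  simp only [one_smul, Complex.ofReal_one, one_mul] at e0 e1 i0 i1
  rw [← e0, ← e1, Finset.sum_congr rfl fun l _ => (g2 l).2.2.symm,
    Finset.sum_congr rfl fun l _ => (g3 l).2.2.symm, mode, mode,
    ← integral_finsetSum _ fun l _ => (g2 l).1, ← integral_finsetSum _ fun l _ => (g3 l).1,
    integral_sub_add_sub_add i4 i5 i1 (integrable_finsetSum _ fun l _ => (g2 l).1)
      (integrable_finsetSum _ fun l _ => (g3 l).1)]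
  refine integral_congr_ae (Eventually.of_forall fun ξ => ?_)
  beta_reduce
  rw [← Finset.sum_smul, ← Finset.sum_smul, ← sub_smul, ← add_smul, ← sub_smul, ← add_smul]
  congr 1
  exact integral_planeWave_path hV hη hY ξ t hΦl

end ModePaths

/-! ### Averaging at scale r: the multiplier and pointwise bounds by local averages -/

section Averages

variable {d : ℕ}

/-- A Lipschitz probability density supported in the unit ball. -/
structure AveragingKernel (ψ : Space d → ℝ) (C : ℝ) : Prop where
  continuous : Continuous ψ
  nonneg : ∀ y, 0 ≤ ψ y
  le : ∀ y, ψ y ≤ C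
  eq_zero : ∀ y, 1 < ‖y‖ → ψ y = 0
  integral_eq : ∫ y, ψ y = 1
  lipschitz : ∀ y z, |ψ y - ψ z| ≤ C * ‖y - z‖

/-- The normalised tent function max(0, 1 - |y|): Lipschitz regularity suffices, since no more than
one derivative ever falls on the kernel. -/
theorem exists_averagingKernel (d : ℕ) : ∃ (ψ : Space d → ℝ) (C : ℝ), AveragingKernel ψ C := by
  set φ : Space d → ℝ := fun y => max 0 (1 - ‖y‖) with hφ
  have hc : Continuous φ := by fun_prop
  have h0 : ∀ y, 0 ≤ φ y := fun y => le_max_left _ _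
  have hz : ∀ y, 1 < ‖y‖ → φ y = 0 := fun y hy => max_eq_left (by linarith)
  have hs : HasCompactSupport φ := HasCompactSupport.intro (isCompact_closedBall (0 : Space d) 1)
    fun y hy => hz y (by simpa using hy)
  have hpos : 0 < ∫ y, φ y :=
    hc.integral_pos_of_hasCompactSupport_nonneg_nonzero hs h0 (x := 0) (by simp [hφ])
  refine ⟨fun y => (∫ y, φ y)⁻¹ * φ y, (∫ y, φ y)⁻¹, by fun_prop, fun y => by positivity, ?_, ?_, ?_,
    ?_⟩
  · intro y
    refine mul_le_of_le_one_right (by positivity) (max_le zero_le_one ?_)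
    linarith [norm_nonneg y]
  · intro y hy
    rw [hz y hy, mul_zero]
  · rw [integral_const_mul, inv_mul_cancel₀ hpos.ne']
  · intro y z
    rw [← mul_sub, abs_mul, abs_of_pos (inv_pos.2 hpos)]
    gcongr
    calc |φ y - φ z| ≤ |(1 - ‖y‖) - (1 - ‖z‖)| := by
          simp only [hφ, max_comm (0 : ℝ)]
          exact abs_max_sub_max_le_abs _ _ _
      _ = |‖z‖ - ‖y‖| := by congr 1; ring
      _ ≤ ‖y - z‖ := by rw [norm_sub_rev]; exact abs_norm_sub_norm_le _ _

namespace AveragingKernel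

variable {ψ : Space d → ℝ} {C : ℝ}

theorem const_nonneg (hψ : AveragingKernel ψ C) : 0 ≤ C := (hψ.nonneg 0).trans (hψ.le 0)

theorem hasCompactSupport (hψ : AveragingKernel ψ C) : HasCompactSupport ψ :=
  HasCompactSupport.intro (isCompact_closedBall (0 : Space d) 1)
    fun y hy => hψ.eq_zero y (by simpa using hy)

theorem integrable (hψ : AveragingKernel ψ C) : Integrable ψ :=
  hψ.continuous.integrable_of_hasCompactSupport hψ.hasCompactSupport

end AveragingKernel

/-- The Fourier multiplier of the average at scale `r`. -/
noncomputable def averageSymbol (ψ : Space d → ℝ) (r : ℝ) (ξ : Space d) : ℂ :=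
  ∫ y, (ψ y : ℂ) * planeWave ξ (-(r • y))

variable {ψ : Space d → ℝ} {C : ℝ}

theorem integrable_averageSymbol (hψ : AveragingKernel ψ C) (r : ℝ) (ξ : Space d) :
    Integrable fun y => (ψ y : ℂ) * planeWave ξ (-(r • y)) := by
  have hψc := hψ.continuous
  refine hψ.integrable.mono (by fun_prop : Continuous fun y => (ψ y : ℂ) *
    planeWave ξ (-(r • y))).aestronglyMeasurable (Eventually.of_forall fun y => ?_)
  rw [norm_mul, norm_planeWave, mul_one, Complex.norm_real]

theorem continuous_averageSymbol (hψ : AveragingKernel ψ C) (r : ℝ) :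
    Continuous (averageSymbol ψ r) := by
  refine continuous_of_dominated (bound := ψ) (fun ξ => (integrable_averageSymbol hψ r ξ).1) ?_
    hψ.integrable (Eventually.of_forall fun y => ?_)
  · intro ξ
    refine Eventually.of_forall fun y => ?_
    rw [norm_mul, norm_planeWave, mul_one, Complex.norm_real, Real.norm_of_nonneg (hψ.nonneg y)]
  · fun_prop

theorem norm_averageSymbol_le (hψ : AveragingKernel ψ C) (r : ℝ) (ξ : Space d) :
    ‖averageSymbol ψ r ξ‖ ≤ 1 := by
  rw [← hψ.integral_eq]
  refine norm_integral_le_of_norm_le hψ.integrable (Eventually.of_forall fun y => ?_)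
  rw [norm_mul, norm_planeWave, mul_one, Complex.norm_real, Real.norm_of_nonneg (hψ.nonneg y)]

theorem norm_one_sub_averageSymbol_le_two (hψ : AveragingKernel ψ C) (r : ℝ) (ξ : Space d) :
    ‖1 - averageSymbol ψ r ξ‖ ≤ 2 := by
  refine (norm_sub_le _ _).trans ?_
  rw [norm_one]; linarith [norm_averageSymbol_le hψ r ξ]

/-- The kernel has mass one and lives on |y| ≤ 1, where the phase of the wave is at most 2πr|ξ|.
This factor r compensates the weight 2/r in `scaleBound`, and it makes low frequencies small when
the force is decomposed. -/
theorem norm_one_sub_averageSymbol_le (hψ : AveragingKernel ψ C) {r : ℝ} (hr : 0 ≤ r)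
    (ξ : Space d) : ‖1 - averageSymbol ψ r ξ‖ ≤ 2 * Real.pi * r * ‖ξ‖ := by
  have h1 : (1 : ℂ) = ∫ y, (ψ y : ℂ) := by
    rw [integral_complex_ofReal, hψ.integral_eq, Complex.ofReal_one]
  have h2 : 2 * Real.pi * r * ‖ξ‖ = ∫ y, ψ y * (2 * Real.pi * r * ‖ξ‖) := by
    rw [integral_mul_const, hψ.integral_eq, one_mul]
  have h3 : Integrable fun y => (ψ y : ℂ) := hψ.integrable.ofReal
  rw [averageSymbol, h1, ← integral_sub h3 (integrable_averageSymbol hψ r ξ), h2]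
  refine norm_integral_le_of_norm_le (hψ.integrable.mul_const _) (Eventually.of_forall fun y => ?_)
  rw [← mul_one_sub, norm_mul, Complex.norm_real, Real.norm_of_nonneg (hψ.nonneg y)]
  rcases le_or_gt ‖y‖ 1 with hy | hy
  · refine mul_le_mul_of_nonneg_left ?_ (hψ.nonneg y)
    rw [norm_sub_rev, planeWave, mul_comm]
    refine (Real.norm_exp_I_mul_ofReal_sub_one_le).trans ?_
    rw [norm_mul, Real.norm_of_nonneg (by positivity : 0 ≤ 2 * Real.pi)]
    calc 2 * Real.pi * ‖(inner ℝ ξ (-(r • y)) : ℝ)‖ ≤ 2 * Real.pi * (‖ξ‖ * (r * 1)) := by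
          gcongr
          refine (norm_inner_le_norm (𝕜 := ℝ) _ _).trans ?_
          rw [norm_neg, norm_smul, Real.norm_of_nonneg hr]
          gcongr
      _ = _ := by ring
  · simp [hψ.eq_zero y hy]

/-- Averaging a superposition of plane waves amounts to a Fourier multiplier. -/
theorem BandLimited.mode_averageSymbol {a : Space d → CSpace d} (ha : BandLimited a)
    (hψ : AveragingKernel ψ C) {b : Space d → ℂ} (hb : Measurable b) {M : ℝ} {n : ℕ}
    (hM : ∀ ξ, ‖b ξ‖ ≤ M * (1 + ‖ξ‖) ^ n) (r : ℝ) (x : Space d) :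
    mode a (fun ξ => averageSymbol ψ r ξ * b ξ) x = ∫ y, ψ y • mode a b (x - r • y) := by
  have hint : Integrable (Function.uncurry fun (ξ y : Space d) =>
      ((ψ y : ℂ) * (b ξ * planeWave ξ (x - r • y))) • a ξ) (volume.prod volume) := by
    have h1 : Integrable (fun q : Space d × Space d => (M * ((1 + ‖q.1‖) ^ n * ‖a q.1‖)) * ψ q.2)
        (volume.prod volume) :=
      ((ha.integrable_pow_norm n).const_mul M).mul_prod hψ.integrable
    refine h1.mono' ?_ (Eventually.of_forall fun q => ?_)
    · have hp : Measurable fun q : Space d × Space d => planeWave q.1 (x - r • q.2) :=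
        (by fun_prop : Continuous fun q : Space d × Space d =>
          planeWave q.1 (x - r • q.2)).measurable
      have hψm := hψ.continuous.measurable
      have ham := ha.measurable
      refine Measurable.aestronglyMeasurable ?_
      simp only [Function.uncurry_def]
      have h2 : Measurable fun q : Space d × Space d =>
        (ψ q.2 : ℂ) * (b q.1 * planeWave q.1 (x - r • q.2)) := by fun_prop
      exact h2.smul (ham.comp measurable_fst)
    · simp only [Function.uncurry_def]
      rw [norm_smul, norm_mul, norm_mul, norm_planeWave, mul_one, Complex.norm_real,
        Real.norm_of_nonneg (hψ.nonneg _), ← mul_assoc M, mul_comm (ψ q.2), mul_right_comm]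
      have := hψ.nonneg q.2
      gcongr
      exact hM _
  have e1 : mode a (fun ξ => averageSymbol ψ r ξ * b ξ) x =
      ∫ ξ, ∫ y, ((ψ y : ℂ) * (b ξ * planeWave ξ (x - r • y))) • a ξ := by
    refine integral_congr_ae (Eventually.of_forall fun ξ => ?_)
    beta_reduce
    rw [integral_smul_const, averageSymbol, mul_assoc, ← integral_mul_const]
    congr 1
    refine integral_congr_ae (Eventually.of_forall fun y => ?_)
    beta_reduce
    rw [sub_eq_add_neg, planeWave_add]; ring
  rw [e1, integral_integral_swap hint]
  refine integral_congr_ae (Eventually.of_forall fun y => ?_)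
  beta_reduce
  rw [mode, ← integral_smul]
  refine integral_congr_ae (Eventually.of_forall fun ξ => ?_)
  beta_reduce
  rw [mul_smul (ψ y : ℂ), Complex.coe_smul]

/-- `C` times the integral of the norm over the ball of radius `2r`, in rescaled variables. -/
noncomputable def localAverage (C r : ℝ) (h : Space d → CSpace d) (x : Space d) : ℝ :=
  C * ∫ u in Metric.closedBall (0 : Space d) 2, ‖h (x + r • u)‖

theorem localAverage_nonneg (hC : 0 ≤ C) (r : ℝ) (h : Space d → CSpace d) (x : Space d) :
    0 ≤ localAverage C r h x :=
  mul_nonneg hC (integral_nonneg fun _ => norm_nonneg _)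

/-- The average centred at any point within r of x only sees the ball of radius 2r about x. One
quantity attached to x therefore controls all nearby points, which allows a second trajectory to be
estimated by functions of the first. -/
theorem norm_integral_kernel_smul_le (hψ : AveragingKernel ψ C) {h : Space d → CSpace d}
    {r : ℝ} (hr : 0 < r) {x : Space d}
    (hh : IntegrableOn (fun u => h (x + r • u)) (Metric.closedBall 0 2)) {w : Space d}
    (hw : ‖w‖ ≤ r) :
    ‖∫ y, ψ y • h (x + w - r • y)‖ ≤ localAverage C r h x := by
  have e1 : ∫ y, ψ y • h (x + w - r • y) = ∫ u, ψ (r⁻¹ • w - u) • h (x + r • u) := by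
    -- The substitution y = w/r - u moves the displacement w onto the kernel.
    rw [← integral_sub_left_eq_self (fun y => ψ y • h (x + w - r • y)) volume (r⁻¹ • w)]
    refine integral_congr_ae (Eventually.of_forall fun u => ?_)
    beta_reduce
    rw [smul_sub, smul_smul, mul_inv_cancel₀ hr.ne', one_smul]
    congr 2; abel
  have hsupp : ∀ u, u ∉ Metric.closedBall (0 : Space d) 2 → ψ (r⁻¹ • w - u) = 0 := by
    intro u hu
    refine hψ.eq_zero _ ?_
    have hu' : 2 < ‖u‖ := by simpa using hu
    have hw' : ‖r⁻¹ • w‖ ≤ 1 := by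
      rw [norm_smul, norm_inv, Real.norm_of_nonneg hr.le, inv_mul_le_iff₀ hr, mul_one]; exact hw
    have := norm_sub_norm_le u (r⁻¹ • w)
    rw [norm_sub_rev]; linarith
  rw [e1, localAverage, ← integral_const_mul, ← setIntegral_eq_integral_of_forall_compl_eq_zero
    (s := Metric.closedBall (0 : Space d) 2) (fun u hu => by rw [hsupp u hu, zero_smul])]
  refine norm_integral_le_of_norm_le ?_ (Eventually.of_forall fun u => ?_)
  · exact hh.norm.const_mul C
  · rw [norm_smul, Real.norm_of_nonneg (hψ.nonneg _)]
    gcongr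
    exact hψ.le _

theorem BandLimited.norm_mode_averageSymbol_le {a : Space d → CSpace d} (ha : BandLimited a)
    (hψ : AveragingKernel ψ C) {b : Space d → ℂ} (hb : Continuous b) {M : ℝ} {n : ℕ}
    (hM : ∀ ξ, ‖b ξ‖ ≤ M * (1 + ‖ξ‖) ^ n) {r : ℝ} (hr : 0 < r) (x : Space d) {w : Space d}
    (hw : ‖w‖ ≤ r) :
    ‖mode a (fun ξ => averageSymbol ψ r ξ * b ξ) (x + w)‖ ≤ localAverage C r (mode a b) x := by
  rw [ha.mode_averageSymbol hψ hb.measurable hM]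
  refine norm_integral_kernel_smul_le hψ hr ?_ hw
  exact ((ha.continuous_mode (b := fun ξ _ => b ξ) (by fun_prop) fun ξ _ => hM ξ).comp
    (by fun_prop : Continuous fun u : Space d =>
      (x + r • u, (0 : Space d)))).continuousOn.integrableOn_compact (isCompact_closedBall _ _)

theorem norm_derivSymbol_mul_le {b : Space d → ℂ} {M : ℝ} {n : ℕ}
    (hM : ∀ ξ, ‖b ξ‖ ≤ M * (1 + ‖ξ‖) ^ n) (l : Fin d) (ξ : Space d) :
    ‖derivSymbol l ξ * b ξ‖ ≤ (2 * Real.pi * M) * (1 + ‖ξ‖) ^ (n + 1) := by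
  rw [norm_mul]
  calc ‖derivSymbol l ξ‖ * ‖b ξ‖ ≤ (2 * Real.pi * (1 + ‖ξ‖)) * (M * (1 + ‖ξ‖) ^ n) := by
        gcongr
        · exact (norm_derivSymbol_le l ξ).trans (by gcongr; linarith)
        · exact hM ξ
    _ = _ := by ring

theorem BandLimited.hasDerivAt_mode {a : Space d → CSpace d} (ha : BandLimited a)
    {b : Space d → ℂ} (hb : Continuous b) {M : ℝ} {n : ℕ}
    (hM : ∀ ξ, ‖b ξ‖ ≤ M * (1 + ‖ξ‖) ^ n) (x w : Space d) (θ : ℝ) :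
    HasDerivAt (fun θ : ℝ => mode a b (x + θ • w))
      (∑ l, w l • mode a (fun ξ => derivSymbol l ξ * b ξ) (x + θ • w)) θ := by
  have hsum : ∑ l, w l • mode a (fun ξ => derivSymbol l ξ * b ξ) (x + θ • w) =
      ∫ ξ, (b ξ * ((((2 * Real.pi * inner ℝ ξ w : ℝ) : ℂ) * Complex.I) *
        planeWave ξ (x + θ • w))) • a ξ := by
    have hi : ∀ l : Fin d, Integrable fun ξ => w l • ((derivSymbol l ξ * b ξ *
        planeWave ξ (x + θ • w)) • a ξ) := fun l => by
      exact (ha.integrable_mode (by fun_prop) (norm_derivSymbol_mul_le hM l) (x + θ • w)).smul (w l)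
    simp only [mode, ← integral_smul]
    rw [← integral_finsetSum _ fun l _ => hi l]
    refine integral_congr_ae (Eventually.of_forall fun ξ => ?_)
    beta_reduce
    rw [inner_mul_I_eq_sum, Finset.sum_mul, Finset.mul_sum, Finset.sum_smul]
    refine Finset.sum_congr rfl fun l _ => ?_
    rw [← Complex.coe_smul, smul_smul]; congr 1; ring
  rw [hsum]
  refine (hasDerivAt_integral_of_dominated_loc_of_deriv_le (𝕜 := ℝ) (s := Set.univ)
    (F := fun θ ξ => (b ξ * planeWave ξ (x + θ • w)) • a ξ)
    (F' := fun θ ξ => (b ξ * ((((2 * Real.pi * inner ℝ ξ w : ℝ) : ℂ) * Complex.I) *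
        planeWave ξ (x + θ • w))) • a ξ)
    (bound := fun ξ => (2 * Real.pi * ‖w‖ * M) * ((1 + ‖ξ‖) ^ (n + 1) * ‖a ξ‖)) Filter.univ_mem
    (Eventually.of_forall fun θ => (ha.integrable_mode hb.measurable hM _).1)
    (ha.integrable_mode hb.measurable hM _) ?_ ?_ ((ha.integrable_pow_norm (n + 1)).const_mul _)
    ?_).2
  · exact ((by fun_prop : Continuous fun ξ => b ξ * ((((2 * Real.pi * inner ℝ ξ w : ℝ) : ℂ) *
      Complex.I) * planeWave ξ (x + θ • w))).measurable.smul ha.measurable).aestronglyMeasurable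
  · refine Eventually.of_forall fun ξ θ _ => ?_
    rw [norm_smul, norm_mul, norm_mul, norm_planeWave, mul_one, norm_mul, Complex.norm_I, mul_one,
      Complex.norm_real, norm_mul, Real.norm_of_nonneg (by positivity : 0 ≤ 2 * Real.pi)]
    calc ‖b ξ‖ * (2 * Real.pi * ‖(inner ℝ ξ w : ℝ)‖) * ‖a ξ‖
        ≤ (M * (1 + ‖ξ‖) ^ n) * (2 * Real.pi * ((1 + ‖ξ‖) * ‖w‖)) * ‖a ξ‖ := by
          have := (norm_nonneg _).trans (hM ξ)
          gcongr
          · exact hM ξ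
          · exact (norm_inner_le_norm (𝕜 := ℝ) ξ w).trans (by gcongr; linarith)
      _ = _ := by ring
  · refine Eventually.of_forall fun ξ θ _ => ?_
    have h1 : HasDerivAt (fun θ : ℝ => x + θ • w) w θ := by
      simpa using ((hasDerivAt_id θ).smul_const w).const_add x
    exact ((hasDerivAt_planeWave h1 ξ).const_mul (b ξ)).smul_const (a ξ)

/-- Mean value inequality on the segment from x to x + w: differentiation commutes with averaging,
and every point of the segment lies within r of x, so the same local averages bound the whole
derivative. -/
theorem BandLimited.norm_mode_averageSymbol_sub_le {a : Space d → CSpace d} (ha : BandLimited a)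
    (hψ : AveragingKernel ψ C) {b : Space d → ℂ} (hb : Continuous b) {M : ℝ} {n : ℕ}
    (hM : ∀ ξ, ‖b ξ‖ ≤ M * (1 + ‖ξ‖) ^ n) {r : ℝ} (hr : 0 < r) (x : Space d) {w : Space d}
    (hw : ‖w‖ ≤ r) :
    ‖mode a (fun ξ => averageSymbol ψ r ξ * b ξ) (x + w) -
        mode a (fun ξ => averageSymbol ψ r ξ * b ξ) x‖ ≤
      ‖w‖ * ∑ l, localAverage C r (mode a fun ξ => derivSymbol l ξ * b ξ) x := by
  have hac := continuous_averageSymbol hψ r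
  have hM' : ∀ ξ, ‖averageSymbol ψ r ξ * b ξ‖ ≤ M * (1 + ‖ξ‖) ^ n := fun ξ => by
    rw [norm_mul]
    exact (mul_le_of_le_one_left (norm_nonneg _) (norm_averageSymbol_le hψ r ξ)).trans (hM ξ)
  have hd := fun θ => ha.hasDerivAt_mode (b := fun ξ => averageSymbol ψ r ξ * b ξ) (by fun_prop) hM'
    x w θ
  have := norm_image_sub_le_of_norm_deriv_le_segment_01'
    (f := fun θ : ℝ => mode a (fun ξ => averageSymbol ψ r ξ * b ξ) (x + θ • w))
    (C := ‖w‖ * ∑ l, localAverage C r (mode a fun ξ => derivSymbol l ξ * b ξ) x)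
    (fun θ _ => (hd θ).hasDerivWithinAt) ?_
  · simpa using this
  intro θ hθ
  rw [Finset.mul_sum]
  refine (norm_sum_le _ _).trans (Finset.sum_le_sum fun l _ => ?_)
  rw [norm_smul]
  gcongr
  · exact PiLp.norm_apply_le w l
  · have e : (fun ξ => derivSymbol l ξ * (averageSymbol ψ r ξ * b ξ)) =
        fun ξ => averageSymbol ψ r ξ * (derivSymbol l ξ * b ξ) := by ext ξ; ring
    rw [e]
    refine ha.norm_mode_averageSymbol_le hψ (by fun_prop) (norm_derivSymbol_mul_le hM l) hr x ?_
    rw [norm_smul, Real.norm_of_nonneg hθ.1]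
    nlinarith [hθ.2, norm_nonneg w]

end Averages

/-! ### Time integrals of high and low frequencies along paths -/

section PathEstimates

variable {d : ℕ} {ψ : Space d → ℝ} {C : ℝ} {a : Space d → CSpace d}

/-- Cauchy–Schwarz, read off from the discriminant of the nonnegative quadratic x ↦ ∫(f + xg)². -/
theorem sq_intervalIntegral_mul_le {f g : ℝ → ℝ} {t : ℝ} (ht : 0 ≤ t)
    (hf : IntervalIntegrable (fun s => f s ^ 2) volume 0 t)
    (hfg : IntervalIntegrable (fun s => f s * g s) volume 0 t)
    (hg : IntervalIntegrable (fun s => g s ^ 2) volume 0 t) :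
    (∫ s in (0 : ℝ)..t, f s * g s) ^ 2 ≤
      (∫ s in (0 : ℝ)..t, f s ^ 2) * ∫ s in (0 : ℝ)..t, g s ^ 2 := by
  have h : ∀ x : ℝ, 0 ≤ (∫ s in (0 : ℝ)..t, g s ^ 2) * (x * x) +
      (2 * ∫ s in (0 : ℝ)..t, f s * g s) * x + ∫ s in (0 : ℝ)..t, f s ^ 2 := by
    intro x
    have e : (∫ s in (0 : ℝ)..t, g s ^ 2) * (x * x) + (2 * ∫ s in (0 : ℝ)..t, f s * g s) * x +
        ∫ s in (0 : ℝ)..t, f s ^ 2 = ∫ s in (0 : ℝ)..t, (f s + x * g s) ^ 2 := by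
      have i1 : IntervalIntegrable (fun s => g s ^ 2 * (x * x)) volume 0 t := hg.mul_const _
      have i2 : IntervalIntegrable (fun s => 2 * (f s * g s) * x) volume 0 t :=
        (hfg.const_mul 2).mul_const x
      rw [← intervalIntegral.integral_mul_const, ← intervalIntegral.integral_const_mul,
        ← intervalIntegral.integral_mul_const, ← intervalIntegral.integral_add i1 i2,
        ← intervalIntegral.integral_add (i1.add i2) hf]
      exact intervalIntegral.integral_congr fun s _ => by ring
    rw [e]
    exact intervalIntegral.integral_nonneg ht fun s _ => sq_nonneg _
  have := discrim_le_zero h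
  rw [discrim] at this
  nlinarith

theorem sq_intervalIntegral_le {g : ℝ → ℝ} {t : ℝ} (ht : 0 ≤ t)
    (hg : IntervalIntegrable g volume 0 t)
    (hg2 : IntervalIntegrable (fun s => g s ^ 2) volume 0 t) :
    (∫ s in (0 : ℝ)..t, g s) ^ 2 ≤ t * ∫ s in (0 : ℝ)..t, g s ^ 2 := by
  simpa using sq_intervalIntegral_mul_le (f := fun _ => 1) ht (by simp) (by simpa using hg) hg2

/-- The local averages controlling the differences of the low frequency part of a corrector. -/
noncomputable def lowBound (C r : ℝ) (a : Space d → CSpace d) (z : Space d × Space d) : ℝ :=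
  (∑ l, localAverage C r (mode a fun ξ => derivSymbol l ξ * (transportSymbol ξ z.2)⁻¹) z.1) +
  (∑ l, localAverage C r (mode a fun ξ => derivSymbol l ξ *
    (waveRate ξ * (transportSymbol ξ z.2)⁻¹)) z.1) +
  ∑ k, ∑ l, localAverage C r (mode a fun ξ => derivSymbol l ξ *
    (derivSymbol k ξ * (transportSymbol ξ z.2)⁻¹ ^ 2)) z.1

/-- The size of the corrector with symbol `c` and of its remainders. -/
noncomputable def highBound (c : Space d → ℂ) (a : Space d → CSpace d) (z : Space d × Space d) :
    ℝ :=
  ‖mode a (fun ξ => correctorSymbol c ξ z.2) z.1‖ + ‖mode a (fun ξ => rateSymbol c ξ z.2) z.1‖ +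
    ∑ l, ‖mode a (fun ξ => velocitySymbol c l ξ z.2) z.1‖

theorem BandLimited.continuous_localAverage (ha : BandLimited a) {b : Space d → Space d → ℂ}
    (hb : Continuous fun q : Space d × Space d => b q.1 q.2)
    {M : ℝ} {n : ℕ} (hM : ∀ ξ v, ‖b ξ v‖ ≤ M * (1 + ‖ξ‖) ^ n) (C r : ℝ) :
    Continuous fun z : Space d × Space d => localAverage C r (mode a fun ξ => b ξ z.2) z.1 := by
  unfold localAverage
  refine continuous_const.mul (continuous_parametric_integral_of_continuous ?_
    (isCompact_closedBall _ _))
  exact ((ha.continuous_mode hb hM).comp (by fun_prop :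
    Continuous fun q : (Space d × Space d) × Space d => (q.1.1 + r • q.2, q.1.2))).norm

theorem norm_inv_transportSymbol_le (ξ v : Space d) :
    ‖(transportSymbol ξ v)⁻¹‖ ≤ 1 * (1 + ‖ξ‖) ^ 0 := by
  simpa using norm_inv_transportSymbol_le_one ξ v

theorem norm_waveRate_mul_inv_le (ξ v : Space d) :
    ‖(waveRate ξ : ℂ) * (transportSymbol ξ v)⁻¹‖ ≤ 1 * (1 + ‖ξ‖) ^ 0 := by
  simpa [rateSymbol] using norm_rateSymbol_le (c := fun _ => 1) (M := 1) (by simp) ξ v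

theorem norm_derivSymbol_mul_inv_le (l : Fin d) (ξ v : Space d) :
    ‖derivSymbol l ξ * (transportSymbol ξ v)⁻¹‖ ≤ (1 * (2 * Real.pi)) * (1 + ‖ξ‖) ^ 1 := by
  simpa [gradSymbol] using norm_gradSymbol_le (c := fun _ => 1) (M := 1) (by simp) l ξ v

theorem norm_derivSymbol_mul_inv_sq_le (l : Fin d) (ξ v : Space d) :
    ‖derivSymbol l ξ * (transportSymbol ξ v)⁻¹ ^ 2‖ ≤ (1 * (2 * Real.pi)) * (1 + ‖ξ‖) ^ 1 := by
  simpa [velocitySymbol] using norm_velocitySymbol_le (c := fun _ => 1) (M := 1) (by simp) l ξ v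

theorem BandLimited.continuous_lowBound (ha : BandLimited a) (C r : ℝ) :
    Continuous (lowBound C r a) := by
  unfold lowBound
  refine ((continuous_finsetSum _ fun l _ => ?_).add (continuous_finsetSum _ fun l _ => ?_)).add
    (continuous_finsetSum _ fun k _ => continuous_finsetSum _ fun l _ => ?_)
  · exact ha.continuous_localAverage
      (b := fun ξ v => derivSymbol l ξ * (transportSymbol ξ v)⁻¹) (by fun_prop)
      (fun ξ v => norm_derivSymbol_mul_le (fun ξ => norm_inv_transportSymbol_le ξ v) l ξ) C r
  · exact ha.continuous_localAverage
      (b := fun ξ v => derivSymbol l ξ * (waveRate ξ * (transportSymbol ξ v)⁻¹)) (by fun_prop)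
      (fun ξ v => norm_derivSymbol_mul_le (fun ξ => norm_waveRate_mul_inv_le ξ v) l ξ) C r
  · exact ha.continuous_localAverage
      (b := fun ξ v => derivSymbol l ξ * (derivSymbol k ξ * (transportSymbol ξ v)⁻¹ ^ 2))
      (by fun_prop)
      (fun ξ v => norm_derivSymbol_mul_le (fun ξ => norm_derivSymbol_mul_inv_sq_le k ξ v) l ξ) C r

theorem BandLimited.continuous_highBound (ha : BandLimited a) {c : Space d → ℂ}
    (hc : Continuous c) {M : ℝ} (hM : ∀ ξ, ‖c ξ‖ ≤ M) : Continuous (highBound c a) := by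
  unfold highBound
  refine ((ha.continuous_mode (continuous_correctorSymbol hc) (norm_correctorSymbol_le hM)).norm.add
    (ha.continuous_mode (continuous_rateSymbol hc) (norm_rateSymbol_le hM)).norm).add
    (continuous_finsetSum _ fun l _ => ?_)
  exact (ha.continuous_mode (continuous_velocitySymbol hc l) (norm_velocitySymbol_le hM l)).norm

theorem lowBound_nonneg (hC : 0 ≤ C) (r : ℝ) (a : Space d → CSpace d) (z : Space d × Space d) :
    0 ≤ lowBound C r a z := by
  have := localAverage_nonneg (d := d) hC r
  exact add_nonneg (add_nonneg (Finset.sum_nonneg fun _ _ => this _ _)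
    (Finset.sum_nonneg fun _ _ => this _ _))
    (Finset.sum_nonneg fun _ _ => Finset.sum_nonneg fun _ _ => this _ _)

theorem highBound_nonneg (c : Space d → ℂ) (a : Space d → CSpace d) (z : Space d × Space d) :
    0 ≤ highBound c a z := by
  unfold highBound; positivity

theorem norm_integral_le_integral_of_le {E : Type*} [NormedAddCommGroup E] [NormedSpace ℝ E]
    {u : ℝ → E} {g : ℝ → ℝ} (hg : Continuous g) {t : ℝ} (ht : 0 ≤ t)
    (h : ∀ s ∈ Set.Icc 0 t, ‖u s‖ ≤ g s) :
    ‖∫ s in (0 : ℝ)..t, u s‖ ≤ ∫ s in (0 : ℝ)..t, g s :=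
  intervalIntegral.norm_integral_le_of_norm_le ht
    (Eventually.of_forall fun s hs => h s ⟨hs.1.le, hs.2⟩) (hg.intervalIntegrable _ _)

/-- Time integrals along a trajectory are controlled by the corrector. -/
theorem BandLimited.norm_integral_mode_le (ha : BandLimited a) {c : Space d → ℂ}
    (hc : Continuous c) {M : ℝ} (hM : ∀ ξ, ‖c ξ‖ ≤ M) {A : ℝ} {X V Φ : ℝ → Space d}
    (hV : BoundedAcceleration A V Φ) (hX : ∀ s, HasDerivAt X (V s) s) {t : ℝ} (ht : 0 ≤ t) :
    ‖∫ s in (0 : ℝ)..t, mode a c (X s)‖ ≤ highBound c a (X t, V t) + highBound c a (X 0, V 0) +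
      (1 + A) * ∫ s in (0 : ℝ)..t, highBound c a (X s, V s) := by
  have hXc : Continuous X := continuous_iff_continuousAt.2 fun s => (hX s).continuousAt
  have hVc := hV.continuous
  have hA : 0 ≤ A := (norm_nonneg _).trans (hV.norm_le 0)
  have hZ : Continuous fun s => (X s, V s) := hXc.prodMk hVc
  have hH : Continuous fun s => highBound c a (X s, V s) := (ha.continuous_highBound hc hM).comp hZ
  have hcorr : ∀ z : Space d × Space d, ‖mode a (fun ξ => correctorSymbol c ξ z.2) z.1‖ ≤
      highBound c a z := fun z => by
    unfold highBound
    have : 0 ≤ ∑ l, ‖mode a (fun ξ => velocitySymbol c l ξ z.2) z.1‖ := by positivity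
    linarith [norm_nonneg (mode a (fun ξ => rateSymbol c ξ z.2) z.1)]
  have hW : ∀ l, Continuous fun s => ‖mode a (fun ξ => velocitySymbol c l ξ (V s)) (X s)‖ :=
    fun l => ((ha.continuous_mode (continuous_velocitySymbol hc l)
      (norm_velocitySymbol_le hM l)).comp hZ).norm
  -- On a true trajectory the position moves exactly with `V`, so the drift is zero and the gradient
  -- term disappears. No derivative of the field is left in the bound.
  have e := ha.integral_mode_path hc hM hV (η := fun _ => 0) continuous_const
    (by simpa using hX) t
  simp only [PiLp.zero_apply, zero_smul, intervalIntegral.integral_zero, Finset.sum_const_zero,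
    sub_zero] at e
  rw [e]
  refine (norm_add_le _ _).trans ?_
  have b1 : ‖∫ s in (0 : ℝ)..t, mode a (fun ξ => rateSymbol c ξ (V s)) (X s)‖ ≤
      ∫ s in (0 : ℝ)..t, highBound c a (X s, V s) := by
    refine norm_integral_le_integral_of_le hH ht fun s _ => ?_
    unfold highBound
    have : 0 ≤ ∑ l, ‖mode a (fun ξ => velocitySymbol c l ξ (V s)) (X s)‖ := by positivity
    simp only
    linarith [norm_nonneg (mode a (fun ξ => correctorSymbol c ξ (V s)) (X s))]
  have b2 : ‖∑ l, ∫ s in (0 : ℝ)..t, Φ s l • mode a (fun ξ => velocitySymbol c l ξ (V s)) (X s)‖ ≤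
      A * ∫ s in (0 : ℝ)..t, highBound c a (X s, V s) := by
    calc _ ≤ ∑ l, ∫ s in (0 : ℝ)..t, A * ‖mode a (fun ξ => velocitySymbol c l ξ (V s)) (X s)‖ := by
          refine (norm_sum_le _ _).trans (Finset.sum_le_sum fun l _ => ?_)
          refine norm_integral_le_integral_of_le (continuous_const.mul (hW l)) ht fun s _ => ?_
          rw [norm_smul]
          exact mul_le_mul_of_nonneg_right ((PiLp.norm_apply_le _ l).trans (hV.norm_le s))
            (norm_nonneg _)
      _ = ∫ s in (0 : ℝ)..t, ∑ l, A * ‖mode a (fun ξ => velocitySymbol c l ξ (V s)) (X s)‖ :=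
          (intervalIntegral.integral_finsetSum fun l _ =>
            (continuous_const.mul (hW l)).intervalIntegrable _ _).symm
      _ ≤ ∫ s in (0 : ℝ)..t, A * highBound c a (X s, V s) := by
          refine intervalIntegral.integral_mono ht ((continuous_finsetSum _ fun l _ =>
            continuous_const.mul (hW l)).intervalIntegrable _ _)
            ((continuous_const.mul hH).intervalIntegrable _ _) fun s => ?_
          rw [← Finset.mul_sum]
          unfold highBound
          gcongr
          simp only [le_add_iff_nonneg_left]
          positivity
      _ = _ := intervalIntegral.integral_const_mul _ _
  have b3 := norm_sub_le (mode a (fun ξ => correctorSymbol c ξ (V t)) (X t))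
    (mode a (fun ξ => correctorSymbol c ξ (V 0)) (X 0))
  have b4 := hcorr (X t, V t)
  have b5 := hcorr (X 0, V 0)
  have b6 := norm_add_le (mode a (fun ξ => correctorSymbol c ξ (V t)) (X t) -
    mode a (fun ξ => correctorSymbol c ξ (V 0)) (X 0))
    (∫ s in (0 : ℝ)..t, mode a (fun ξ => rateSymbol c ξ (V s)) (X s))
  linarith

/-- The low frequency part: differences along two nearby paths. -/
theorem BandLimited.norm_integral_mode_sub_le (ha : BandLimited a) (hψ : AveragingKernel ψ C)
    {A r W : ℝ} (hr : 0 < r) (hWr : W ≤ r) {X V Y η Φ : ℝ → Space d}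
    (hV : BoundedAcceleration A V Φ) (hX : ∀ s, HasDerivAt X (V s) s) (hη : Continuous η)
    (hY : ∀ s, HasDerivAt Y (V s + η s) s) {t : ℝ} (ht : 0 ≤ t)
    (hW : ∀ s ∈ Set.Icc 0 t, ‖Y s - X s‖ ≤ W) :
    ‖(∫ s in (0 : ℝ)..t, mode a (averageSymbol ψ r) (Y s)) -
        ∫ s in (0 : ℝ)..t, mode a (averageSymbol ψ r) (X s)‖ ≤
      W * lowBound C r a (X t, V t) + W * lowBound C r a (X 0, V 0) +
      (1 + A) * (W * ∫ s in (0 : ℝ)..t, lowBound C r a (X s, V s)) +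
      ∫ s in (0 : ℝ)..t, ‖η s‖ * lowBound C r a (X s, V s) := by
  set c := averageSymbol ψ r with hcdef
  have hc : Continuous c := continuous_averageSymbol hψ r
  have hM : ∀ ξ, ‖c ξ‖ ≤ 1 := norm_averageSymbol_le hψ r
  have hC := hψ.const_nonneg
  have hXc : Continuous X := continuous_iff_continuousAt.2 fun s => (hX s).continuousAt
  have hYc : Continuous Y := continuous_iff_continuousAt.2 fun s => (hY s).continuousAt
  have hVc := hV.continuous
  have hA : 0 ≤ A := (norm_nonneg _).trans (hV.norm_le 0)
  have hZ : Continuous fun s => (X s, V s) := hXc.prodMk hVc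
  have hZ' : Continuous fun s => (Y s, V s) := hYc.prodMk hVc
  have hL : Continuous fun s => lowBound C r a (X s, V s) := (ha.continuous_lowBound C r).comp hZ
  have hW0 : 0 ≤ W := (norm_nonneg _).trans (hW 0 ⟨le_rfl, ht⟩)
  have lnn := localAverage_nonneg (d := d) hC r
  -- pointwise bounds on differences
  have d1 : ∀ s ∈ Set.Icc 0 t, ‖mode a (fun ξ => correctorSymbol c ξ (V s)) (Y s) -
      mode a (fun ξ => correctorSymbol c ξ (V s)) (X s)‖ ≤ W * lowBound C r a (X s, V s) := by
    intro s hs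
    have := ha.norm_mode_averageSymbol_sub_le hψ (b := fun ξ => (transportSymbol ξ (V s))⁻¹)
      (by fun_prop) (fun ξ => norm_inv_transportSymbol_le ξ (V s)) hr (X s)
      ((hW s hs).trans hWr)
    rw [add_sub_cancel] at this
    refine this.trans (mul_le_mul (hW s hs) ?_ (Finset.sum_nonneg fun l _ => lnn _ _) hW0)
    unfold lowBound
    have h2 := Finset.sum_nonneg fun (l : Fin d) (_ : l ∈ Finset.univ) => lnn
      (mode a fun ξ => derivSymbol l ξ * (waveRate ξ * (transportSymbol ξ (V s))⁻¹)) (X s)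
    have h3 := Finset.sum_nonneg fun (k : Fin d) (_ : k ∈ Finset.univ) =>
      Finset.sum_nonneg fun (l : Fin d) (_ : l ∈ Finset.univ) => lnn
      (mode a fun ξ => derivSymbol l ξ * (derivSymbol k ξ * (transportSymbol ξ (V s))⁻¹ ^ 2)) (X s)
    simp only
    linarith
  have d2 : ∀ s ∈ Set.Icc 0 t, ‖mode a (fun ξ => rateSymbol c ξ (V s)) (Y s) -
      mode a (fun ξ => rateSymbol c ξ (V s)) (X s)‖ ≤ W * lowBound C r a (X s, V s) := by
    intro s hs
    have := ha.norm_mode_averageSymbol_sub_le hψ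
      (b := fun ξ => waveRate ξ * (transportSymbol ξ (V s))⁻¹)
      (by fun_prop) (fun ξ => norm_waveRate_mul_inv_le ξ (V s)) hr (X s)
      ((hW s hs).trans hWr)
    rw [add_sub_cancel] at this
    refine this.trans (mul_le_mul (hW s hs) ?_ (Finset.sum_nonneg fun l _ => lnn _ _) hW0)
    unfold lowBound
    have h2 := Finset.sum_nonneg fun (l : Fin d) (_ : l ∈ Finset.univ) => lnn
      (mode a fun ξ => derivSymbol l ξ * (transportSymbol ξ (V s))⁻¹) (X s)
    have h3 := Finset.sum_nonneg fun (k : Fin d) (_ : k ∈ Finset.univ) =>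
      Finset.sum_nonneg fun (l : Fin d) (_ : l ∈ Finset.univ) => lnn
      (mode a fun ξ => derivSymbol l ξ * (derivSymbol k ξ * (transportSymbol ξ (V s))⁻¹ ^ 2)) (X s)
    simp only
    linarith
  have d3 : ∀ s ∈ Set.Icc 0 t, ∑ k, ‖mode a (fun ξ => velocitySymbol c k ξ (V s)) (Y s) -
      mode a (fun ξ => velocitySymbol c k ξ (V s)) (X s)‖ ≤ W * lowBound C r a (X s, V s) := by
    intro s hs
    have : ∀ k, ‖mode a (fun ξ => velocitySymbol c k ξ (V s)) (Y s) -
      mode a (fun ξ => velocitySymbol c k ξ (V s)) (X s)‖ ≤ W * ∑ l, localAverage C r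
        (mode a fun ξ => derivSymbol l ξ * (derivSymbol k ξ * (transportSymbol ξ (V s))⁻¹ ^ 2))
        (X s) := fun k => by
      have := ha.norm_mode_averageSymbol_sub_le hψ
        (b := fun ξ => derivSymbol k ξ * (transportSymbol ξ (V s))⁻¹ ^ 2)
        (by fun_prop) (fun ξ => norm_derivSymbol_mul_inv_sq_le k ξ (V s)) hr (X s)
        ((hW s hs).trans hWr)
      rw [add_sub_cancel] at this
      exact this.trans (mul_le_mul_of_nonneg_right (hW s hs) (Finset.sum_nonneg fun l _ => lnn _ _))
    refine (Finset.sum_le_sum fun k _ => this k).trans ?_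
    rw [← Finset.mul_sum]
    refine mul_le_mul_of_nonneg_left ?_ hW0
    unfold lowBound
    have h2 := Finset.sum_nonneg fun (l : Fin d) (_ : l ∈ Finset.univ) => lnn
      (mode a fun ξ => derivSymbol l ξ * (transportSymbol ξ (V s))⁻¹) (X s)
    have h3 := Finset.sum_nonneg fun (l : Fin d) (_ : l ∈ Finset.univ) => lnn
      (mode a fun ξ => derivSymbol l ξ * (waveRate ξ * (transportSymbol ξ (V s))⁻¹)) (X s)
    simp only
    linarith
  have d4 : ∀ s ∈ Set.Icc 0 t, ∑ l, ‖mode a (fun ξ => gradSymbol c l ξ (V s)) (Y s)‖ ≤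
      lowBound C r a (X s, V s) := by
    intro s hs
    have : ∀ l, ‖mode a (fun ξ => gradSymbol c l ξ (V s)) (Y s)‖ ≤ localAverage C r
        (mode a fun ξ => derivSymbol l ξ * (transportSymbol ξ (V s))⁻¹) (X s) := fun l => by
      have := ha.norm_mode_averageSymbol_le hψ
        (b := fun ξ => derivSymbol l ξ * (transportSymbol ξ (V s))⁻¹)
        (by fun_prop) (fun ξ => norm_derivSymbol_mul_inv_le l ξ (V s)) hr (X s)
        ((hW s hs).trans hWr)
      rwa [add_sub_cancel] at this
    refine (Finset.sum_le_sum fun k _ => this k).trans ?_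
    unfold lowBound
    have h2 := Finset.sum_nonneg fun (l : Fin d) (_ : l ∈ Finset.univ) => lnn
      (mode a fun ξ => derivSymbol l ξ * (waveRate ξ * (transportSymbol ξ (V s))⁻¹)) (X s)
    have h3 := Finset.sum_nonneg fun (k : Fin d) (_ : k ∈ Finset.univ) =>
      Finset.sum_nonneg fun (l : Fin d) (_ : l ∈ Finset.univ) => lnn
      (mode a fun ξ => derivSymbol l ξ * (derivSymbol k ξ * (transportSymbol ξ (V s))⁻¹ ^ 2)) (X s)
    simp only
    linarith
  -- integrability of the four families
  have hΦl : ∀ l, IntervalIntegrable (fun s => Φ s l) volume 0 t := fun l => by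
    refine (intervalIntegrable_const (c := A)).mono_fun ?_ (Eventually.of_forall fun s => ?_)
    · exact ((by fun_prop : Continuous fun y : Space d => y l).measurable.comp
        hV.measurable).aestronglyMeasurable
    · exact (PiLp.norm_apply_le (Φ s) l).trans ((hV.norm_le s).trans (le_abs_self A))
  have cR := ha.continuous_mode (continuous_rateSymbol hc) (norm_rateSymbol_le hM)
  have cG := fun l => ha.continuous_mode (continuous_gradSymbol hc l) (norm_gradSymbol_le hM l)
  have cW := fun l => ha.continuous_mode (continuous_velocitySymbol hc l)
    (norm_velocitySymbol_le hM l)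
  -- The path `Y` is paired with the velocity of `X`, the discrepancy being the drift η. The symbols
  -- along `Y` and `X` then coincide at each time and differ only in the point of evaluation, so the
  -- symbol never has to be differenced in v; the price is the gradient term with weight η.
  have eY := ha.integral_mode_path hc hM hV hη hY t
  have eX := ha.integral_mode_path hc hM hV (η := fun _ => 0) continuous_const
    (by simpa using hX) t
  simp only [PiLp.zero_apply, zero_smul, intervalIntegral.integral_zero, Finset.sum_const_zero,
    sub_zero] at eX
  have tR : (∫ s in (0 : ℝ)..t, mode a (fun ξ => rateSymbol c ξ (V s)) (Y s)) -
      (∫ s in (0 : ℝ)..t, mode a (fun ξ => rateSymbol c ξ (V s)) (X s)) =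
      ∫ s in (0 : ℝ)..t, (mode a (fun ξ => rateSymbol c ξ (V s)) (Y s) -
        mode a (fun ξ => rateSymbol c ξ (V s)) (X s)) :=
    (intervalIntegral.integral_sub ((cR.comp hZ').intervalIntegrable _ _)
      ((cR.comp hZ).intervalIntegrable _ _)).symm
  have tW : (∑ l, ∫ s in (0 : ℝ)..t, Φ s l • mode a (fun ξ => velocitySymbol c l ξ (V s)) (Y s)) -
      (∑ l, ∫ s in (0 : ℝ)..t, Φ s l • mode a (fun ξ => velocitySymbol c l ξ (V s)) (X s)) =
      ∑ l, ∫ s in (0 : ℝ)..t, Φ s l • (mode a (fun ξ => velocitySymbol c l ξ (V s)) (Y s) -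
        mode a (fun ξ => velocitySymbol c l ξ (V s)) (X s)) := by
    rw [← Finset.sum_sub_distrib]
    refine Finset.sum_congr rfl fun l _ => ?_
    have i1 : IntervalIntegrable
        (fun s => Φ s l • mode a (fun ξ => velocitySymbol c l ξ (V s)) (Y s)) volume 0 t :=
      (hΦl l).smul_continuousOn ((cW l).comp hZ').continuousOn
    have i2 : IntervalIntegrable
        (fun s => Φ s l • mode a (fun ξ => velocitySymbol c l ξ (V s)) (X s)) volume 0 t :=
      (hΦl l).smul_continuousOn ((cW l).comp hZ).continuousOn
    rw [← intervalIntegral.integral_sub i1 i2]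
    simp only [smul_sub]
  have nR : ‖∫ s in (0 : ℝ)..t, (mode a (fun ξ => rateSymbol c ξ (V s)) (Y s) -
      mode a (fun ξ => rateSymbol c ξ (V s)) (X s))‖ ≤
      W * ∫ s in (0 : ℝ)..t, lowBound C r a (X s, V s) := by
    rw [← intervalIntegral.integral_const_mul]
    exact norm_integral_le_integral_of_le (continuous_const.mul hL) ht d2
  have cWn : ∀ l, Continuous fun s => ‖mode a (fun ξ => velocitySymbol c l ξ (V s)) (Y s) -
      mode a (fun ξ => velocitySymbol c l ξ (V s)) (X s)‖ := fun l =>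
    (((cW l).comp hZ').sub ((cW l).comp hZ)).norm
  have nW : ‖∑ l, ∫ s in (0 : ℝ)..t, Φ s l • (mode a (fun ξ => velocitySymbol c l ξ (V s)) (Y s) -
      mode a (fun ξ => velocitySymbol c l ξ (V s)) (X s))‖ ≤
      A * (W * ∫ s in (0 : ℝ)..t, lowBound C r a (X s, V s)) := by
    rw [← intervalIntegral.integral_const_mul, ← intervalIntegral.integral_const_mul]
    calc _ ≤ ∑ l, ∫ s in (0 : ℝ)..t, A * ‖mode a (fun ξ => velocitySymbol c l ξ (V s)) (Y s) -
          mode a (fun ξ => velocitySymbol c l ξ (V s)) (X s)‖ := by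
          refine (norm_sum_le _ _).trans (Finset.sum_le_sum fun l _ => ?_)
          refine norm_integral_le_integral_of_le (continuous_const.mul (cWn l)) ht fun s _ => ?_
          rw [norm_smul]
          exact mul_le_mul_of_nonneg_right ((PiLp.norm_apply_le _ l).trans (hV.norm_le s))
            (norm_nonneg _)
      _ = ∫ s in (0 : ℝ)..t, ∑ l, A * ‖mode a (fun ξ => velocitySymbol c l ξ (V s)) (Y s) -
          mode a (fun ξ => velocitySymbol c l ξ (V s)) (X s)‖ :=
          (intervalIntegral.integral_finsetSum fun l _ =>
            (continuous_const.mul (cWn l)).intervalIntegrable _ _).symm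
      _ ≤ _ := by
          refine intervalIntegral.integral_mono_on ht ((continuous_finsetSum _ fun l _ =>
            continuous_const.mul (cWn l)).intervalIntegrable _ _)
            ((continuous_const.mul (continuous_const.mul hL)).intervalIntegrable _ _)
            fun s hs => ?_
          rw [← Finset.mul_sum]
          gcongr
          exact d3 s hs
  have cGn : ∀ l, Continuous fun s => ‖η s‖ * ‖mode a (fun ξ => gradSymbol c l ξ (V s)) (Y s)‖ :=
    fun l => hη.norm.mul ((cG l).comp hZ').norm
  have nG : ‖∑ l, ∫ s in (0 : ℝ)..t, η s l • mode a (fun ξ => gradSymbol c l ξ (V s)) (Y s)‖ ≤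
      ∫ s in (0 : ℝ)..t, ‖η s‖ * lowBound C r a (X s, V s) := by
    calc _ ≤ ∑ l, ∫ s in (0 : ℝ)..t, ‖η s‖ * ‖mode a (fun ξ => gradSymbol c l ξ (V s)) (Y s)‖ := by
          refine (norm_sum_le _ _).trans (Finset.sum_le_sum fun l _ => ?_)
          refine norm_integral_le_integral_of_le (cGn l) ht fun s _ => ?_
          rw [norm_smul]
          gcongr
          exact PiLp.norm_apply_le _ l
      _ = ∫ s in (0 : ℝ)..t, ∑ l, ‖η s‖ * ‖mode a (fun ξ => gradSymbol c l ξ (V s)) (Y s)‖ :=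
          (intervalIntegral.integral_finsetSum fun l _ => (cGn l).intervalIntegrable _ _).symm
      _ ≤ _ := by
          refine intervalIntegral.integral_mono_on ht
            ((continuous_finsetSum _ fun l _ => cGn l).intervalIntegrable _ _)
            ((hη.norm.mul hL).intervalIntegrable _ _) fun s hs => ?_
          rw [← Finset.mul_sum]
          gcongr
          exact d4 s hs
  have n1 := d1 t ⟨ht, le_rfl⟩
  have n0 := d1 0 ⟨le_rfl, ht⟩
  rw [eY, eX]
  rw [← tR] at nR
  rw [← tW] at nW
  -- The terms along the two paths are matched in pairs; the drift term `G` has no counterpart along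
  -- `X` and is bounded on its own.
  have key : ∀ p q p' q' R R' G S S' : CSpace d, ‖(p - q + R - G + S) - (p' - q' + R' + S')‖ ≤
      ‖p - p'‖ + ‖q - q'‖ + ‖R - R'‖ + ‖S - S'‖ + ‖G‖ := by
    intro p q p' q' R R' G S S'
    have e : (p - q + R - G + S) - (p' - q' + R' + S') =
        (p - p') - (q - q') + (R - R') + (S - S') - G := by abel
    rw [e]
    refine (norm_sub_le _ _).trans ?_
    gcongr
    refine (norm_add_le _ _).trans ?_
    gcongr
    refine (norm_add_le _ _).trans ?_
    gcongr
    exact norm_sub_le _ _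
  refine (key _ _ _ _ _ _ _ _ _).trans ?_
  linarith

end PathEstimates

/-! ### A bound for the scale quantity in L² of phase space, uniform in the scale -/

section ScaleBound

variable {d : ℕ} {ψ : Space d → ℝ} {C : ℝ} {a : Space d → CSpace d}

theorem lintegral_enorm_sq_eq_eLpNorm_sq {α E : Type*} [MeasurableSpace α] {μ : Measure α}
    [NormedAddCommGroup E] (g : α → E) : ∫⁻ x, ‖g x‖ₑ ^ 2 ∂μ = eLpNorm g 2 μ ^ 2 := by
  have := eLpNorm_nnreal_pow_eq_lintegral (μ := μ) (f := g) (p := 2) (by norm_num)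
  simp only [NNReal.coe_ofNat, ENNReal.coe_ofNat, ENNReal.rpow_ofNat] at this
  exact this.symm

theorem eLpNorm_two_le_of_lintegral_le {α E : Type*} [MeasurableSpace α] {μ : Measure α}
    [NormedAddCommGroup E] {g : α → E} {K : ℝ} {I : ℝ≥0∞} (hK : 0 ≤ K)
    (h : ∫⁻ x, ‖g x‖ₑ ^ 2 ∂μ ≤ ENNReal.ofReal (K ^ 2) * I) :
    eLpNorm g 2 μ ≤ ENNReal.ofReal K * I ^ (1 / 2 : ℝ) := by
  rw [lintegral_enorm_sq_eq_eLpNorm_sq, ENNReal.ofReal_pow hK] at h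
  have h2 := ENNReal.rpow_le_rpow h (z := 1 / 2) (by norm_num)
  rwa [ENNReal.mul_rpow_of_nonneg _ _ (by norm_num), ← ENNReal.rpow_natCast, ← ENNReal.rpow_mul,
    ← ENNReal.rpow_natCast, ← ENNReal.rpow_mul, Nat.cast_ofNat, mul_one_div_cancel two_ne_zero,
    ENNReal.rpow_one, ENNReal.rpow_one] at h2

/-- The squared homogeneous Sobolev norm of order `3/4`, in frequency variables. -/
noncomputable def frequencyEnergy (a : Space d → CSpace d) : ℝ≥0∞ :=
  ∫⁻ ξ, ENNReal.ofReal (‖ξ‖ ^ (3 / 2 : ℝ) * ‖a ξ‖ ^ 2)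

theorem exists_eLpNorm_mode_le (d : ℕ) (R : ℝ) : ∃ K : ℝ, 0 ≤ K ∧
    ∀ (a : Space d → CSpace d), BandLimited a → ∀ (b : Space d → Space d → ℂ),
      (Continuous fun q : Space d × Space d => b q.1 q.2) → ∀ M : ℝ, 0 ≤ M →
      (∀ ξ v, ‖b ξ v‖ ≤ M * (‖ξ‖ * waveRate ξ / ‖transportSymbol ξ v‖)) →
      eLpNorm (fun z : Space d × Space d => mode a (fun ξ => b ξ z.2) z.1) 2 (phaseMeasure d R) ≤
        ENNReal.ofReal (M * K) * frequencyEnergy a ^ (1 / 2 : ℝ) := by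
  obtain ⟨C, hC0, hC⟩ := exists_lintegral_mode_sq_le d R
  refine ⟨√C, Real.sqrt_nonneg _, fun a ha b hb M hM h => ?_⟩
  refine eLpNorm_two_le_of_lintegral_le (by positivity) ?_
  rw [mul_pow, Real.sq_sqrt hC0]
  exact hC a ha b hb M hM h

theorem measurePreserving_phaseMeasure_translate (R : ℝ) (y : Space d) :
    MeasurePreserving (fun z : Space d × Space d => (z.1 + y, z.2)) (phaseMeasure d R)
      (phaseMeasure d R) :=
  (measurePreserving_add_right volume y).prod (MeasurePreserving.id _)

/-- Cauchy–Schwarz on the ball of radius 2, then invariance of phase space measure under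
translations in x. In the rescaled variable neither step sees r, so the constant serves all scales
at once. -/
theorem exists_eLpNorm_localAverage_le (d : ℕ) (C : ℝ) (hC : 0 ≤ C) : ∃ K : ℝ, 0 ≤ K ∧
    ∀ (R r : ℝ) (h : Space d → Space d → CSpace d),
      (Measurable fun z : Space d × Space d => h z.2 z.1) →
      eLpNorm (fun z : Space d × Space d => localAverage C r (h z.2) z.1) 2 (phaseMeasure d R) ≤
        ENNReal.ofReal K * eLpNorm (fun z : Space d × Space d => h z.2 z.1) 2
          (phaseMeasure d R) := by
  set β : Measure (Space d) := volume.restrict (Metric.closedBall (0 : Space d) 2) with hβ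
  have : IsFiniteMeasure β := ⟨by simp [hβ, measure_closedBall_lt_top]⟩
  set B : ℝ := β.real Set.univ with hB
  have hBe : β Set.univ = ENNReal.ofReal B := (ofReal_measureReal (measure_ne_top β _)).symm
  have hB0 : 0 ≤ B := measureReal_nonneg
  refine ⟨C * B, by positivity, fun R r h hh => ?_⟩
  have hcs : ∀ z : Space d × Space d, ‖localAverage C r (h z.2) z.1‖ₑ ^ 2 ≤
      ENNReal.ofReal (C ^ 2 * B) * ∫⁻ u, ‖h z.2 (z.1 + r • u)‖ₑ ^ 2 ∂β := by
    intro z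
    have hc : Measurable fun u => h z.2 (z.1 + r • u) :=
      hh.comp (by fun_prop : Measurable fun u : Space d => (z.1 + r • u, z.2))
    have h1 : ‖∫ u, ‖h z.2 (z.1 + r • u)‖ ∂β‖ₑ ≤ eLpNorm (fun u => h z.2 (z.1 + r • u)) 1 β := by
      rw [eLpNorm_one_eq_lintegral_enorm]
      refine (enorm_integral_le_lintegral_enorm _).trans (le_of_eq ?_)
      simp
    have h2 : eLpNorm (fun u => h z.2 (z.1 + r • u)) 1 β ≤
        eLpNorm (fun u => h z.2 (z.1 + r • u)) 2 β * β Set.univ ^ (1 / 2 : ℝ) := by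
      refine (eLpNorm_le_eLpNorm_mul_rpow_measure_univ (by norm_num : (1 : ℝ≥0∞) ≤ 2)
        hc.aestronglyMeasurable).trans (le_of_eq ?_)
      norm_num
    rw [localAverage, enorm_mul, mul_pow, ENNReal.ofReal_mul (by positivity),
      ENNReal.ofReal_pow hC, Real.enorm_of_nonneg hC, mul_assoc]
    gcongr
    calc _ ≤ (eLpNorm (fun u => h z.2 (z.1 + r • u)) 2 β * β Set.univ ^ (1 / 2 : ℝ)) ^ 2 := by
          gcongr; exact h1.trans h2
      _ = _ := by
          rw [mul_pow, ← lintegral_enorm_sq_eq_eLpNorm_sq, ← ENNReal.rpow_natCast (_ ^ _),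
            ← ENNReal.rpow_mul, hBe, mul_comm]
          norm_num
  have hm : Measurable (Function.uncurry fun (z : Space d × Space d) (u : Space d) =>
      ‖h z.2 (z.1 + r • u)‖ₑ ^ 2) := by
    have h1 : Measurable fun q : (Space d × Space d) × Space d => h q.1.2 (q.1.1 + r • q.2) :=
      hh.comp (by fun_prop : Measurable fun q : (Space d × Space d) × Space d =>
        (q.1.1 + r • q.2, q.1.2))
    exact h1.enorm.pow_const 2
  have main : ∫⁻ z : Space d × Space d, ‖localAverage C r (h z.2) z.1‖ₑ ^ 2 ∂(phaseMeasure d R) ≤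
      ENNReal.ofReal ((C * B) ^ 2) * ∫⁻ z, ‖h z.2 z.1‖ₑ ^ 2 ∂(phaseMeasure d R) := by
    refine (lintegral_mono hcs).trans ?_
    rw [lintegral_const_mul' _ _ ENNReal.ofReal_ne_top, lintegral_lintegral_swap hm.aemeasurable]
    have : ∀ u, ∫⁻ z : Space d × Space d, ‖h z.2 (z.1 + r • u)‖ₑ ^ 2 ∂(phaseMeasure d R) =
        ∫⁻ z, ‖h z.2 z.1‖ₑ ^ 2 ∂(phaseMeasure d R) := fun u =>
      (measurePreserving_phaseMeasure_translate R (r • u)).lintegral_comp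
        (f := fun z => ‖h z.2 z.1‖ₑ ^ 2) (hh.enorm.pow_const 2)
    simp_rw [this]
    rw [lintegral_const, hBe, mul_comm (∫⁻ z, _ ∂_), ← mul_assoc, ← ENNReal.ofReal_mul (by positivity)]
    apply le_of_eq; congr 2; ring
  have := eLpNorm_two_le_of_lintegral_le (by positivity) main
  rwa [lintegral_enorm_sq_eq_eLpNorm_sq, ← ENNReal.rpow_natCast, ← ENNReal.rpow_mul, Nat.cast_ofNat,
    mul_one_div_cancel two_ne_zero, ENNReal.rpow_one] at this

theorem norm_le_waveRate_sq (ξ : Space d) : ‖ξ‖ ≤ waveRate ξ ^ 2 := by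
  rw [waveRate_sq]; linarith

theorem norm_inv_le_waveRate_div (ξ v : Space d) :
    ‖(transportSymbol ξ v)⁻¹‖ ≤ waveRate ξ / ‖transportSymbol ξ v‖ := by
  rw [norm_inv, ← one_div]
  gcongr
  exact one_le_waveRate ξ

theorem norm_waveRate_mul_inv_le_div (ξ v : Space d) :
    ‖(waveRate ξ : ℂ) * (transportSymbol ξ v)⁻¹‖ ≤ waveRate ξ / ‖transportSymbol ξ v‖ := by
  rw [norm_mul, Complex.norm_real, Real.norm_of_nonneg (waveRate_pos ξ).le, norm_inv,
    ← div_eq_mul_inv]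

/-- The acceleration term has an extra factor |ξ|/|σ|, where σ is the transport symbol. Since |ξ| ≤
λ² and λ ≤ |σ|, it is no worse than the rate term λ/|σ|; this is what fixes the choice of λ. -/
theorem norm_derivSymbol_mul_inv_sq_le_div (l : Fin d) (ξ v : Space d) :
    ‖derivSymbol l ξ * (transportSymbol ξ v)⁻¹ ^ 2‖ ≤
      2 * Real.pi * (waveRate ξ / ‖transportSymbol ξ v‖) := by
  rw [norm_mul, norm_pow, norm_inv]
  have h1 := waveRate_le_norm_transportSymbol ξ v
  have h2 := waveRate_pos ξ
  have h3 : 0 < ‖transportSymbol ξ v‖ := h2.trans_le h1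
  calc _ ≤ 2 * Real.pi * waveRate ξ ^ 2 * ‖transportSymbol ξ v‖⁻¹ ^ 2 := by
        gcongr
        refine (norm_derivSymbol_le l ξ).trans ?_
        gcongr
        exact norm_le_waveRate_sq ξ
    _ = 2 * Real.pi * (waveRate ξ / ‖transportSymbol ξ v‖) *
        (waveRate ξ / ‖transportSymbol ξ v‖) := by field_simp
    _ ≤ 2 * Real.pi * (waveRate ξ / ‖transportSymbol ξ v‖) * 1 := by
        gcongr
        exact (div_le_one h3).2 h1
    _ = _ := mul_one _

/-- Multiplying by a first order symbol. -/
theorem norm_mul_le_of_le_div {c e : ℂ} {M m : ℝ} (hM : 0 ≤ M) {ξ v : Space d}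
    (hc : ‖c‖ ≤ M * ‖ξ‖)
    (he : ‖e‖ ≤ m * (waveRate ξ / ‖transportSymbol ξ v‖)) :
    ‖c * e‖ ≤ M * m * (‖ξ‖ * waveRate ξ / ‖transportSymbol ξ v‖) := by
  rw [norm_mul]
  calc ‖c‖ * ‖e‖ ≤ (M * ‖ξ‖) * (m * (waveRate ξ / ‖transportSymbol ξ v‖)) := by gcongr
    _ = _ := by ring

/-- The quantity that controls the corrector at scale `r`. -/
noncomputable def scaleBound (ψ : Space d → ℝ) (C r : ℝ) (a : Space d → CSpace d)
    (z : Space d × Space d) : ℝ :=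
  lowBound C r a z + 2 / r * highBound (fun ξ => 1 - averageSymbol ψ r ξ) a z

theorem scaleBound_nonneg (hC : 0 ≤ C) {r : ℝ} (hr : 0 < r) (a : Space d → CSpace d)
    (z : Space d × Space d) : 0 ≤ scaleBound ψ C r a z :=
  add_nonneg (lowBound_nonneg hC r a z) (mul_nonneg (by positivity) (highBound_nonneg _ a z))

theorem BandLimited.continuous_scaleBound (ha : BandLimited a) (hψ : AveragingKernel ψ C) (r : ℝ) :
    Continuous (scaleBound ψ C r a) :=
  (ha.continuous_lowBound C r).add (continuous_const.mul (ha.continuous_highBound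
    (continuous_const.sub (continuous_averageSymbol hψ r)) (norm_one_sub_averageSymbol_le_two hψ r)))

theorem eLpNorm_sum_le_of_le {α ι : Type*} [MeasurableSpace α] {μ : Measure α} [Fintype ι]
    {g : ι → α → ℝ} (hg : ∀ i, AEStronglyMeasurable (g i) μ) {K : ℝ} {I : ℝ≥0∞}
    (h : ∀ i, eLpNorm (g i) 2 μ ≤ ENNReal.ofReal K * I) :
    eLpNorm (fun x => ∑ i, g i x) 2 μ ≤ ENNReal.ofReal (Fintype.card ι * K) * I := by
  have e : (fun x => ∑ i, g i x) = ∑ i, g i := by ext x; simp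
  rw [e]
  refine (eLpNorm_sum_le (fun i _ => hg i) (by norm_num)).trans ?_
  refine (Finset.sum_le_sum fun i _ => h i).trans (le_of_eq ?_)
  rw [Finset.sum_const, Finset.card_univ, nsmul_eq_mul, ENNReal.ofReal_mul (by positivity),
    ENNReal.ofReal_natCast, mul_assoc]

theorem eLpNorm_add_le_of_le {α : Type*} [MeasurableSpace α] {μ : Measure α}
    {g h : α → ℝ} (hg : AEStronglyMeasurable g μ) (hh : AEStronglyMeasurable h μ) {K L : ℝ}
    (hK : 0 ≤ K) (hL : 0 ≤ L) {I : ℝ≥0∞} (h1 : eLpNorm g 2 μ ≤ ENNReal.ofReal K * I)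
    (h2 : eLpNorm h 2 μ ≤ ENNReal.ofReal L * I) :
    eLpNorm (fun x => g x + h x) 2 μ ≤ ENNReal.ofReal (K + L) * I := by
  refine (eLpNorm_add_le hg hh (by norm_num)).trans ((add_le_add h1 h2).trans (le_of_eq ?_))
  rw [← add_mul, ENNReal.ofReal_add hK hL]

/-- Every constituent has a symbol bounded by a constant times |ξ|λ/|σ|, where σ is the transport
symbol. In the low part the factor |ξ| is a derivative; in the high part it comes from |1 - ψ̂(rξ)|
≤ 2πr|ξ|, the factor r cancelling against 2/r. The constant is independent of r, so each dyadic
scale costs the same. -/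
theorem exists_eLpNorm_scaleBound_le (hψ : AveragingKernel ψ C) (R : ℝ) : ∃ K : ℝ, 0 ≤ K ∧
    ∀ (a : Space d → CSpace d), BandLimited a → ∀ r : ℝ, 0 < r →
      eLpNorm (scaleBound ψ C r a) 2 (phaseMeasure d R) ≤
        ENNReal.ofReal K * frequencyEnergy a ^ (1 / 2 : ℝ) := by
  obtain ⟨K₁, hK₁, h₁⟩ := exists_eLpNorm_mode_le d R
  obtain ⟨K₂, hK₂, h₂⟩ := exists_eLpNorm_localAverage_le d C hψ.const_nonneg
  have hp := Real.pi_pos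
  -- A sum of all the constants that occur: the factors 4π belong to the high part, as (2/r)·2πr,
  -- the factors 2π to derivatives in position and to the acceleration term.
  set M : ℝ := (4 * Real.pi) * (2 * Real.pi) + 4 * Real.pi + (2 * Real.pi) * (2 * Real.pi) +
    2 * Real.pi with hM
  have hM0 : 0 ≤ M := by positivity
  set L : ℝ := K₂ * (M * K₁)
  have hL0 : 0 ≤ L := by positivity
  set H : ℝ := M * K₁
  have hH0 : 0 ≤ H := by positivity
  refine ⟨(Fintype.card (Fin d) * L + Fintype.card (Fin d) * L +
    Fintype.card (Fin d) * (Fintype.card (Fin d) * L)) +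
    (H + H + Fintype.card (Fin d) * H), by positivity, fun a ha r hr => ?_⟩
  set I := frequencyEnergy a ^ (1 / 2 : ℝ)
  have upgrade : ∀ (e : ℂ) (m : ℝ) (ξ v : Space d), m ≤ M →
      ‖e‖ ≤ m * (‖ξ‖ * waveRate ξ / ‖transportSymbol ξ v‖) →
      ‖e‖ ≤ M * (‖ξ‖ * waveRate ξ / ‖transportSymbol ξ v‖) := fun e m ξ v hm he => by
    have := waveRate_pos ξ
    exact he.trans (by gcongr)
  have low : ∀ (b : Space d → Space d → ℂ),
      (Continuous fun q : Space d × Space d => b q.1 q.2) →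
      (∃ m n, ∀ ξ v, ‖b ξ v‖ ≤ m * (1 + ‖ξ‖) ^ n) →
      (∀ ξ v, ‖b ξ v‖ ≤ M * (‖ξ‖ * waveRate ξ / ‖transportSymbol ξ v‖)) →
      (AEStronglyMeasurable (fun z : Space d × Space d =>
        localAverage C r (mode a fun ξ => b ξ z.2) z.1) (phaseMeasure d R)) ∧
      eLpNorm (fun z : Space d × Space d => localAverage C r (mode a fun ξ => b ξ z.2) z.1) 2
        (phaseMeasure d R) ≤ ENNReal.ofReal L * I := by
    rintro b hb ⟨m, n, hmn⟩ hbM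
    refine ⟨(ha.continuous_localAverage hb hmn C r).aestronglyMeasurable, ?_⟩
    refine (h₂ R r (fun v => mode a fun ξ => b ξ v)
      (ha.continuous_mode hb hmn).measurable).trans ?_
    rw [ENNReal.ofReal_mul hK₂, mul_assoc]
    gcongr
    exact h₁ a ha b hb M hM0 hbM
  have high : ∀ (b : Space d → Space d → ℂ),
      (Continuous fun q : Space d × Space d => b q.1 q.2) →
      (∃ m n, ∀ ξ v, ‖(1 - averageSymbol ψ r ξ) * b ξ v‖ ≤ m * (1 + ‖ξ‖) ^ n) →
      (∃ m, 0 ≤ m ∧ (4 * Real.pi) * m ≤ M ∧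
        ∀ ξ v, ‖b ξ v‖ ≤ m * (waveRate ξ / ‖transportSymbol ξ v‖)) →
      (AEStronglyMeasurable (fun z : Space d × Space d =>
        2 / r * ‖mode a (fun ξ => (1 - averageSymbol ψ r ξ) * b ξ z.2) z.1‖) (phaseMeasure d R)) ∧
      eLpNorm (fun z : Space d × Space d =>
        2 / r * ‖mode a (fun ξ => (1 - averageSymbol ψ r ξ) * b ξ z.2) z.1‖) 2
        (phaseMeasure d R) ≤ ENNReal.ofReal H * I := by
    rintro b hb ⟨m', n, hmn⟩ ⟨m, hm0, hm, hbm⟩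
    have hcc : Continuous fun q : Space d × Space d => (1 - averageSymbol ψ r q.1) * b q.1 q.2 :=
      (continuous_const.sub ((continuous_averageSymbol hψ r).comp continuous_fst)).mul hb
    have hmode := ha.continuous_mode (b := fun ξ v => (1 - averageSymbol ψ r ξ) * b ξ v) hcc hmn
    refine ⟨(continuous_const.mul hmode.norm).aestronglyMeasurable, ?_⟩
    have e : (fun z : Space d × Space d =>
        2 / r * ‖mode a (fun ξ => (1 - averageSymbol ψ r ξ) * b ξ z.2) z.1‖) =
        (2 / r) • fun z : Space d × Space d =>
          ‖mode a (fun ξ => (1 - averageSymbol ψ r ξ) * b ξ z.2) z.1‖ := rfl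
    rw [e, eLpNorm_const_smul, eLpNorm_norm, Real.enorm_of_nonneg (by positivity)]
    -- The symbol bound is taken with constant (r/2)M so that the prefactor 2/r leaves M.
    have h3 := h₁ a ha (fun ξ v => (1 - averageSymbol ψ r ξ) * b ξ v) hcc (r / 2 * M)
      (by positivity) fun ξ v => ?_
    · calc _ ≤ ENNReal.ofReal (2 / r) * (ENNReal.ofReal (r / 2 * M * K₁) * I) := by gcongr
        _ = _ := by
          rw [← mul_assoc, ← ENNReal.ofReal_mul (by positivity)]
          congr 2
          simp only [H]; field_simp
    · refine (norm_mul_le_of_le_div (by positivity)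
        (norm_one_sub_averageSymbol_le hψ hr.le ξ) (hbm ξ v)).trans ?_
      have := waveRate_pos ξ
      have h4 : 2 * Real.pi * r * m ≤ r / 2 * M := by nlinarith
      gcongr
  have one : ∀ b : Space d → Space d → ℂ,
      (∀ ξ v, ‖b ξ v‖ ≤ waveRate ξ / ‖transportSymbol ξ v‖) →
      ∀ ξ v, ‖b ξ v‖ ≤ 1 * (waveRate ξ / ‖transportSymbol ξ v‖) := fun b h ξ v => by
    rw [one_mul]; exact h ξ v
  have l1 := fun l : Fin d => low (fun ξ v => derivSymbol l ξ * (transportSymbol ξ v)⁻¹)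
    (by fun_prop) ⟨_, _, fun ξ v => norm_derivSymbol_mul_inv_le l ξ v⟩ fun ξ v =>
      upgrade _ _ ξ v (by rw [mul_one, hM]; nlinarith)
        (norm_mul_le_of_le_div (by positivity) (norm_derivSymbol_le l ξ)
        (one _ norm_inv_le_waveRate_div ξ v))
  have l2 := fun l : Fin d => low
    (fun ξ v => derivSymbol l ξ * (waveRate ξ * (transportSymbol ξ v)⁻¹))
    (by fun_prop) ⟨_, _, fun ξ v => norm_derivSymbol_mul_le
      (fun ξ => norm_waveRate_mul_inv_le ξ v) l ξ⟩ fun ξ v =>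
      upgrade _ _ ξ v (by rw [mul_one, hM]; nlinarith)
        (norm_mul_le_of_le_div (by positivity) (norm_derivSymbol_le l ξ)
        (one _ norm_waveRate_mul_inv_le_div ξ v))
  have l3 := fun k l : Fin d => low
    (fun ξ v => derivSymbol l ξ * (derivSymbol k ξ * (transportSymbol ξ v)⁻¹ ^ 2))
    (by fun_prop) ⟨_, _, fun ξ v => norm_derivSymbol_mul_le
      (fun ξ => norm_derivSymbol_mul_inv_sq_le k ξ v) l ξ⟩ fun ξ v =>
      upgrade _ _ ξ v (by rw [hM]; nlinarith)
        (norm_mul_le_of_le_div (by positivity) (norm_derivSymbol_le l ξ)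
        (norm_derivSymbol_mul_inv_sq_le_div k ξ v))
  have hM2 := norm_one_sub_averageSymbol_le_two hψ r
  have g1 := high (fun ξ v => (transportSymbol ξ v)⁻¹) (by fun_prop)
    ⟨_, _, fun ξ v => norm_correctorSymbol_le (c := fun ξ => 1 - averageSymbol ψ r ξ) hM2 ξ v⟩
    ⟨1, zero_le_one, by rw [mul_one, hM]; nlinarith, one _ norm_inv_le_waveRate_div⟩
  have g2 := high (fun ξ v => waveRate ξ * (transportSymbol ξ v)⁻¹) (by fun_prop)
    ⟨_, _, fun ξ v => norm_rateSymbol_le (c := fun ξ => 1 - averageSymbol ψ r ξ) hM2 ξ v⟩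
    ⟨1, zero_le_one, by rw [mul_one, hM]; nlinarith, one _ norm_waveRate_mul_inv_le_div⟩
  have g3 := fun l : Fin d => high
    (fun ξ v => derivSymbol l ξ * (transportSymbol ξ v)⁻¹ ^ 2) (by fun_prop)
    ⟨_, _, fun ξ v => norm_velocitySymbol_le (c := fun ξ => 1 - averageSymbol ψ r ξ) hM2 l ξ v⟩
    ⟨2 * Real.pi, by positivity, by rw [hM]; nlinarith, norm_derivSymbol_mul_inv_sq_le_div l⟩
  have sumMeas : ∀ {g : Fin d → Space d × Space d → ℝ},
      (∀ i, AEStronglyMeasurable (g i) (phaseMeasure d R)) →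
      AEStronglyMeasurable (fun z => ∑ i, g i z) (phaseMeasure d R) := fun h =>
    Finset.aestronglyMeasurable_fun_sum _ fun i _ => h i
  have s1 := eLpNorm_sum_le_of_le (fun l => (l1 l).1) fun l => (l1 l).2
  have s2 := eLpNorm_sum_le_of_le (fun l => (l2 l).1) fun l => (l2 l).2
  have s3 := eLpNorm_sum_le_of_le (fun k => sumMeas fun l => (l3 k l).1) fun k => eLpNorm_sum_le_of_le (fun l => (l3 k l).1) fun l => (l3 k l).2
  have s4 := eLpNorm_sum_le_of_le (fun l => (g3 l).1) fun l => (g3 l).2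
  have m1 := sumMeas fun l => (l1 l).1
  have m2 := sumMeas fun l => (l2 l).1
  have m3 := sumMeas fun k => sumMeas fun l => (l3 k l).1
  have m4 := sumMeas fun l => (g3 l).1
  have t1 := eLpNorm_add_le_of_le (m1.add m2) m3 (by positivity) (by positivity)
    (eLpNorm_add_le_of_le m1 m2 (by positivity) (by positivity) s1 s2) s3
  have t2 := eLpNorm_add_le_of_le (g1.1.add g2.1) m4 (by positivity) (by positivity)
    (eLpNorm_add_le_of_le g1.1 g2.1 hH0 hH0 g1.2 g2.2) s4
  have t3 := eLpNorm_add_le_of_le ((m1.add m2).add m3) ((g1.1.add g2.1).add m4)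
    (by positivity) (by positivity) t1 t2
  refine le_of_eq_of_le ?_ t3
  congr 1
  ext z
  simp only [scaleBound, lowBound, highBound, correctorSymbol, rateSymbol, velocitySymbol, mul_add,
    Finset.mul_sum, Pi.add_apply]

end ScaleBound

/-! ### Splitting the force into Lipschitz, band-limited and small parts -/

section ForceDecomposition

variable {d : ℕ} {ψ : Space d → ℝ} {C : ℝ} {a : Space d → CSpace d}

theorem AveragingKernel.integrable_smul (hψ : AveragingKernel ψ C) {g : Space d → CSpace d}
    (hg : Measurable g) {A : ℝ} (hA : ∀ x, ‖g x‖ ≤ A) (r : ℝ) (x : Space d) :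
    Integrable fun y => ψ y • g (x - r • y) := by
  have hψm := hψ.continuous.measurable
  refine (hψ.integrable.mul_const A).mono' (by fun_prop) (Eventually.of_forall fun y => ?_)
  rw [norm_smul, Real.norm_of_nonneg (hψ.nonneg y)]
  exact mul_le_mul_of_nonneg_left (hA _) (hψ.nonneg y)

theorem AveragingKernel.norm_integral_smul_le (hψ : AveragingKernel ψ C) {g : Space d → CSpace d}
    {A : ℝ} (hA : ∀ x, ‖g x‖ ≤ A) (r : ℝ) (x : Space d) : ‖∫ y, ψ y • g (x - r • y)‖ ≤ A := by
  have : A = ∫ y, ψ y * A := by rw [integral_mul_const, hψ.integral_eq, one_mul]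
  rw [this]
  refine norm_integral_le_of_norm_le (hψ.integrable.mul_const A) (Eventually.of_forall fun y => ?_)
  rw [norm_smul, Real.norm_of_nonneg (hψ.nonneg y)]
  exact mul_le_mul_of_nonneg_left (hA _) (hψ.nonneg y)

theorem AveragingKernel.integral_smul_eq {r : ℝ} (hr : 0 < r)
    (g : Space d → CSpace d) (x : Space d) :
    ∫ y, ψ y • g (x - r • y) = ∫ u, ψ (r⁻¹ • x - u) • g (r • u) := by
  rw [← integral_sub_left_eq_self (fun y => ψ y • g (x - r • y)) volume (r⁻¹ • x)]
  refine integral_congr_ae (Eventually.of_forall fun u => ?_)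
  beta_reduce
  rw [smul_sub, smul_smul, mul_inv_cancel₀ hr.ne', one_smul, sub_sub_cancel]

/-- Averages of bounded functions are Lipschitz. -/
theorem AveragingKernel.norm_integral_smul_sub_le (hψ : AveragingKernel ψ C)
    {g : Space d → CSpace d} (hg : Measurable g) {A : ℝ} (hA : ∀ x, ‖g x‖ ≤ A) {r : ℝ}
    (hr : 0 < r) (x z : Space d) :
    ‖(∫ y, ψ y • g (x - r • y)) - ∫ y, ψ y • g (z - r • y)‖ ≤
      (C * volume.real (Metric.closedBall (0 : Space d) 2) + 2) * A / r * ‖x - z‖ := by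
  have hA0 : 0 ≤ A := (norm_nonneg _).trans (hA 0)
  have hC := hψ.const_nonneg
  have hB : 0 ≤ volume.real (Metric.closedBall (0 : Space d) 2) := measureReal_nonneg
  rcases le_or_gt ‖x - z‖ r with h | h
  · have hi : ∀ x, Integrable fun u => ψ (r⁻¹ • x - u) • g (r • u) := fun x => by
      have := (hψ.integrable_smul hg hA r x).comp_sub_left (r⁻¹ • x)
      refine this.congr (Eventually.of_forall fun u => ?_)
      beta_reduce
      rw [smul_sub, smul_smul, mul_inv_cancel₀ hr.ne', one_smul, sub_sub_cancel]
    rw [integral_smul_eq hr, integral_smul_eq hr, ← integral_sub (hi x) (hi z)]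
    simp_rw [← sub_smul]
    have hd : ‖r⁻¹ • x - r⁻¹ • z‖ = r⁻¹ * ‖x - z‖ := by
      rw [← smul_sub, norm_smul, norm_inv, Real.norm_of_nonneg hr.le]
    have hd1 : r⁻¹ * ‖x - z‖ ≤ 1 := by rw [inv_mul_le_iff₀ hr, mul_one]; exact h
    -- The rescaled centres are at distance at most one, so both kernels vanish outside the ball of
    -- radius 2 about the first.
    rw [← setIntegral_eq_integral_of_forall_compl_eq_zero
      (s := Metric.closedBall (r⁻¹ • x) 2) (fun u hu => ?_)]
    · refine (norm_setIntegral_le_of_norm_le_const (C := C * (r⁻¹ * ‖x - z‖) * A)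
        measure_closedBall_lt_top fun u _ => ?_).trans ?_
      · rw [norm_smul]
        gcongr
        · rw [Real.norm_eq_abs, ← hd]
          simpa using hψ.lipschitz (r⁻¹ • x - u) (r⁻¹ • z - u)
        · exact hA _
      · have : volume.real (Metric.closedBall (r⁻¹ • x) 2) =
            volume.real (Metric.closedBall (0 : Space d) 2) := by
          simp only [measureReal_def, Measure.addHaar_closedBall_center]
        rw [this]
        have h2 : 0 ≤ 2 * A / r * ‖x - z‖ := by positivity
        calc _ = C * volume.real (Metric.closedBall (0 : Space d) 2) * A / r * ‖x - z‖ := by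
              field_simp
          _ ≤ C * volume.real (Metric.closedBall (0 : Space d) 2) * A / r * ‖x - z‖ +
              2 * A / r * ‖x - z‖ := by linarith
          _ = _ := by ring
    · have hu' : 2 < ‖r⁻¹ • x - u‖ := by
        rw [norm_sub_rev, ← dist_eq_norm]; simpa using hu
      have h3 : 1 < ‖r⁻¹ • z - u‖ := by
        have := norm_sub_le_norm_sub_add_norm_sub (r⁻¹ • x) (r⁻¹ • z) u
        linarith
      rw [hψ.eq_zero _ (by linarith), hψ.eq_zero _ h3, sub_zero, zero_smul]
  -- At distance more than r the trivial bound 2A is already at most 2A|x - z|/r; this accounts for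
  -- the summand 2 in the constant.
  · refine (norm_sub_le _ _).trans ?_
    have h1 := hψ.norm_integral_smul_le hA r x
    have h2 := hψ.norm_integral_smul_le hA r z
    have h3 : 1 ≤ ‖x - z‖ / r := (one_le_div hr).2 h.le
    have h4 : 0 ≤ C * volume.real (Metric.closedBall (0 : Space d) 2) * A * (‖x - z‖ / r) := by
      positivity
    calc _ ≤ 2 * A * 1 := by linarith
      _ ≤ 2 * A * (‖x - z‖ / r) := by gcongr
      _ ≤ C * volume.real (Metric.closedBall (0 : Space d) 2) * A * (‖x - z‖ / r) +
          2 * A * (‖x - z‖ / r) := by linarith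
      _ = _ := by ring

theorem lintegral_phaseMeasure_fst (R : ℝ) {g : Space d → ℝ≥0∞} (hg : Measurable g) :
    ∫⁻ z, g z.1 ∂(phaseMeasure d R) =
      ENNReal.ofReal (volume.real (Metric.closedBall (0 : Space d) R)) * ∫⁻ x, g x := by
  rw [phaseMeasure, lintegral_prod (fun z : Space d × Space d => g z.1)
    (hg.comp measurable_fst).aemeasurable]
  simp only [lintegral_const, Measure.restrict_apply MeasurableSet.univ, Set.univ_inter]
  rw [lintegral_mul_const _ hg, ofReal_measureReal measure_closedBall_lt_top.ne, mul_comm]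

/-- A bounded force field is the sum of a Lipschitz field, of a superposition of plane waves with
small low frequencies, and of a small remainder. -/
theorem exists_force_decomposition (hψ : AveragingKernel ψ C) (R : ℝ) : ∃ K : ℝ, 0 ≤ K ∧
    ∀ (A : ℝ) (F : Space d → Space d) (hF : MemLp F 2 volume), Measurable F → (∀ x, ‖F x‖ ≤ A) →
      ∀ r : ℝ, 0 < r → ∀ ε : ℝ, 0 < ε →
      ∃ (a S rem : Space d → CSpace d), BandLimited a ∧
        (∀ ξ, ‖a ξ‖ ≤ ‖1 - averageSymbol ψ r ξ‖ *
          ‖(𝓕 (forceL2 F hF) : Lp (CSpace d) 2 (volume : Measure (Space d))) ξ‖) ∧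
        (∀ x y, ‖S x - S y‖ ≤ K * A / r * ‖x - y‖) ∧ Measurable rem ∧
        (∃ B, ∀ x, ‖rem x‖ ≤ B) ∧
        ∫⁻ z, ‖rem z.1‖ₑ ^ 2 ∂(phaseMeasure d R) ≤ ENNReal.ofReal ε ∧
        ∀ x, toCSpace (F x) = S x + mode a (fun _ => 1) x + rem x := by
  obtain ⟨K₂, hK₂, h₂⟩ := exists_eLpNorm_localAverage_le d C hψ.const_nonneg
  have hC := hψ.const_nonneg
  refine ⟨C * volume.real (Metric.closedBall (0 : Space d) 2) + 2,
    by positivity, fun A F hF hFm hFA r hr ε hε => ?_⟩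
  set v : ℝ := volume.real (Metric.closedBall (0 : Space d) R)
  have hv : 0 ≤ v := measureReal_nonneg
  set u := forceL2 F hF with hu
  -- The tolerance absorbs the volume v of the velocity ball, the factor 1 + K₂² for the remainder
  -- and its average, and the 2 from squaring a sum; v + 1 avoids dividing by zero.
  obtain ⟨K, hK, hKε⟩ := exists_bandLimited_approx u
    (ε := ENNReal.ofReal (ε / (2 * (1 + K₂ ^ 2) * (v + 1)))) (by
      rw [ne_eq, ENNReal.ofReal_eq_zero, not_le]; positivity)
  set û : Lp (CSpace d) 2 (volume : Measure (Space d)) := 𝓕 u with hû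
  set a₀ : Space d → CSpace d := (Metric.closedBall 0 K).indicator û with ha₀
  have hûm : Measurable û := (Lp.stronglyMeasurable û).measurable
  have hsupp : ∀ ξ, K < ‖ξ‖ → a₀ ξ = 0 := fun ξ hξ =>
    Set.indicator_of_notMem (by simpa using hξ) _
  have hb₀ : BandLimited a₀ := ⟨hûm.indicator measurableSet_closedBall,
    (Lp.memLp û).indicator measurableSet_closedBall, K, hsupp⟩
  set c : Space d → ℂ := averageSymbol ψ r with hc
  have hcc : Continuous c := continuous_averageSymbol hψ r
  have hb : BandLimited fun ξ => (1 - c ξ) • a₀ ξ := by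
    refine ⟨(measurable_const.sub hcc.measurable).smul hb₀.measurable, ?_, K, fun ξ hξ => by
      rw [hsupp ξ hξ, smul_zero]⟩
    refine hb₀.memLp.of_le_mul (c := 2)
      ((measurable_const.sub hcc.measurable).smul hb₀.measurable).aestronglyMeasurable
      (Eventually.of_forall fun ξ => ?_)
    rw [norm_smul]
    gcongr
    exact norm_one_sub_averageSymbol_le_two hψ r ξ
  -- the band limited approximation and the averages
  set G : Space d → CSpace d := mode a₀ (fun _ => 1) with hG
  have hone : ∀ ξ : Space d, ‖(1 : ℂ)‖ ≤ 1 * (1 + ‖ξ‖) ^ 0 := fun ξ => by simp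
  have hGc : Continuous G := (hb₀.continuous_mode (b := fun _ _ => 1) continuous_const
    fun ξ _ => hone ξ).comp (by fun_prop : Continuous fun x : Space d => (x, (0 : Space d)))
  set g : Space d → CSpace d := fun x => toCSpace (F x) with hg
  have hgm : Measurable g := continuous_toCSpace.measurable.comp hFm
  have hgA : ∀ x, ‖g x‖ ≤ A := fun x => (norm_toCSpace (F x)).le.trans (hFA x)
  obtain ⟨B, hGB⟩ : ∃ B, ∀ x, ‖G x‖ ≤ B := ⟨∫ ξ, ‖a₀ ξ‖, fun x => by
    refine norm_integral_le_of_norm_le hb₀.integrable.norm (Eventually.of_forall fun ξ => ?_)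
    rw [norm_smul, one_mul, norm_planeWave, one_mul]⟩
  set h : Space d → CSpace d := fun x => g x - G x with hh
  have hhm : Measurable h := hgm.sub hGc.measurable
  have hhB : ∀ x, ‖h x‖ ≤ A + B := fun x => (norm_sub_le _ _).trans (add_le_add (hgA x) (hGB x))
  set Sh : Space d → CSpace d := fun x => ∫ y, ψ y • h (x - r • y) with hSh
  have hShm : Measurable Sh := by
    have hψm := hψ.continuous.measurable
    have : Measurable fun q : Space d × Space d => ψ q.2 • h (q.1 - r • q.2) := by fun_prop
    exact this.stronglyMeasurable.integral_prod_right.measurable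
  have hloc : ∀ x, ‖Sh x‖ ≤ localAverage C r h x := fun x => by
    have := norm_integral_kernel_smul_le hψ hr (x := x) (h := h) (w := 0) ?_ (by simpa using hr.le)
    · simpa using this
    · refine Measure.integrableOn_of_bounded measure_closedBall_lt_top.ne ?_
        (Eventually.of_forall fun u => hhB _)
      exact (by fun_prop : Measurable fun u => h (x + r • u)).aestronglyMeasurable
  -- Write g for the force, G for its band-limited approximation, h = g - G, and a star for
  -- averaging at scale r. The splitting is g = ψ*g + (G - ψ*G) + (h - ψ*h). Averaging g rather than
  -- G keeps the Lipschitz constant dependent on the sup norm of F alone.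
  refine ⟨fun ξ => (1 - c ξ) • a₀ ξ, fun x => ∫ y, ψ y • g (x - r • y), fun x => h x - Sh x, hb,
    fun ξ => ?_, fun x y => hψ.norm_integral_smul_sub_le hgm hgA hr x y, hhm.sub hShm,
    ⟨(A + B) + (A + B), fun x => (norm_sub_le _ _).trans
      (add_le_add (hhB x) (hψ.norm_integral_smul_le hhB r x))⟩, ?_, fun x => ?_⟩
  · rw [norm_smul]
    gcongr
    exact norm_indicator_le_norm_self _ _
  · have hL2 : ∫⁻ x, ‖h x‖ₑ ^ 2 ≤ ENNReal.ofReal (ε / (2 * (1 + K₂ ^ 2) * (v + 1))) := by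
      refine le_of_eq_of_le ?_ hKε
      have hae : ∀ᵐ x, u x = g x := (memLp_toCSpace hF).coeFn_toLp
      refine lintegral_congr_ae (hae.mono fun x hx => ?_)
      beta_reduce
      simp only [hx, hh, hG, mode_eq_fourierInv, one_smul]
    have hp2 : ∫⁻ z, ‖h z.1‖ₑ ^ 2 ∂(phaseMeasure d R) = ENNReal.ofReal v * ∫⁻ x, ‖h x‖ₑ ^ 2 :=
      lintegral_phaseMeasure_fst R (hhm.enorm.pow_const 2)
    have hloc2 : ∫⁻ z, ‖localAverage C r h z.1‖ₑ ^ 2 ∂(phaseMeasure d R) ≤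
        ENNReal.ofReal (K₂ ^ 2) * ∫⁻ z, ‖h z.1‖ₑ ^ 2 ∂(phaseMeasure d R) := by
      rw [lintegral_enorm_sq_eq_eLpNorm_sq (fun z : Space d × Space d => localAverage C r h z.1),
        lintegral_enorm_sq_eq_eLpNorm_sq (fun z : Space d × Space d => h z.1),
        ENNReal.ofReal_pow hK₂, ← mul_pow]
      gcongr
      exact h₂ R r (fun _ => h) (hhm.comp measurable_fst)
    have hpt : ∀ z : Space d × Space d, ‖h z.1 - Sh z.1‖ₑ ^ 2 ≤
        ENNReal.ofReal 2 * ‖h z.1‖ₑ ^ 2 + ENNReal.ofReal 2 * ‖localAverage C r h z.1‖ₑ ^ 2 := by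
      intro z
      rw [Real.enorm_of_nonneg (localAverage_nonneg hC r h z.1), ← ofReal_norm, ← ofReal_norm,
        ← ENNReal.ofReal_pow (norm_nonneg _), ← ENNReal.ofReal_pow (norm_nonneg _),
        ← ENNReal.ofReal_pow (localAverage_nonneg hC r h z.1), ← ENNReal.ofReal_mul zero_le_two,
        ← ENNReal.ofReal_mul zero_le_two, ← ENNReal.ofReal_add (by positivity) (by positivity)]
      refine ENNReal.ofReal_le_ofReal ?_
      have h1 := norm_sub_le (h z.1) (Sh z.1)
      have h2 := hloc z.1
      have h3 := norm_nonneg (h z.1)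
      have h4 : ‖h z.1 - Sh z.1‖ ≤ ‖h z.1‖ + localAverage C r h z.1 := by linarith
      calc _ ≤ (‖h z.1‖ + localAverage C r h z.1) ^ 2 := by gcongr
        _ ≤ _ := by nlinarith [sq_nonneg (‖h z.1‖ - localAverage C r h z.1)]
    refine (lintegral_mono hpt).trans ?_
    have hm1 : Measurable fun z : Space d × Space d => ENNReal.ofReal 2 * ‖h z.1‖ₑ ^ 2 :=
      ((hhm.comp measurable_fst).enorm.pow_const 2).const_mul _
    rw [lintegral_add_left hm1, lintegral_const_mul' _ _ ENNReal.ofReal_ne_top,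
      lintegral_const_mul' _ _ ENNReal.ofReal_ne_top]
    calc _ ≤ ENNReal.ofReal 2 * (ENNReal.ofReal v * ENNReal.ofReal (ε / (2 * (1 + K₂ ^ 2) * (v + 1))))
          + ENNReal.ofReal 2 * (ENNReal.ofReal (K₂ ^ 2) *
            (ENNReal.ofReal v * ENNReal.ofReal (ε / (2 * (1 + K₂ ^ 2) * (v + 1))))) := by
          refine add_le_add ?_ ?_
          · rw [hp2]; gcongr
          · refine mul_le_mul_right ?_ _
            refine hloc2.trans ?_
            rw [hp2]; gcongr
      _ = ENNReal.ofReal (ε * (v / (v + 1))) := by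
          rw [← ENNReal.ofReal_mul (by positivity), ← ENNReal.ofReal_mul (by positivity),
            ← ENNReal.ofReal_mul (by positivity), ← ENNReal.ofReal_mul (by positivity),
            ← ENNReal.ofReal_add (by positivity) (by positivity)]
          congr 1
          field_simp
      _ ≤ ENNReal.ofReal ε := by
          refine ENNReal.ofReal_le_ofReal (mul_le_of_le_one_right hε.le ?_)
          rw [div_le_one (by positivity)]; linarith
  · have e1 : (∫ y, ψ y • g (x - r • y)) - Sh x = ∫ y, ψ y • G (x - r • y) := by
      rw [hSh]
      beta_reduce
      rw [← integral_sub (hψ.integrable_smul hgm hgA r x) (hψ.integrable_smul hhm hhB r x)]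
      refine integral_congr_ae (Eventually.of_forall fun y => ?_)
      simp only [hh, smul_sub, sub_sub_cancel]
    rw [hG, ← hb₀.mode_averageSymbol hψ measurable_const hone] at e1
    have e2 : mode (fun ξ => (1 - c ξ) • a₀ ξ) (fun _ => 1) x =
        G x - mode a₀ (fun ξ => averageSymbol ψ r ξ * 1) x := by
      rw [hG, mode, mode, mode, ← integral_sub]
      · refine integral_congr_ae (Eventually.of_forall fun ξ => ?_)
        simp only [one_mul, mul_one, hc, smul_smul, ← sub_smul]
        congr 1; ring
      · exact hb₀.integrable_mode measurable_const hone x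
      · refine hb₀.integrable_mode (M := 1) (n := 0) (hcc.measurable.mul_const _) (fun ξ => ?_) x
        simpa using norm_averageSymbol_le hψ r ξ
    rw [e2, ← e1]
    simp only [hh]
    abel

/-- Frequencies below a fixed threshold contribute little if the averages are taken at a small
scale. -/
theorem exists_scale_frequencyEnergy_le (hψ : AveragingKernel ψ C) {f : Space d → ℝ}
    (hf1 : ∀ k, 1 ≤ f k) (hf : Tendsto f (cocompact (Space d)) atTop) {η : ℝ} (hη : 0 < η) :
    ∃ r : ℝ, 0 < r ∧ ∀ a w : Space d → CSpace d,
      (∀ ξ, ‖a ξ‖ ≤ ‖1 - averageSymbol ψ r ξ‖ * ‖w ξ‖) →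
      frequencyEnergy a ≤ ENNReal.ofReal η * ∫⁻ ξ, ENNReal.ofReal
        (‖ξ‖ ^ (3 / 2 : ℝ) * ‖w ξ‖ ^ 2 * f ((2 * Real.pi) • ξ)) := by
  -- The threshold 4/η matches |1 - ψ̂|² ≤ 4, valid at every frequency. On the remaining bounded set
  -- of frequencies r is taken so small that |1 - ψ̂|² ≤ η, and there f ≥ 1 suffices.
  have hev := hf.eventually_ge_atTop (4 / η)
  obtain ⟨t, ht, hts⟩ := mem_cocompact.1 hev
  obtain ⟨ρ, hρ⟩ := ht.isBounded.subset_closedBall 0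
  have hρ' : ∀ k : Space d, |ρ| < ‖k‖ → 4 / η ≤ f k := fun k hk => hts fun hkt => by
    have := hρ hkt
    rw [mem_closedBall_zero_iff] at this
    linarith [le_abs_self ρ]
  have hpi := Real.pi_pos
  set r := √η / (|ρ| + 1) with hr
  have hr0 : 0 < r := by positivity
  have hsym : ∀ ξ, ‖1 - averageSymbol ψ r ξ‖ ^ 2 ≤ η * f ((2 * Real.pi) • ξ) := by
    intro ξ
    have hk : ‖(2 * Real.pi) • ξ‖ = 2 * Real.pi * ‖ξ‖ := by
      rw [norm_smul, Real.norm_of_nonneg (by positivity)]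
    rcases lt_or_ge |ρ| ‖(2 * Real.pi) • ξ‖ with h | h
    · have h1 := norm_one_sub_averageSymbol_le_two hψ r ξ
      have h2 := hρ' _ h
      rw [div_le_iff₀ hη] at h2
      calc ‖1 - averageSymbol ψ r ξ‖ ^ 2 ≤ 2 ^ 2 := by gcongr
        _ ≤ _ := by linarith
    · have h1 : ‖1 - averageSymbol ψ r ξ‖ ≤ √η := by
        refine (norm_one_sub_averageSymbol_le hψ hr0.le ξ).trans ?_
        rw [hk] at h
        calc 2 * Real.pi * r * ‖ξ‖ = r * (2 * Real.pi * ‖ξ‖) := by ring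
          _ ≤ r * (|ρ| + 1) := by gcongr; linarith
          _ = √η := by rw [hr]; field_simp
      calc ‖1 - averageSymbol ψ r ξ‖ ^ 2 ≤ √η ^ 2 := by gcongr
        _ = η * 1 := by rw [Real.sq_sqrt hη.le, mul_one]
        _ ≤ _ := by gcongr; exact hf1 _
  refine ⟨r, hr0, fun a w h => ?_⟩
  rw [frequencyEnergy, ← lintegral_const_mul' _ _ ENNReal.ofReal_ne_top]
  refine lintegral_mono fun ξ => ?_
  rw [← ENNReal.ofReal_mul hη.le]
  refine ENNReal.ofReal_le_ofReal ?_
  calc ‖ξ‖ ^ (3 / 2 : ℝ) * ‖a ξ‖ ^ 2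
      ≤ ‖ξ‖ ^ (3 / 2 : ℝ) * (‖1 - averageSymbol ψ r ξ‖ * ‖w ξ‖) ^ 2 := by gcongr; exact h ξ
    _ = ‖ξ‖ ^ (3 / 2 : ℝ) * ‖w ξ‖ ^ 2 * ‖1 - averageSymbol ψ r ξ‖ ^ 2 := by ring
    _ ≤ ‖ξ‖ ^ (3 / 2 : ℝ) * ‖w ξ‖ ^ 2 * (η * f ((2 * Real.pi) • ξ)) := by gcongr; exact hsym ξ
    _ = _ := by ring

end ForceDecomposition

/-! ### The oscillating part of the force along two trajectories -/

section Trajectories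

variable {d : ℕ} {ψ : Space d → ℝ} {C A T t : ℝ} {a : Space d → CSpace d}
  {X V X' V' Φ Φ' : ℝ → Space d}

/-- The squared size of `g` along a path, at both ends and on average. -/
noncomputable def pathEnergy (T : ℝ) (g : Space d × Space d → ℝ) (X V : ℝ → Space d) (t : ℝ) : ℝ :=
  g (X t, V t) ^ 2 + g (X 0, V 0) ^ 2 + ∫ s in (0 : ℝ)..T, g (X s, V s) ^ 2

theorem pathEnergy_nonneg (hT : 0 ≤ T) (g : Space d × Space d → ℝ) (X V : ℝ → Space d) (t : ℝ) :
    0 ≤ pathEnergy T g X V t := by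
  have := intervalIntegral.integral_nonneg (μ := volume) hT fun s _ => sq_nonneg (g (X s, V s))
  unfold pathEnergy
  positivity

/-- The frequencies are split at scale r comparable to the separation W. The averaged part is
compared along the two paths and gains W from W ≥ |X' - X|; the rest is estimated on each trajectory
with its own velocity and gains W from r/2 ≤ W. The result is W² times energies of the single
function `scaleBound`. -/
theorem BandLimited.norm_integral_mode_sub_sq_le (ha : BandLimited a) (hψ : AveragingKernel ψ C)
    {r W : ℝ} (hr : 0 < r) (hWr : W ≤ r) (hrW : r ≤ 2 * W)
    (hV : BoundedAcceleration A V Φ) (hX : ∀ s, HasDerivAt X (V s) s)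
    (hV' : BoundedAcceleration A V' Φ') (hX' : ∀ s, HasDerivAt X' (V' s) s)
    (ht : t ∈ Set.Icc 0 T) (hW : ∀ s ∈ Set.Icc 0 t, ‖X' s - X s‖ ≤ W)
    (hη : ∫ s in (0 : ℝ)..t, ‖V' s - V s‖ ^ 2 ≤ W ^ 2) :
    ‖(∫ s in (0 : ℝ)..t, mode a (fun _ => 1) (X' s)) -
        ∫ s in (0 : ℝ)..t, mode a (fun _ => 1) (X s)‖ ^ 2 ≤
      W ^ 2 * (7 * (1 + (1 + A) ^ 2 * T) * (pathEnergy T (scaleBound ψ C r a) X V t +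
        pathEnergy T (scaleBound ψ C r a) X' V' t)) := by
  have hC := hψ.const_nonneg
  have hA : 0 ≤ A := (norm_nonneg _).trans (hV.norm_le 0)
  have hXc : Continuous X := continuous_iff_continuousAt.2 fun s => (hX s).continuousAt
  have hXc' : Continuous X' := continuous_iff_continuousAt.2 fun s => (hX' s).continuousAt
  have hVc := hV.continuous
  have hVc' := hV'.continuous
  have hT : 0 ≤ T := ht.1.trans ht.2
  have hW0 : 0 ≤ W := by linarith
  set c := averageSymbol ψ r with hcdef
  have hc : Continuous c := continuous_averageSymbol hψ r
  have hc1 := norm_averageSymbol_le hψ r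
  have hc2 := norm_one_sub_averageSymbol_le_two hψ r
  have hc' : Continuous fun ξ => 1 - c ξ := continuous_const.sub hc
  set h := highBound (fun ξ => 1 - averageSymbol ψ r ξ) a with hh
  set l := lowBound C r a with hl
  set g := scaleBound ψ C r a with hg
  have hhc : Continuous h := ha.continuous_highBound hc' hc2
  have hlc : Continuous l := ha.continuous_lowBound C r
  have hgc : Continuous g := ha.continuous_scaleBound hψ r
  have hh0 : ∀ z, 0 ≤ h z := highBound_nonneg _ a
  have hl0 : ∀ z, 0 ≤ l z := lowBound_nonneg hC r a
  have hg0 : ∀ z, 0 ≤ g z := scaleBound_nonneg hC hr a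
  have hlg : ∀ z, l z ≤ g z := fun z => le_add_of_nonneg_right (mul_nonneg (by positivity) (hh0 z))
  have hhW : ∀ z, h z ≤ W * g z := fun z => by
    have e : h z = r / 2 * (2 / r * h z) := by field_simp
    calc h z = r / 2 * (2 / r * h z) := e
      _ ≤ W * (2 / r * h z) := by
          have := hh0 z
          gcongr; linarith
      _ ≤ W * g z := by
          gcongr
          exact le_add_of_nonneg_left (hl0 z)
  have hlhW : ∀ z, W * l z + h z ≤ W * g z := fun z => by
    have e : h z = r / 2 * (2 / r * h z) := by field_simp
    have : h z ≤ W * (2 / r * h z) := by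
      rw [e]
      have h1 := hh0 z
      have : 0 ≤ 2 / r * (r / 2 * (2 / r * h z)) := by positivity
      calc r / 2 * (2 / r * h z) = r / 2 * (2 / r * (r / 2 * (2 / r * h z))) := by field_simp
        _ ≤ _ := by gcongr; linarith
    calc _ ≤ W * l z + W * (2 / r * h z) := by linarith
      _ = W * g z := by rw [hg, scaleBound]; ring
  -- splitting the frequencies
  have hmode : ∀ x, mode a (fun _ => 1) x = mode a c x + mode a (fun ξ => 1 - c ξ) x := fun x => by
    rw [mode, mode, mode, ← integral_add]
    · refine integral_congr_ae (Eventually.of_forall fun ξ => ?_)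
      beta_reduce
      rw [← add_smul]; congr 1; ring
    · exact ha.integrable_mode (M := 1) (n := 0) hc.measurable (by simpa using hc1) x
    · exact ha.integrable_mode (M := 2) (n := 0) hc'.measurable
        (by simpa using hc2) x
  have cmode : ∀ {b : Space d → ℂ} {M : ℝ}, Continuous b → (∀ ξ, ‖b ξ‖ ≤ M) →
      Continuous (mode a b) := fun {b M} hb hM =>
    (ha.continuous_mode (b := fun ξ _ => b ξ) (M := M) (n := 0) (by fun_prop)
      fun ξ _ => by simpa using hM ξ).comp
      (by fun_prop : Continuous fun x : Space d => (x, (0 : Space d)))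
  have c1 := cmode hc hc1
  have c2 := cmode hc' hc2
  have split : ∀ {Y : ℝ → Space d}, Continuous Y → ∫ s in (0 : ℝ)..t, mode a (fun _ => 1) (Y s) =
      (∫ s in (0 : ℝ)..t, mode a c (Y s)) + ∫ s in (0 : ℝ)..t, mode a (fun ξ => 1 - c ξ) (Y s) :=
    fun {Y} hY => by
      simp_rw [hmode]
      exact intervalIntegral.integral_add ((c1.comp hY).intervalIntegrable _ _)
        ((c2.comp hY).intervalIntegrable _ _)
  -- The second position is run against the first velocity, with drift V' - V.
  have b1 := ha.norm_integral_mode_sub_le hψ hr hWr hV hX (η := fun s => V' s - V s)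
    (hVc'.sub hVc) (Y := X') (by simpa using hX') ht.1 hW
  have b2 := ha.norm_integral_mode_le hc' hc2 hV hX ht.1
  have b3 := ha.norm_integral_mode_le hc' hc2 hV' hX' ht.1
  -- comparison with the scale bound
  have gX : Continuous fun s => g (X s, V s) := hgc.comp (hXc.prodMk hVc)
  have gX' : Continuous fun s => g (X' s, V' s) := hgc.comp (hXc'.prodMk hVc')
  have lX : Continuous fun s => l (X s, V s) := hlc.comp (hXc.prodMk hVc)
  have hX2 : Continuous fun s => h (X s, V s) := hhc.comp (hXc.prodMk hVc)
  have hX2' : Continuous fun s => h (X' s, V' s) := hhc.comp (hXc'.prodMk hVc')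
  have i1 : W * (∫ s in (0 : ℝ)..t, l (X s, V s)) + ∫ s in (0 : ℝ)..t, h (X s, V s) ≤
      W * ∫ s in (0 : ℝ)..t, g (X s, V s) := by
    have iL : IntervalIntegrable (fun s => W * l (X s, V s)) volume 0 t :=
      (continuous_const.mul lX).intervalIntegrable _ _
    rw [← intervalIntegral.integral_const_mul, ← intervalIntegral.integral_const_mul,
      ← intervalIntegral.integral_add iL
        (hX2.intervalIntegrable _ _)]
    exact intervalIntegral.integral_mono ht.1
      (((continuous_const.mul lX).add hX2).intervalIntegrable _ _)
      ((continuous_const.mul gX).intervalIntegrable _ _) fun s => hlhW _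
  have i2 : ∫ s in (0 : ℝ)..t, h (X' s, V' s) ≤ W * ∫ s in (0 : ℝ)..t, g (X' s, V' s) := by
    rw [← intervalIntegral.integral_const_mul]
    exact intervalIntegral.integral_mono ht.1 (hX2'.intervalIntegrable _ _)
      ((continuous_const.mul gX').intervalIntegrable _ _) fun s => hhW _
  set J := ∫ s in (0 : ℝ)..t, g (X s, V s) with hJ
  set J' := ∫ s in (0 : ℝ)..t, g (X' s, V' s) with hJ'
  set P := ∫ s in (0 : ℝ)..T, g (X s, V s) ^ 2 with hP
  set P' := ∫ s in (0 : ℝ)..T, g (X' s, V' s) ^ 2 with hP'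
  have mono : ∀ {u : ℝ → ℝ}, Continuous u → ∫ s in (0 : ℝ)..t, u s ^ 2 ≤
      ∫ s in (0 : ℝ)..T, u s ^ 2 := fun {u} hu =>
    intervalIntegral.integral_mono_interval le_rfl ht.1 ht.2
      (Eventually.of_forall fun s => sq_nonneg (u s)) ((hu.pow 2).intervalIntegrable _ _)
  have sqJ : ∀ {u : ℝ → ℝ}, Continuous u → (∫ s in (0 : ℝ)..t, u s) ^ 2 ≤
      T * ∫ s in (0 : ℝ)..T, u s ^ 2 := fun {u} hu =>
    (sq_intervalIntegral_le ht.1 (hu.intervalIntegrable _ _) ((hu.pow 2).intervalIntegrable _ _)).trans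
      (mul_le_mul ht.2 (mono hu)
        (intervalIntegral.integral_nonneg ht.1 fun s _ => sq_nonneg _) hT)
  have j1 : J ^ 2 ≤ T * P := sqJ gX
  have j2 : J' ^ 2 ≤ T * P' := sqJ gX'
  have hP0 : 0 ≤ P := intervalIntegral.integral_nonneg hT fun s _ => sq_nonneg _
  have hP0' : 0 ≤ P' := intervalIntegral.integral_nonneg hT fun s _ => sq_nonneg _
  -- The drift term gains its factor W from the L² bound on V' - V, not from the distance of
  -- positions; this is why the velocity difference belongs to the quantity W has to dominate.
  have j3 : ∫ s in (0 : ℝ)..t, ‖V' s - V s‖ * l (X s, V s) ≤ W * √P := by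
    have ηc : Continuous fun s => ‖V' s - V s‖ := (hVc'.sub hVc).norm
    have h1 : (∫ s in (0 : ℝ)..t, ‖V' s - V s‖ * l (X s, V s)) ^ 2 ≤ W ^ 2 * P := by
      refine (sq_intervalIntegral_mul_le ht.1 ((ηc.pow 2).intervalIntegrable _ _)
        ((ηc.mul lX).intervalIntegrable _ _) ((lX.pow 2).intervalIntegrable _ _)).trans ?_
      refine mul_le_mul hη ?_ (intervalIntegral.integral_nonneg ht.1 fun s _ => sq_nonneg _)
        (sq_nonneg _)
      refine (mono lX).trans (intervalIntegral.integral_mono hT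
        ((lX.pow 2).intervalIntegrable _ _) ((gX.pow 2).intervalIntegrable _ _) fun s => ?_)
      exact pow_le_pow_left₀ (hl0 _) (hlg _) 2
    refine le_of_sq_le_sq ?_ (by positivity)
    rw [mul_pow, Real.sq_sqrt hP0]; exact h1
  have total : ‖(∫ s in (0 : ℝ)..t, mode a (fun _ => 1) (X' s)) -
      ∫ s in (0 : ℝ)..t, mode a (fun _ => 1) (X s)‖ ≤ W * (g (X t, V t) + g (X 0, V 0) +
        g (X' t, V' t) + g (X' 0, V' 0) + (1 + A) * J + (1 + A) * J' + √P) := by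
    rw [split hXc, split hXc', add_sub_add_comm]
    refine (norm_add_le _ _).trans ((add_le_add b1 (norm_sub_le _ _)).trans ?_)
    refine (add_le_add_right (add_le_add b3 b2) _).trans ?_
    have k1 := hlhW (X t, V t)
    have k2 := hlhW (X 0, V 0)
    have k3 := hhW (X' t, V' t)
    have k4 := hhW (X' 0, V' 0)
    have k5 : (1 + A) * (W * (∫ s in (0 : ℝ)..t, l (X s, V s)) + ∫ s in (0 : ℝ)..t, h (X s, V s)) ≤
      (1 + A) * (W * J) := by gcongr
    have k6 : (1 + A) * (∫ s in (0 : ℝ)..t, h (X' s, V' s)) ≤ (1 + A) * (W * J') := by gcongr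
    linarith
  have hsum0 : 0 ≤ W * (g (X t, V t) + g (X 0, V 0) + g (X' t, V' t) + g (X' 0, V' 0) +
      (1 + A) * J + (1 + A) * J' + √P) := (norm_nonneg _).trans total
  have seven : ∀ x₁ x₂ x₃ x₄ x₅ x₆ x₇ : ℝ, (x₁ + x₂ + x₃ + x₄ + x₅ + x₆ + x₇) ^ 2 ≤
      7 * (x₁ ^ 2 + x₂ ^ 2 + x₃ ^ 2 + x₄ ^ 2 + x₅ ^ 2 + x₆ ^ 2 + x₇ ^ 2) := by
    intro x₁ x₂ x₃ x₄ x₅ x₆ x₇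
    have := sq_sum_le_card_mul_sum_sq (s := Finset.univ)
      (f := ![x₁, x₂, x₃, x₄, x₅, x₆, x₇])
    simpa [Fin.sum_univ_succ, add_assoc] using this
  calc _ ≤ (W * (g (X t, V t) + g (X 0, V 0) + g (X' t, V' t) + g (X' 0, V' 0) +
      (1 + A) * J + (1 + A) * J' + √P)) ^ 2 := by gcongr
    _ ≤ W ^ 2 * (7 * (g (X t, V t) ^ 2 + g (X 0, V 0) ^ 2 + g (X' t, V' t) ^ 2 +
      g (X' 0, V' 0) ^ 2 + ((1 + A) * J) ^ 2 + ((1 + A) * J') ^ 2 + √P ^ 2)) := by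
        rw [mul_pow]; gcongr; exact seven _ _ _ _ _ _ _
    _ ≤ _ := by
        refine mul_le_mul_of_nonneg_left ?_ (sq_nonneg W)
        rw [mul_assoc]
        refine mul_le_mul_of_nonneg_left ?_ (by norm_num)
        rw [Real.sq_sqrt hP0, mul_pow, mul_pow]
        have k1 : (1 + A) ^ 2 * J ^ 2 ≤ (1 + A) ^ 2 * (T * P) := by gcongr
        have k2 : (1 + A) ^ 2 * J' ^ 2 ≤ (1 + A) ^ 2 * (T * P') := by gcongr
        have hk : 0 ≤ (1 + A) ^ 2 * T := by positivity
        have k3 : 0 ≤ (1 + A) ^ 2 * T * (g (X t, V t) ^ 2 + g (X 0, V 0) ^ 2 + g (X' t, V' t) ^ 2 +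
          g (X' 0, V' 0) ^ 2) := by positivity
        simp only [pathEnergy, ← hP, ← hP']
        linarith

end Trajectories

/-! ### Grönwall's inequality for the logarithm of the separation -/

section Gronwall

variable {d : ℕ} {δ T : ℝ} {w η : ℝ → Space d}

/-- A continuously differentiable majorant of `‖w‖² + ∫ ‖η‖²` along a path with velocity `η`. -/
noncomputable def pathMajorant (δ : ℝ) (w η : ℝ → Space d) (t : ℝ) : ℝ :=
  2 * δ ^ 2 + 2 * (∫ s in (0 : ℝ)..t, ‖w s‖ * ‖η s‖) + ∫ s in (0 : ℝ)..t, ‖η s‖ ^ 2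

theorem hasDerivAt_pathMajorant (hw : Continuous w) (hη : Continuous η) (δ t : ℝ) :
    HasDerivAt (pathMajorant δ w η) (2 * (‖w t‖ * ‖η t‖) + ‖η t‖ ^ 2) t := by
  have h1 := ((hw.norm.mul hη.norm).integral_hasStrictDerivAt 0 t).hasDerivAt
  have h2 := ((hη.norm.pow 2).integral_hasStrictDerivAt 0 t).hasDerivAt
  exact ((h1.const_mul 2).const_add (2 * δ ^ 2)).add h2

/-- Integrating d|w|²/ds = 2⟨w, η⟩ ≤ 2|w||η|. Unlike |w|² the majorant is nondecreasing, so its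
value at t bounds every earlier separation. Of the initial 2δ², one δ² pays for |w(0)|² and the
other is kept as slack. -/
theorem le_pathMajorant (hw : ∀ s, HasDerivAt w (η s) s) (hη : Continuous η) (h0 : ‖w 0‖ ≤ δ)
    {s t : ℝ} (hs : s ∈ Set.Icc 0 t) :
    ‖w s‖ ^ 2 + δ ^ 2 + ∫ s in (0 : ℝ)..t, ‖η s‖ ^ 2 ≤ pathMajorant δ w η t := by
  have hwc : Continuous w := continuous_iff_continuousAt.2 fun s => (hw s).continuousAt
  have h1 : ∫ u in (0 : ℝ)..s, 2 * inner ℝ (w u) (η u) = ‖w s‖ ^ 2 - ‖w 0‖ ^ 2 :=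
    intervalIntegral.integral_eq_sub_of_hasDerivAt (fun u _ => (hw u).norm_sq)
      ((continuous_const.mul (hwc.inner hη)).intervalIntegrable _ _)
  have h2 : ∫ u in (0 : ℝ)..s, 2 * inner ℝ (w u) (η u) ≤
      ∫ u in (0 : ℝ)..s, 2 * (‖w u‖ * ‖η u‖) :=
    intervalIntegral.integral_mono hs.1
      ((continuous_const.mul (hwc.inner hη)).intervalIntegrable _ _)
      ((continuous_const.mul (hwc.norm.mul hη.norm)).intervalIntegrable _ _) fun u => by
        have := real_inner_le_norm (w u) (η u)
        dsimp only; gcongr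
  have h3 : ∫ u in (0 : ℝ)..s, 2 * (‖w u‖ * ‖η u‖) ≤ ∫ u in (0 : ℝ)..t, 2 * (‖w u‖ * ‖η u‖) :=
    intervalIntegral.integral_mono_interval le_rfl hs.1 hs.2
      (Eventually.of_forall fun u => by simp only [Pi.zero_apply]; positivity)
      ((continuous_const.mul (hwc.norm.mul hη.norm)).intervalIntegrable _ _)
  rw [intervalIntegral.integral_const_mul 2 fun u => ‖w u‖ * ‖η u‖,
    intervalIntegral.integral_const_mul 2 fun u => ‖w u‖ * ‖η u‖] at h3
  rw [intervalIntegral.integral_const_mul 2 fun u => ‖w u‖ * ‖η u‖] at h2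
  have h4 : ‖w 0‖ ^ 2 ≤ δ ^ 2 := by gcongr
  unfold pathMajorant
  linarith

theorem sq_le_pathMajorant (hw : ∀ s, HasDerivAt w (η s) s) (hη : Continuous η) (h0 : ‖w 0‖ ≤ δ)
    {t : ℝ} (ht : 0 ≤ t) : δ ^ 2 ≤ pathMajorant δ w η t := by
  have h1 := le_pathMajorant hw hη h0 (s := 0) ⟨le_rfl, ht⟩
  have h2 := intervalIntegral.integral_nonneg (μ := volume) ht fun s _ => sq_nonneg ‖η s‖
  linarith [sq_nonneg ‖w 0‖]

theorem log_pathMajorant_le (hw : ∀ s, HasDerivAt w (η s) s) (hη : Continuous η) (hδ : 0 < δ)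
    (h0 : ‖w 0‖ ≤ δ) (hT : 0 ≤ T) {P : ℝ → ℝ} (hP : Continuous P)
    (h : ∀ t ∈ Set.Icc 0 T, ‖η t‖ ^ 2 ≤ pathMajorant δ w η t * P t) :
    Real.log (pathMajorant δ w η T / δ ^ 2) ≤ Real.log 2 + T + 2 * ∫ t in (0 : ℝ)..T, P t := by
  have hwc : Continuous w := continuous_iff_continuousAt.2 fun s => (hw s).continuousAt
  have hpos : ∀ t ∈ Set.Icc 0 T, 0 < pathMajorant δ w η t := fun t ht =>
    (by positivity : 0 < δ ^ 2).trans_le (sq_le_pathMajorant hw hη h0 ht.1)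
  have hcont : Continuous (pathMajorant δ w η) :=
    continuous_iff_continuousAt.2 fun t => (hasDerivAt_pathMajorant hwc hη δ t).continuousAt
  have hcd : ContinuousOn (fun t => (2 * (‖w t‖ * ‖η t‖) + ‖η t‖ ^ 2) / pathMajorant δ w η t)
      (Set.uIcc 0 T) := by
    rw [Set.uIcc_of_le hT]
    refine ContinuousOn.div (by fun_prop) hcont.continuousOn fun t ht => (hpos t ht).ne'
  have e : ∫ t in (0 : ℝ)..T, (2 * (‖w t‖ * ‖η t‖) + ‖η t‖ ^ 2) / pathMajorant δ w η t =
      Real.log (pathMajorant δ w η T) - Real.log (pathMajorant δ w η 0) := by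
    refine intervalIntegral.integral_eq_sub_of_hasDerivAt
      (f := fun t => Real.log (pathMajorant δ w η t)) (fun t ht => ?_) hcd.intervalIntegrable
    rw [Set.uIcc_of_le hT] at ht
    exact (hasDerivAt_pathMajorant hwc hη δ t).log (hpos t ht).ne'
  have i1 : IntervalIntegrable (fun t => 2 * P t) volume 0 T :=
    (continuous_const.mul hP).intervalIntegrable _ _
  have le : ∫ t in (0 : ℝ)..T, (2 * (‖w t‖ * ‖η t‖) + ‖η t‖ ^ 2) / pathMajorant δ w η t ≤
      ∫ t in (0 : ℝ)..T, (1 + 2 * P t) := by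
    refine intervalIntegral.integral_mono_on hT hcd.intervalIntegrable
      (intervalIntegrable_const.add i1) fun t ht => ?_
    rw [div_le_iff₀ (hpos t ht)]
    have h1 := le_pathMajorant hw hη h0 (s := t) (t := t) ⟨ht.1, le_rfl⟩
    have h2 := intervalIntegral.integral_nonneg (μ := volume) ht.1 fun s _ => sq_nonneg ‖η s‖
    have h3 := h t ht
    -- The derivative satisfies 2|w||η| + |η|² ≤ |w|² + 2|η|² ≤ G + 2GP, with G the majorant.
    nlinarith [sq_nonneg (‖w t‖ - ‖η t‖), sq_nonneg δ]
  rw [intervalIntegral.integral_add intervalIntegrable_const i1,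
    intervalIntegral.integral_const_mul, intervalIntegral.integral_const, sub_zero, smul_eq_mul,
    mul_one, e] at le
  -- The initial value 2δ² is the source of log 2.
  have h5 : pathMajorant δ w η 0 = 2 * δ ^ 2 := by simp [pathMajorant]
  rw [h5, Real.log_mul two_ne_zero (by positivity)] at le
  rw [Real.log_div (hpos T ⟨hT, le_rfl⟩).ne' (by positivity)]
  linarith

/-- A crude bound independent of δ, from bounded accelerations. It gives the trivial logarithmic
estimate and the largest separation to be covered by dyadic scales. -/
theorem pathMajorant_le (hw : ∀ s, HasDerivAt w (η s) s) (hη : Continuous η)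
    (h0 : ‖w 0‖ ≤ δ) (hδ1 : δ ≤ 1) {B : ℝ} (hB : ∀ t ∈ Set.Icc 0 T, ‖η t‖ ≤ B)
    {t : ℝ} (ht : t ∈ Set.Icc 0 T) :
    pathMajorant δ w η t ≤ 2 + 2 * T * ((1 + T * B) * B) + T * B ^ 2 := by
  have hwc : Continuous w := continuous_iff_continuousAt.2 fun s => (hw s).continuousAt
  have hT : 0 ≤ T := ht.1.trans ht.2
  have hB0 : 0 ≤ B := (norm_nonneg _).trans (hB t ht)
  have hwB : ∀ s ∈ Set.Icc 0 T, ‖w s‖ ≤ 1 + T * B := by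
    intro s hs
    have e : ∫ u in (0 : ℝ)..s, η u = w s - w 0 :=
      intervalIntegral.integral_eq_sub_of_hasDerivAt (fun u _ => hw u)
        (hη.intervalIntegrable _ _)
    have h1 : ‖w s - w 0‖ ≤ T * B := by
      rw [← e]
      refine (norm_integral_le_integral_of_le (g := fun _ => B) continuous_const hs.1
        fun u hu => hB u ⟨hu.1, hu.2.trans hs.2⟩).trans ?_
      rw [intervalIntegral.integral_const, sub_zero, smul_eq_mul]
      gcongr; exact hs.2
    have h2 := norm_sub_norm_le (w s) (w 0)
    linarith
  have i1 : ∫ s in (0 : ℝ)..t, ‖w s‖ * ‖η s‖ ≤ T * ((1 + T * B) * B) := by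
    calc _ ≤ ∫ s in (0 : ℝ)..t, (1 + T * B) * B := by
          refine intervalIntegral.integral_mono_on ht.1
            ((hwc.norm.mul hη.norm).intervalIntegrable _ _) intervalIntegrable_const fun s hs => ?_
          have hs' : s ∈ Set.Icc 0 T := ⟨hs.1, hs.2.trans ht.2⟩
          have := hwB s hs'
          have := hB s hs'
          gcongr
      _ ≤ _ := by
          rw [intervalIntegral.integral_const, sub_zero, smul_eq_mul]
          gcongr; exact ht.2
  have i2 : ∫ s in (0 : ℝ)..t, ‖η s‖ ^ 2 ≤ T * B ^ 2 := by
    calc _ ≤ ∫ s in (0 : ℝ)..t, B ^ 2 := by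
          refine intervalIntegral.integral_mono_on ht.1
            ((hη.norm.pow 2).intervalIntegrable _ _) intervalIntegrable_const fun s hs => ?_
          have := hB s ⟨hs.1, hs.2.trans ht.2⟩
          gcongr
      _ ≤ _ := by
          rw [intervalIntegral.integral_const, sub_zero, smul_eq_mul]
          gcongr; exact ht.2
  have hδ : δ ^ 2 ≤ 1 := pow_le_one₀ ((norm_nonneg _).trans h0) hδ1
  unfold pathMajorant
  linarith

/-- The slack δ² in `le_pathMajorant`, divided by δ², is the 1 inside the logarithm. -/
theorem log_one_add_le_log_pathMajorant (hw : ∀ s, HasDerivAt w (η s) s) (hη : Continuous η)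
    (hδ : 0 < δ) (h0 : ‖w 0‖ ≤ δ) (hT : 0 ≤ T) :
    Real.log (1 + 1 / δ ^ 2 * ((⨆ t : Set.Icc (0 : ℝ) T, ‖w t‖ ^ 2) +
      ∫ t in (0 : ℝ)..T, ‖η t‖ ^ 2)) ≤ Real.log (pathMajorant δ w η T / δ ^ 2) := by
  have : Nonempty (Set.Icc (0 : ℝ) T) := ⟨⟨0, le_rfl, hT⟩⟩
  have h1 : (⨆ t : Set.Icc (0 : ℝ) T, ‖w t‖ ^ 2) ≤
      pathMajorant δ w η T - δ ^ 2 - ∫ t in (0 : ℝ)..T, ‖η t‖ ^ 2 :=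
    ciSup_le fun t => by linarith [le_pathMajorant hw hη h0 t.2]
  have h2 : 0 ≤ (⨆ t : Set.Icc (0 : ℝ) T, ‖w t‖ ^ 2) := Real.iSup_nonneg fun t => sq_nonneg _
  have h3 := intervalIntegral.integral_nonneg (μ := volume) hT fun s _ => sq_nonneg ‖η s‖
  refine Real.log_le_log (by positivity) ?_
  rw [le_div_iff₀ (by positivity)]
  field_simp
  linarith

end Gronwall

/-! ### The logarithmic functional along one pair of trajectories -/

section Trajectories

variable {d : ℕ} {ψ : Space d → ℝ} {C A T δ : ℝ} {a S rem : Space d → CSpace d}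
  {F : Space d → Space d} {X V X' V' : ℝ → Space d}

/-- The inclusion of the real vectors as a linear isometry. -/
noncomputable def toCSpaceIsometry (d : ℕ) : Space d →ₗᵢ[ℝ] CSpace d where
  toFun := toCSpace
  map_add' x y := by ext i; simp [toCSpace]
  map_smul' c x := by ext i; simp [toCSpace]
  norm_map' := norm_toCSpace

/-- Choose n with 2ⁿ ≤ W/δ < 2ⁿ⁺¹; the scale is the upper end 2ⁿ⁺¹δ, so that it dominates W and
exceeds it at most by a factor 2. -/
theorem exists_dyadic_scale {D W : ℝ} (hδ : 0 < δ) (hW : δ ≤ W) {N : ℕ} (hWD : W ≤ D)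
    (hN : D < 2 ^ N * δ) : ∃ n ∈ Finset.range N, W ≤ 2 ^ (n + 1) * δ ∧ 2 ^ (n + 1) * δ ≤ 2 * W := by
  obtain ⟨n, h1, h2⟩ := exists_nat_pow_near ((one_le_div hδ).2 hW) one_lt_two
  rw [le_div_iff₀ hδ] at h1
  rw [div_lt_iff₀ hδ] at h2
  refine ⟨n, ?_, h2.le, by rw [pow_succ]; linarith⟩
  rw [Finset.mem_range]
  by_contra hn
  have : (2 : ℝ) ^ N ≤ 2 ^ n := pow_le_pow_right₀ one_le_two (not_lt.1 hn)
  nlinarith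

/-- The velocity difference is the initial one plus the time integrals of the three parts of the
force. The initial difference is at most δ ≤ W, the Lipschitz part gains W directly and the
oscillating part through the corrector. The remainder is not differenced: W² is inserted through 1 ≤
W²/δ², hence the weight δ⁻² on it. -/
theorem BandLimited.norm_velocity_sub_sq_le (ha : BandLimited a) (hψ : AveragingKernel ψ C)
    {Λ W B r : ℝ} (hΛ : ∀ x y, ‖S x - S y‖ ≤ Λ * ‖x - y‖) (hΛ0 : 0 ≤ Λ) (hrem : Measurable rem)
    (hB : ∀ x, ‖rem x‖ ≤ B)
    (hF : ∀ x, toCSpace (F x) = S x + mode a (fun _ => 1) x + rem x)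
    (hV : BoundedAcceleration A V fun s => F (X s)) (hX : ∀ s, HasDerivAt X (V s) s)
    (hV' : BoundedAcceleration A V' fun s => F (X' s)) (hX' : ∀ s, HasDerivAt X' (V' s) s)
    (hδ : 0 < δ) (hVδ : ‖V' 0 - V 0‖ ≤ δ) (hδW : δ ≤ W) (hWr : W ≤ r) (hrW : r ≤ 2 * W)
    {t : ℝ} (ht : t ∈ Set.Icc 0 T) (hW : ∀ s ∈ Set.Icc 0 t, ‖X' s - X s‖ ≤ W)
    (hη : ∫ s in (0 : ℝ)..t, ‖V' s - V s‖ ^ 2 ≤ W ^ 2) :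
    ‖V' t - V t‖ ^ 2 ≤ W ^ 2 * (4 * (1 + (Λ * T) ^ 2 +
      7 * (1 + (1 + A) ^ 2 * T) * (pathEnergy T (scaleBound ψ C r a) X V t +
        pathEnergy T (scaleBound ψ C r a) X' V' t) +
      2 * T / δ ^ 2 * ((∫ s in (0 : ℝ)..T, ‖rem (X s)‖ ^ 2) +
        ∫ s in (0 : ℝ)..T, ‖rem (X' s)‖ ^ 2))) := by
  have hXc : Continuous X := continuous_iff_continuousAt.2 fun s => (hX s).continuousAt
  have hXc' : Continuous X' := continuous_iff_continuousAt.2 fun s => (hX' s).continuousAt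
  have hT : 0 ≤ T := ht.1.trans ht.2
  have hW0 : 0 < W := hδ.trans_le hδW
  have hSc : Continuous S := by
    refine (LipschitzWith.of_dist_le_mul (K := ⟨Λ, hΛ0⟩) fun x y => ?_).continuous
    rw [dist_eq_norm, dist_eq_norm]; exact hΛ x y
  have hmc : Continuous (mode a fun _ => 1) :=
    (ha.continuous_mode (b := fun _ _ => 1) (M := 1) (n := 0) continuous_const
      fun ξ _ => by simp).comp (by fun_prop : Continuous fun x : Space d => (x, (0 : Space d)))
  have irem : ∀ {Y : ℝ → Space d}, Continuous Y → ∀ u,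
      IntervalIntegrable (fun s => rem (Y s)) volume 0 u := fun {Y} hY u =>
    (intervalIntegrable_const (c := B)).mono_fun (hrem.comp hY.measurable).aestronglyMeasurable
      (Eventually.of_forall fun s => (hB _).trans (le_abs_self B))
  have irem1 : ∀ {Y : ℝ → Space d}, Continuous Y →
      IntervalIntegrable (fun s => ‖rem (Y s)‖) volume 0 T := fun hY => (irem hY T).norm
  have irem2 : ∀ {Y : ℝ → Space d}, Continuous Y →
      IntervalIntegrable (fun s => ‖rem (Y s)‖ ^ 2) volume 0 T := fun {Y} hY =>
    (intervalIntegrable_const (c := B ^ 2)).mono_fun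
      ((hrem.comp hY.measurable).norm.pow_const 2).aestronglyMeasurable
      (Eventually.of_forall fun s => by
        simp only [norm_pow, norm_norm]
        rw [← norm_pow, Real.norm_of_nonneg (sq_nonneg B)]
        exact pow_le_pow_left₀ (norm_nonneg _) (hB _) 2)
  have force : ∀ {Y : ℝ → Space d}, Continuous Y →
      toCSpace (∫ s in (0 : ℝ)..t, F (Y s)) = (∫ s in (0 : ℝ)..t, S (Y s)) +
        (∫ s in (0 : ℝ)..t, mode a (fun _ => 1) (Y s)) + ∫ s in (0 : ℝ)..t, rem (Y s) := by
    intro Y hY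
    have h1 : toCSpace (∫ s in (0 : ℝ)..t, F (Y s)) = ∫ s in (0 : ℝ)..t, toCSpace (F (Y s)) := by
      have := (toCSpaceIsometry d).integral_comp_comm (μ := volume.restrict (Set.Ioc 0 t))
        (fun s => F (Y s))
      rw [intervalIntegral.integral_of_le ht.1, intervalIntegral.integral_of_le ht.1]
      exact this.symm
    have i1 : IntervalIntegrable (fun s => S (Y s)) volume 0 t :=
      (hSc.comp hY).intervalIntegrable _ _
    have i2 : IntervalIntegrable (fun s => mode a (fun _ => 1) (Y s)) volume 0 t :=
      (hmc.comp hY).intervalIntegrable _ _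
    rw [h1, ← intervalIntegral.integral_add i1 i2,
      ← intervalIntegral.integral_add (i1.add i2) (irem hY t)]
    simp_rw [hF]
  have eV : V' t - V t = (V' 0 - V 0) +
      ((∫ s in (0 : ℝ)..t, F (X' s)) - ∫ s in (0 : ℝ)..t, F (X s)) := by
    rw [hV.eq_integral t, hV'.eq_integral t]; abel
  have eF : ‖(∫ s in (0 : ℝ)..t, F (X' s)) - ∫ s in (0 : ℝ)..t, F (X s)‖ =
      ‖((∫ s in (0 : ℝ)..t, S (X' s)) - ∫ s in (0 : ℝ)..t, S (X s)) +
        ((∫ s in (0 : ℝ)..t, mode a (fun _ => 1) (X' s)) -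
          ∫ s in (0 : ℝ)..t, mode a (fun _ => 1) (X s)) +
        ((∫ s in (0 : ℝ)..t, rem (X' s)) - ∫ s in (0 : ℝ)..t, rem (X s))‖ := by
    have h1 := (toCSpaceIsometry d).norm_map
      ((∫ s in (0 : ℝ)..t, F (X' s)) - ∫ s in (0 : ℝ)..t, F (X s))
    rw [map_sub] at h1
    rw [← h1]
    change ‖toCSpace _ - toCSpace _‖ = _
    rw [force hXc, force hXc']
    congr 1; abel
  have bS : ‖(∫ s in (0 : ℝ)..t, S (X' s)) - ∫ s in (0 : ℝ)..t, S (X s)‖ ≤ W * (Λ * T) := by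
    have i1 : IntervalIntegrable (fun s => S (X' s)) volume 0 t :=
      (hSc.comp hXc').intervalIntegrable _ _
    have i2 : IntervalIntegrable (fun s => S (X s)) volume 0 t :=
      (hSc.comp hXc).intervalIntegrable _ _
    rw [← intervalIntegral.integral_sub i1 i2]
    refine (norm_integral_le_integral_of_le (g := fun _ => Λ * W) continuous_const ht.1
      fun s hs => ?_).trans ?_
    · exact (hΛ _ _).trans (mul_le_mul_of_nonneg_left (hW s hs) hΛ0)
    · rw [intervalIntegral.integral_const, sub_zero, smul_eq_mul]
      have : t * (Λ * W) ≤ T * (Λ * W) := by gcongr; exact ht.2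
      linarith
  have bU := ha.norm_integral_mode_sub_sq_le hψ (hW0.trans_le hWr) hWr hrW hV hX hV' hX' ht hW hη
  have bR1 : ∀ {Y : ℝ → Space d}, Continuous Y → ‖∫ s in (0 : ℝ)..t, rem (Y s)‖ ^ 2 ≤
      T * ∫ s in (0 : ℝ)..T, ‖rem (Y s)‖ ^ 2 := by
    intro Y hY
    refine le_trans ?_ (sq_intervalIntegral_le hT (irem1 hY) (irem2 hY))
    refine pow_le_pow_left₀ (norm_nonneg _) ?_ 2
    refine (intervalIntegral.norm_integral_le_integral_norm ht.1).trans ?_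
    exact intervalIntegral.integral_mono_interval le_rfl ht.1 ht.2
      (Eventually.of_forall fun s => norm_nonneg _) (irem1 hY)
  set I := ∫ s in (0 : ℝ)..T, ‖rem (X s)‖ ^ 2 with hI
  set I' := ∫ s in (0 : ℝ)..T, ‖rem (X' s)‖ ^ 2 with hI'
  have hI0 : 0 ≤ I := intervalIntegral.integral_nonneg hT fun s _ => sq_nonneg _
  have hI0' : 0 ≤ I' := intervalIntegral.integral_nonneg hT fun s _ => sq_nonneg _
  have bR : ‖(∫ s in (0 : ℝ)..t, rem (X' s)) - ∫ s in (0 : ℝ)..t, rem (X s)‖ ^ 2 ≤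
      W ^ 2 * (2 * T / δ ^ 2 * (I + I')) := by
    have h1 := bR1 hXc
    have h2 := bR1 hXc'
    have h3 := norm_sub_le (∫ s in (0 : ℝ)..t, rem (X' s)) (∫ s in (0 : ℝ)..t, rem (X s))
    have h4 : ‖(∫ s in (0 : ℝ)..t, rem (X' s)) - ∫ s in (0 : ℝ)..t, rem (X s)‖ ^ 2 ≤
        2 * T * (I + I') := by
      refine (pow_le_pow_left₀ (norm_nonneg _) h3 2).trans ?_
      nlinarith [sq_nonneg (‖∫ s in (0 : ℝ)..t, rem (X' s)‖ - ‖∫ s in (0 : ℝ)..t, rem (X s)‖)]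
    refine h4.trans ?_
    have h5 : 0 ≤ 2 * T / δ ^ 2 * (I + I') := by positivity
    calc 2 * T * (I + I') = δ ^ 2 * (2 * T / δ ^ 2 * (I + I')) := by field_simp
      _ ≤ _ := by gcongr
  set x₁ := ‖(∫ s in (0 : ℝ)..t, S (X' s)) - ∫ s in (0 : ℝ)..t, S (X s)‖
  set x₂ := ‖(∫ s in (0 : ℝ)..t, mode a (fun _ => 1) (X' s)) -
          ∫ s in (0 : ℝ)..t, mode a (fun _ => 1) (X s)‖
  set x₃ := ‖(∫ s in (0 : ℝ)..t, rem (X' s)) - ∫ s in (0 : ℝ)..t, rem (X s)‖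
  have tot : ‖V' t - V t‖ ≤ W + (x₁ + x₂ + x₃) := by
    rw [eV]
    refine (norm_add_le _ _).trans (add_le_add (hVδ.trans hδW) ?_)
    rw [eF]; exact norm_add₃_le
  have h1 : x₁ ^ 2 ≤ W ^ 2 * (Λ * T) ^ 2 := by
    rw [← mul_pow]; exact pow_le_pow_left₀ (norm_nonneg _) bS 2
  calc ‖V' t - V t‖ ^ 2 ≤ (W + (x₁ + x₂ + x₃)) ^ 2 := by gcongr
    _ ≤ 4 * (W ^ 2 + x₁ ^ 2 + x₂ ^ 2 + x₃ ^ 2) := by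
        nlinarith [sq_nonneg (W - x₁), sq_nonneg (W - x₂), sq_nonneg (W - x₃),
          sq_nonneg (x₁ - x₂), sq_nonneg (x₁ - x₃), sq_nonneg (x₂ - x₃)]
    _ ≤ _ := by linarith

/-- The logarithmic functional along a pair of trajectories. -/
theorem BandLimited.log_functional_le (ha : BandLimited a) (hψ : AveragingKernel ψ C)
    {Λ B D : ℝ} {N : ℕ} (hΛ : ∀ x y, ‖S x - S y‖ ≤ Λ * ‖x - y‖) (hΛ0 : 0 ≤ Λ)
    (hrem : Measurable rem) (hB : ∀ x, ‖rem x‖ ≤ B)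
    (hF : ∀ x, toCSpace (F x) = S x + mode a (fun _ => 1) x + rem x)
    (hV : BoundedAcceleration A V fun s => F (X s)) (hX : ∀ s, HasDerivAt X (V s) s)
    (hV' : BoundedAcceleration A V' fun s => F (X' s)) (hX' : ∀ s, HasDerivAt X' (V' s) s)
    (hδ : 0 < δ) (hδ1 : δ ≤ 1) (hXδ : ‖X 0 - X' 0‖ ≤ δ) (hVδ : ‖V 0 - V' 0‖ ≤ δ) (hT : 0 ≤ T)
    (hD0 : 0 ≤ D)
    (hD : 2 + 2 * T * ((1 + T * (1 + 2 * A * T)) * (1 + 2 * A * T)) + T * (1 + 2 * A * T) ^ 2 ≤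
      D ^ 2) (hN : D < 2 ^ N * δ) :
    Real.log (1 + 1 / δ ^ 2 * ((⨆ t : Set.Icc (0 : ℝ) T, ‖X t - X' t‖ ^ 2) +
      ∫ t in (0 : ℝ)..T, ‖V t - V' t‖ ^ 2)) ≤ Real.log (D ^ 2 / δ ^ 2) ∧
    Real.log (1 + 1 / δ ^ 2 * ((⨆ t : Set.Icc (0 : ℝ) T, ‖X t - X' t‖ ^ 2) +
      ∫ t in (0 : ℝ)..T, ‖V t - V' t‖ ^ 2)) ≤ Real.log 2 + T +
      2 * ∫ t in (0 : ℝ)..T, 4 * (1 + (Λ * T) ^ 2 + 7 * (1 + (1 + A) ^ 2 * T) *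
        (∑ n ∈ Finset.range N, (pathEnergy T (scaleBound ψ C (2 ^ (n + 1) * δ) a) X V t +
          pathEnergy T (scaleBound ψ C (2 ^ (n + 1) * δ) a) X' V' t)) +
        2 * T / δ ^ 2 * ((∫ s in (0 : ℝ)..T, ‖rem (X s)‖ ^ 2) +
          ∫ s in (0 : ℝ)..T, ‖rem (X' s)‖ ^ 2)) := by
  have hA : 0 ≤ A := (norm_nonneg _).trans (hV.norm_le 0)
  have hXc : Continuous X := continuous_iff_continuousAt.2 fun s => (hX s).continuousAt
  have hXc' : Continuous X' := continuous_iff_continuousAt.2 fun s => (hX' s).continuousAt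
  have hVc := hV.continuous
  have hVc' := hV'.continuous
  simp_rw [fun t => norm_sub_rev (X t) (X' t), fun t => norm_sub_rev (V t) (V' t)]
  rw [norm_sub_rev] at hXδ hVδ
  set w : ℝ → Space d := fun t => X' t - X t with hw
  set η : ℝ → Space d := fun t => V' t - V t with hη
  have hwη : ∀ s, HasDerivAt w (η s) s := fun s => (hX' s).sub (hX s)
  have hηc : Continuous η := hVc'.sub hVc
  have hlog := log_one_add_le_log_pathMajorant hwη hηc hδ hXδ hT
  have hηB : ∀ t ∈ Set.Icc 0 T, ‖η t‖ ≤ 1 + 2 * A * T := by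
    intro t ht
    have h1 := hV.norm_sub_le t 0
    have h2 := hV'.norm_sub_le t 0
    have e : η t = (V' t - V' 0) - (V t - V 0) + (V' 0 - V 0) := by simp only [hη]; abel
    rw [e]
    refine (norm_add_le _ _).trans ?_
    have h3 := norm_sub_le (V' t - V' 0) (V t - V 0)
    rw [sub_zero, abs_of_nonneg ht.1] at h1 h2
    have h4 : A * t ≤ A * T := by gcongr; exact ht.2
    linarith
  have hup : ∀ t ∈ Set.Icc 0 T, pathMajorant δ w η t ≤ D ^ 2 := fun t ht =>
    (pathMajorant_le hwη hηc hXδ hδ1 hηB ht).trans hD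
  have hlow : ∀ t ∈ Set.Icc 0 T, δ ^ 2 ≤ pathMajorant δ w η t := fun t ht =>
    sq_le_pathMajorant hwη hηc hXδ ht.1
  refine ⟨hlog.trans (Real.log_le_log ?_ ?_), hlog.trans
    (log_pathMajorant_le hwη hηc hδ hXδ hT ?_ fun t ht => ?_)⟩
  · have := hlow T ⟨hT, le_rfl⟩
    have : 0 < pathMajorant δ w η T := (by positivity : 0 < δ ^ 2).trans_le this
    positivity
  · have := hup T ⟨hT, le_rfl⟩
    gcongr
  · have hp : ∀ (r : ℝ) {Y U : ℝ → Space d}, Continuous Y → Continuous U →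
        Continuous (pathEnergy T (scaleBound ψ C r a) Y U) := fun r {Y U} hY hU => by
      have h1 : Continuous fun t => scaleBound ψ C r a (Y t, U t) :=
        (ha.continuous_scaleBound hψ r).comp (hY.prodMk hU)
      unfold pathEnergy
      exact ((h1.pow 2).add continuous_const).add continuous_const
    refine continuous_const.mul ((continuous_const.add (continuous_const.mul
      (continuous_finsetSum _ fun n _ => ?_))).add continuous_const)
    exact (hp _ hXc hVc).add (hp _ hXc' hVc')
  · have hpos : 0 ≤ pathMajorant δ w η t := (sq_nonneg δ).trans (hlow t ht)
    -- This W dominates all separations on [0,t] and the L² norm of the velocity difference, and W²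
    -- is the factor that Grönwall's inequality requires.
    set W := √(pathMajorant δ w η t) with hW
    have hW2 : W ^ 2 = pathMajorant δ w η t := Real.sq_sqrt hpos
    have hδW : δ ≤ W := Real.le_sqrt_of_sq_le (hlow t ht)
    have hWD : W ≤ D := Real.sqrt_le_iff.2 ⟨hD0, hup t ht⟩
    obtain ⟨n, hn, h1, h2⟩ := exists_dyadic_scale hδ hδW hWD hN
    have hint := intervalIntegral.integral_nonneg (μ := volume) ht.1 fun s _ => sq_nonneg ‖η s‖
    have key := ha.norm_velocity_sub_sq_le hψ hΛ hΛ0 hrem hB hF hV hX hV' hX' hδ hVδ hδW h1 h2 ht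
      (fun s hs => by
        refine Real.le_sqrt_of_sq_le ?_
        have := le_pathMajorant hwη hηc hXδ hs
        linarith [sq_nonneg δ])
      (by
        rw [hW2]
        have := le_pathMajorant hwη hηc hXδ (s := 0) (t := t) ⟨le_rfl, ht.1⟩
        linarith [sq_nonneg δ, sq_nonneg ‖w 0‖])
    refine key.trans ?_
    rw [hW2]
    have hp := pathEnergy_nonneg (d := d) hT
    -- The dyadic scale depends on the pair of trajectories and on t; bounding its term by the sum
    -- over all scales removes this dependence.
    have hsum := Finset.single_le_sum (f := fun n =>
      pathEnergy T (scaleBound ψ C (2 ^ (n + 1) * δ) a) X V t +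
        pathEnergy T (scaleBound ψ C (2 ^ (n + 1) * δ) a) X' V' t)
      (fun n _ => add_nonneg (hp _ _ _ _) (hp _ _ _ _)) hn
    gcongr

end Trajectories

/-! ### Measurable versions of the flows and averages along them -/

section Flows

variable {d : ℕ} {A T R : ℝ} {F F' : Space d → Space d}
  {X V Y U : ℝ → Space d × Space d → Space d} {Ω : Set (Space d × Space d)}

/-- A jointly measurable, measure preserving flow of Newton's equation with force `F`. -/
structure RegularFlow (F : Space d → Space d) (A : ℝ)
    (Y U : ℝ → Space d × Space d → Space d) : Prop where
  measurable : Measurable fun q : ℝ × (Space d × Space d) => (Y q.1 q.2, U q.1 q.2)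
  measurePreserving : ∀ t, MeasurePreserving (fun p => (Y t p, U t p)) volume volume
  trajectory : ∀ᵐ p, (∀ t, HasDerivAt (fun s => Y s p) (U t p) t) ∧
    BoundedAcceleration A (fun s => U s p) fun s => F (Y s p)

/-- A measure preserving solution of Newton's equation agrees almost everywhere with a regular flow,
for any version of the force. -/
theorem IsNewtonSolution.exists_regularFlow (hsol : IsNewtonSolution F X V)
    (hmp : ∀ t, MeasurePreserving (fun p => (X t p, V t p)) volume volume)
    (hF' : Measurable F') (hA : ∀ x, ‖F' x‖ ≤ A) (hae : F =ᵐ[volume] F') :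
    ∃ Y U : ℝ → Space d × Space d → Space d, RegularFlow F' A Y U ∧
      ∀ᵐ p, ∀ t, Y t p = X t p ∧ U t p = V t p := by
  obtain ⟨G, hGs, hGm, hG0⟩ := exists_measurable_superset_of_null (ae_iff.1 hsol)
  have hgood : ∀ p, p ∉ G → (∀ t : ℝ, HasDerivAt (fun s => X s p) (V t p) t) ∧
      (∀ t : ℝ, IntervalIntegrable (fun s => F (X s p)) volume 0 t) ∧
      (∀ t : ℝ, V t p = V 0 p + ∫ s in (0 : ℝ)..t, F (X s p)) := fun p hp => by
    by_contra h; exact hp (hGs h)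
  have haeG : ∀ᵐ p, p ∉ G := measure_eq_zero_iff_ae_notMem.1 hG0
  -- Setting the flow to zero on the exceptional null set makes every path continuous, from which
  -- joint measurability in time and label follows.
  set Y : ℝ → Space d × Space d → Space d := fun t => Gᶜ.indicator (X t) with hY
  set U : ℝ → Space d × Space d → Space d := fun t => Gᶜ.indicator (V t) with hU
  have eY : ∀ p, p ∉ G → ∀ t, Y t p = X t p := fun p hp t => Set.indicator_of_mem hp _
  have eU : ∀ p, p ∉ G → ∀ t, U t p = V t p := fun p hp t => Set.indicator_of_mem hp _
  have zY : ∀ p, p ∈ G → ∀ t, Y t p = 0 := fun p hp t =>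
    Set.indicator_of_notMem (not_not.2 hp) _
  have zU : ∀ p, p ∈ G → ∀ t, U t p = 0 := fun p hp t =>
    Set.indicator_of_notMem (not_not.2 hp) _
  have hXm : ∀ t, Measurable (X t) := fun t => measurable_fst.comp (hmp t).measurable
  have hVm : ∀ t, Measurable (V t) := fun t => measurable_snd.comp (hmp t).measurable
  have hYm : ∀ t, Measurable (Y t) := fun t => (hXm t).indicator hGm.compl
  have hUm : ∀ t, Measurable (U t) := fun t => (hVm t).indicator hGm.compl
  have cY : ∀ p, Continuous fun t => Y t p := fun p => by
    by_cases hp : p ∈ G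
    · simp_rw [zY p hp]; exact continuous_const
    · simp_rw [eY p hp]
      exact continuous_iff_continuousAt.2 fun t => ((hgood p hp).1 t).continuousAt
  have cU : ∀ p, Continuous fun t => U t p := fun p => by
    by_cases hp : p ∈ G
    · simp_rw [zU p hp]; exact continuous_const
    · simp_rw [eU p hp]
      obtain ⟨-, h2, h3⟩ := hgood p hp
      rw [show (fun t => V t p) = fun t => V 0 p + ∫ s in (0 : ℝ)..t, F (X s p) from funext h3]
      exact continuous_const.add (intervalIntegral.continuous_primitive
        (fun a b => (h2 a).symm.trans (h2 b)) 0)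
  have mY : Measurable (Function.uncurry Y) := measurable_uncurry_of_continuous_of_measurable cY hYm
  have mU : Measurable (Function.uncurry U) := measurable_uncurry_of_continuous_of_measurable cU hUm
  have mp : ∀ t, MeasurePreserving (fun p => (Y t p, U t p)) volume volume := fun t =>
    (hmp t).congr ((hYm t).prodMk (hUm t)) (haeG.mono fun p hp => by
      simp only [eY p hp, eU p hp])
  obtain ⟨N, hNs, hNm, hN0⟩ := exists_measurable_superset_of_null (ae_iff.1 hae)
  -- At each time the flow preserves measure, so almost no label sits over the null set where the
  -- two versions of the force differ. By Fubini almost every trajectory meets that set only for a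
  -- null set of times, and the time integral of the force is unchanged.
  have hN : ∀ᵐ p : Space d × Space d, ∀ᵐ s : ℝ, Y s p ∉ N := by
    rw [← Measure.ae_ae_comm (p := fun s p => Y s p ∉ N) (mY hNm.compl)]
    refine Eventually.of_forall fun s => ?_
    suffices h : (volume : Measure (Space d × Space d)) {p | Y s p ∈ N} = 0 from
      (measure_eq_zero_iff_ae_notMem.1 h).mono fun p hp => hp
    have h1 := (mp s).measure_preimage (s := N ×ˢ Set.univ) (hNm.prod .univ).nullMeasurableSet
    rw [show (volume : Measure (Space d × Space d)) = volume.prod volume from rfl,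
      Measure.prod_prod, hN0, zero_mul] at h1
    have e : (fun p => (Y s p, U s p)) ⁻¹' (N ×ˢ Set.univ) = {p | Y s p ∈ N} := by
      ext p; simp
    rwa [← e]
  refine ⟨Y, U, ⟨mY.prodMk mU, mp, ?_⟩, haeG.mono fun p hp t => ⟨eY p hp t, eU p hp t⟩⟩
  filter_upwards [haeG, hN] with p hp hNp
  obtain ⟨h1, h2, h3⟩ := hgood p hp
  refine ⟨fun t => ?_, hF'.comp (cY p).measurable, fun s => hA _, fun t => ?_⟩
  · simp_rw [eY p hp, eU p hp]; exact h1 t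
  · rw [eU p hp, eU p hp, h3 t]
    congr 1
    refine intervalIntegral.integral_congr_ae (hNp.mono fun s hs _ => ?_)
    rw [← eY p hp s]
    by_contra h
    exact hs (hNs h)

/-- The image of Ω at time t has velocities in the ball of radius R, and measure preservation
transports the integral there. Positions need no restriction because the Plancherel estimates hold
on the whole space. -/
theorem RegularFlow.setLIntegral_comp_le (h : RegularFlow F A Y U) {t : ℝ}
    (hR : ∀ᵐ p, p ∈ Ω → ‖U t p‖ ≤ R) {g : Space d × Space d → ℝ≥0∞} (hg : Measurable g) :
    ∫⁻ p in Ω, g (Y t p, U t p) ≤ ∫⁻ z, g z ∂(phaseMeasure d R) := by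
  set B : Set (Space d × Space d) := Set.univ ×ˢ Metric.closedBall 0 R with hB
  have hBm : MeasurableSet B := MeasurableSet.univ.prod measurableSet_closedBall
  have e : phaseMeasure d R = (volume : Measure (Space d × Space d)).restrict B := by
    rw [phaseMeasure, hB, show (volume : Measure (Space d × Space d)) = volume.prod volume from rfl,
      ← Measure.prod_restrict, Measure.restrict_univ]
  rw [e, ← lintegral_indicator hBm, ← (h.measurePreserving t).lintegral_comp (hg.indicator hBm)]
  have hm : Measurable fun p => B.indicator g (Y t p, U t p) :=
    (hg.indicator hBm).comp (h.measurePreserving t).measurable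
  refine (setLIntegral_mono_ae hm.aemeasurable.restrict (hR.mono fun p hp hpΩ => ?_)).trans
    (setLIntegral_le_lintegral _ _)
  rw [Set.indicator_of_mem]
  simpa [hB] using hp hpΩ

/-- The mean square of `g` along the flow. -/
noncomputable def flowEnergy {E : Type*} [NormedAddCommGroup E] (T : ℝ)
    (g : Space d × Space d → E) (Y U : ℝ → Space d × Space d → Space d) (p : Space d × Space d) :
    ℝ≥0∞ :=
  ENNReal.ofReal (1 + T) * (∫⁻ s in Set.Ioc 0 T, ‖g (Y s p, U s p)‖ₑ ^ 2) +
    ENNReal.ofReal T * ‖g (Y 0 p, U 0 p)‖ₑ ^ 2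

variable {E : Type*} [NormedAddCommGroup E] [MeasurableSpace E] [BorelSpace E]

theorem RegularFlow.measurable_comp (h : RegularFlow F A Y U) {g : Space d × Space d → ℝ≥0∞}
    (hg : Measurable g) : Measurable fun q : ℝ × (Space d × Space d) => g (Y q.1 q.2, U q.1 q.2) :=
  hg.comp h.measurable

theorem RegularFlow.measurable_flowEnergy (h : RegularFlow F A Y U) (T : ℝ)
    {g : Space d × Space d → E} (hg : Measurable g) : Measurable (flowEnergy T g Y U) := by
  have h1 := h.measurable_comp (hg.enorm.pow_const 2)
  refine Measurable.add (Measurable.const_mul ?_ _) (Measurable.const_mul ?_ _)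
  · exact (h1.comp measurable_swap).lintegral_prod_right'
  · exact h1.comp (measurable_const.prodMk measurable_id)

theorem RegularFlow.lintegral_flowEnergy_le (h : RegularFlow F A Y U)
    (hT : 0 ≤ T) (hR : ∀ t ∈ Set.Icc 0 T, ∀ᵐ p, p ∈ Ω → ‖U t p‖ ≤ R)
    {g : Space d × Space d → E} (hg : Measurable g) :
    ∫⁻ p in Ω, flowEnergy T g Y U p ≤
      ENNReal.ofReal ((1 + T) * T + T) * ∫⁻ z, ‖g z‖ₑ ^ 2 ∂(phaseMeasure d R) := by
  have hg2 : Measurable fun z => ‖g z‖ₑ ^ 2 := hg.enorm.pow_const 2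
  have h1 := h.measurable_comp hg2
  set J := ∫⁻ z, ‖g z‖ₑ ^ 2 ∂(phaseMeasure d R)
  have b0 : ∫⁻ p in Ω, ‖g (Y 0 p, U 0 p)‖ₑ ^ 2 ≤ J :=
    h.setLIntegral_comp_le (hR 0 ⟨le_rfl, hT⟩) hg2
  have b1 : ∫⁻ p in Ω, ∫⁻ s in Set.Ioc 0 T, ‖g (Y s p, U s p)‖ₑ ^ 2 ≤ ENNReal.ofReal T * J := by
    have hm : Measurable (Function.uncurry fun (p : Space d × Space d) (s : ℝ) =>
        ‖g (Y s p, U s p)‖ₑ ^ 2) := h1.comp measurable_swap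
    rw [lintegral_lintegral_swap hm.aemeasurable]
    calc _ ≤ ∫⁻ s in Set.Ioc 0 T, J := by
          refine setLIntegral_mono measurable_const fun s hs => ?_
          exact h.setLIntegral_comp_le (hR s ⟨hs.1.le, hs.2⟩) hg2
      _ = _ := by rw [setLIntegral_const, Real.volume_Ioc, sub_zero, mul_comm]
  have m0 : Measurable fun p => ENNReal.ofReal T * ‖g (Y 0 p, U 0 p)‖ₑ ^ 2 :=
    Measurable.const_mul (h1.comp (measurable_const.prodMk measurable_id)) _
  simp only [flowEnergy]
  rw [lintegral_add_right _ m0, lintegral_const_mul' _ _ ENNReal.ofReal_ne_top,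
    lintegral_const_mul' _ _ ENNReal.ofReal_ne_top]
  calc _ ≤ ENNReal.ofReal (1 + T) * (ENNReal.ofReal T * J) + ENNReal.ofReal T * J := by gcongr
    _ = _ := by
      rw [← mul_assoc, ← ENNReal.ofReal_mul (by positivity), ← add_mul,
        ← ENNReal.ofReal_add (by positivity) (by positivity)]

theorem ofReal_intervalIntegral_sq_le {u : ℝ → E} (hu : Measurable u) (hT : 0 ≤ T) :
    ENNReal.ofReal (∫ s in (0 : ℝ)..T, ‖u s‖ ^ 2) ≤ ∫⁻ s in Set.Ioc 0 T, ‖u s‖ₑ ^ 2 := by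
  rw [intervalIntegral.integral_of_le hT, integral_eq_lintegral_of_nonneg_ae
    (Eventually.of_forall fun s => sq_nonneg _) (hu.norm.pow_const 2).aestronglyMeasurable]
  refine ENNReal.ofReal_toReal_le.trans (le_of_eq (lintegral_congr fun s => ?_))
  rw [ENNReal.ofReal_pow (norm_nonneg _), ofReal_norm]

theorem ofReal_integral_sq_le_flowEnergy (hT : 0 ≤ T) {g : Space d × Space d → E}
    {p : Space d × Space d} (hu : Measurable fun s => g (Y s p, U s p)) :
    ENNReal.ofReal (∫ s in (0 : ℝ)..T, ‖g (Y s p, U s p)‖ ^ 2) ≤ flowEnergy T g Y U p := by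
  refine (ofReal_intervalIntegral_sq_le hu hT).trans ?_
  refine le_add_right ?_
  calc _ = ENNReal.ofReal 1 * ∫⁻ s in Set.Ioc 0 T, ‖g (Y s p, U s p)‖ₑ ^ 2 := by simp
    _ ≤ _ := by gcongr; linarith

/-- Integrated over [0,T], the end value at t joins the time integral, which gives the weight 1 + T,
and the initial value is multiplied by T; these are the weights of `flowEnergy`. -/
theorem ofReal_integral_pathEnergy_le (hT : 0 ≤ T) {g : Space d × Space d → ℝ}
    {p : Space d × Space d} (hu : Continuous fun s => g (Y s p, U s p)) :
    ENNReal.ofReal (∫ t in (0 : ℝ)..T, pathEnergy T g (fun s => Y s p) (fun s => U s p) t) ≤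
      flowEnergy T g Y U p := by
  have e : ∫ t in (0 : ℝ)..T, pathEnergy T g (fun s => Y s p) (fun s => U s p) t =
      (1 + T) * (∫ t in (0 : ℝ)..T, g (Y t p, U t p) ^ 2) + T * g (Y 0 p, U 0 p) ^ 2 := by
    unfold pathEnergy
    rw [intervalIntegral.integral_add, intervalIntegral.integral_add]
    · simp only [intervalIntegral.integral_const, sub_zero, smul_eq_mul]; ring
    · exact (hu.pow 2).intervalIntegrable _ _
    · exact intervalIntegrable_const
    · exact ((hu.pow 2).add continuous_const).intervalIntegrable _ _
    · exact intervalIntegrable_const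
  have h0 : 0 ≤ ∫ t in (0 : ℝ)..T, g (Y t p, U t p) ^ 2 :=
    intervalIntegral.integral_nonneg hT fun s _ => sq_nonneg _
  rw [e, ENNReal.ofReal_add (by positivity) (by positivity), ENNReal.ofReal_mul (by positivity),
    ENNReal.ofReal_mul hT]
  unfold flowEnergy
  gcongr
  · have := ofReal_intervalIntegral_sq_le hu.measurable hT
    simpa only [Real.norm_eq_abs, sq_abs] using this
  · rw [← Real.enorm_of_nonneg (sq_nonneg _), enorm_pow]

end Flows

/-! ### Integration over the initial data -/

section Integration

variable {d : ℕ} {ψ : Space d → ℝ} {C A T R δ : ℝ} {a S rem : Space d → CSpace d}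
  {F : Space d → Space d} {Y U Y' U' : ℝ → Space d × Space d → Space d}
  {Ω : Set (Space d × Space d)}

theorem integral_pathEnergy_sum {N : ℕ} {c₁ c₂ c₃ : ℝ} {p p' : ℕ → ℝ → ℝ}
    (hp : ∀ n, Continuous (p n)) (hp' : ∀ n, Continuous (p' n)) :
    2 * ∫ t in (0 : ℝ)..T, 4 * (c₁ + c₂ * (∑ n ∈ Finset.range N, (p n t + p' n t)) + c₃) =
      8 * T * c₁ + 8 * c₂ * (∑ n ∈ Finset.range N,
        ((∫ t in (0 : ℝ)..T, p n t) + ∫ t in (0 : ℝ)..T, p' n t)) + 8 * T * c₃ := by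
  have hs : Continuous fun t => ∑ n ∈ Finset.range N, (p n t + p' n t) :=
    continuous_finsetSum _ fun n _ => (hp n).add (hp' n)
  have hc : Continuous fun t => c₂ * ∑ n ∈ Finset.range N, (p n t + p' n t) :=
    continuous_const.mul hs
  have hi : IntervalIntegrable (fun t => c₁ + c₂ * ∑ n ∈ Finset.range N, (p n t + p' n t))
      volume 0 T := (continuous_const.add hc).intervalIntegrable _ _
  rw [intervalIntegral.integral_const_mul, intervalIntegral.integral_add hi
    intervalIntegrable_const,
    intervalIntegral.integral_add intervalIntegrable_const (hc.intervalIntegrable _ _),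
    intervalIntegral.integral_const_mul, intervalIntegral.integral_finsetSum
      (f := fun n t => p n t + p' n t) fun n _ => ((hp n).add (hp' n)).intervalIntegrable _ _]
  simp_rw [fun n => intervalIntegral.integral_add ((hp n).intervalIntegrable (μ := volume) 0 T)
    ((hp' n).intervalIntegrable 0 T)]
  simp only [intervalIntegral.integral_const, sub_zero, smul_eq_mul]
  ring

/-- Measure preservation converts the energies along trajectories into phase space norms. Since
these are bounded uniformly in the scale, the sum over scales costs exactly a factor N; the
remainder keeps its weight δ⁻². -/
theorem BandLimited.lintegral_log_functional_le (ha : BandLimited a) (hψ : AveragingKernel ψ C)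
    {Λ B D K : ℝ} {N : ℕ} (hΛ : ∀ x y, ‖S x - S y‖ ≤ Λ * ‖x - y‖) (hΛ0 : 0 ≤ Λ)
    (hrem : Measurable rem) (hB : ∀ x, ‖rem x‖ ≤ B)
    (hF : ∀ x, toCSpace (F x) = S x + mode a (fun _ => 1) x + rem x) (hA : 0 ≤ A)
    (h : RegularFlow F A Y U) (h' : RegularFlow F A Y' U')
    (hδ : 0 < δ) (hδ1 : δ ≤ 1) (hT : 0 ≤ T) (hD0 : 0 ≤ D)
    (hD : 2 + 2 * T * ((1 + T * (1 + 2 * A * T)) * (1 + 2 * A * T)) + T * (1 + 2 * A * T) ^ 2 ≤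
      D ^ 2) (hN : D < 2 ^ N * δ)
    (h0 : ∀ᵐ p, ‖Y 0 p - Y' 0 p‖ ≤ δ ∧ ‖U 0 p - U' 0 p‖ ≤ δ)
    (hR : ∀ t ∈ Set.Icc 0 T, ∀ᵐ p, p ∈ Ω → ‖U t p‖ ≤ R)
    (hR' : ∀ t ∈ Set.Icc 0 T, ∀ᵐ p, p ∈ Ω → ‖U' t p‖ ≤ R) (hK0 : 0 ≤ K)
    (hK : ∀ r : ℝ, 0 < r → eLpNorm (scaleBound ψ C r a) 2 (phaseMeasure d R) ≤
      ENNReal.ofReal K * frequencyEnergy a ^ (1 / 2 : ℝ)) :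
    QFunctional T Ω δ Y U Y' U' ≤ ENNReal.ofReal (Real.log (D ^ 2 / δ ^ 2)) * volume Ω ∧
    QFunctional T Ω δ Y U Y' U' ≤
      ENNReal.ofReal (Real.log 2 + T + 8 * T * (1 + (Λ * T) ^ 2)) * volume Ω +
      ENNReal.ofReal (8 * (7 * (1 + (1 + A) ^ 2 * T))) * (N * (2 * (ENNReal.ofReal ((1 + T) * T + T) *
        (ENNReal.ofReal (K ^ 2) * frequencyEnergy a)))) +
      ENNReal.ofReal (8 * T * (2 * T / δ ^ 2)) * (2 * (ENNReal.ofReal ((1 + T) * T + T) *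
        ∫⁻ z, ‖rem z.1‖ₑ ^ 2 ∂(phaseMeasure d R))) := by
  set g : ℕ → Space d × Space d → ℝ := fun n => scaleBound ψ C (2 ^ (n + 1) * δ) a with hg
  have hgc : ∀ n, Continuous (g n) := fun n => ha.continuous_scaleBound hψ _
  have hrem1 : Measurable fun z : Space d × Space d => rem z.1 := hrem.comp measurable_fst
  set c₁ := Real.log 2 + T + 8 * T * (1 + (Λ * T) ^ 2) with hc₁
  set c₂ := 7 * (1 + (1 + A) ^ 2 * T) with hc₂
  set c₃ := 2 * T / δ ^ 2 with hc₃
  have hlog2 : 0 ≤ Real.log 2 := Real.log_nonneg one_le_two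
  have hc₁0 : 0 ≤ c₁ := by positivity
  have hc₂0 : 0 ≤ c₂ := by positivity
  have hc₃0 : 0 ≤ c₃ := by positivity
  have path : ∀ {Z W : ℝ → Space d × Space d → Space d} {p : Space d × Space d},
      (∀ t, HasDerivAt (fun s => Z s p) (W t p) t) →
      BoundedAcceleration A (fun s => W s p) (fun s => F (Z s p)) →
      Continuous fun s => (Z s p, W s p) := fun hd hb =>
    (continuous_iff_continuousAt.2 fun s => (hd s).continuousAt).prodMk hb.continuous
  have pointwise : ∀ᵐ p,
      Real.log (1 + 1 / δ ^ 2 * ((⨆ t : Set.Icc (0 : ℝ) T, ‖Y t p - Y' t p‖ ^ 2) +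
        ∫ t in (0 : ℝ)..T, ‖U t p - U' t p‖ ^ 2)) ≤ Real.log (D ^ 2 / δ ^ 2) ∧
      ENNReal.ofReal (Real.log (1 + 1 / δ ^ 2 *
        ((⨆ t : Set.Icc (0 : ℝ) T, ‖Y t p - Y' t p‖ ^ 2) +
          ∫ t in (0 : ℝ)..T, ‖U t p - U' t p‖ ^ 2))) ≤
      ENNReal.ofReal c₁ + ENNReal.ofReal (8 * c₂) * (∑ n ∈ Finset.range N,
        (flowEnergy T (g n) Y U p + flowEnergy T (g n) Y' U' p)) +
        ENNReal.ofReal (8 * T * c₃) * (flowEnergy T (fun z => rem z.1) Y U p +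
          flowEnergy T (fun z => rem z.1) Y' U' p) := by
    filter_upwards [h.trajectory, h'.trajectory, h0] with p hp hp' hp0
    obtain ⟨l1, l2⟩ := ha.log_functional_le (N := N) hψ hΛ hΛ0 hrem hB hF hp.2 hp.1 hp'.2 hp'.1 hδ hδ1
      hp0.1 hp0.2 hT hD0 hD hN
    have cZ := path hp.1 hp.2
    have cZ' := path hp'.1 hp'.2
    have cg : ∀ n, Continuous fun s => g n (Y s p, U s p) := fun n => (hgc n).comp cZ
    have cg' : ∀ n, Continuous fun s => g n (Y' s p, U' s p) := fun n => (hgc n).comp cZ'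
    have cp : ∀ n, Continuous (pathEnergy T (g n) (fun s => Y s p) fun s => U s p) := fun n => by
      unfold pathEnergy
      exact (((cg n).pow 2).add continuous_const).add continuous_const
    have cp' : ∀ n, Continuous (pathEnergy T (g n) (fun s => Y' s p) fun s => U' s p) := fun n => by
      unfold pathEnergy
      exact (((cg' n).pow 2).add continuous_const).add continuous_const
    rw [integral_pathEnergy_sum cp cp'] at l2
    have hI : 0 ≤ ∫ s in (0 : ℝ)..T, ‖rem (Y s p)‖ ^ 2 :=
      intervalIntegral.integral_nonneg hT fun s _ => sq_nonneg _
    have hI' : 0 ≤ ∫ s in (0 : ℝ)..T, ‖rem (Y' s p)‖ ^ 2 :=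
      intervalIntegral.integral_nonneg hT fun s _ => sq_nonneg _
    have hp0 : ∀ n, 0 ≤ ∫ t in (0 : ℝ)..T, pathEnergy T (g n) (fun s => Y s p) (fun s => U s p) t :=
      fun n => intervalIntegral.integral_nonneg hT fun s _ => pathEnergy_nonneg hT _ _ _ _
    have hp0' : ∀ n, 0 ≤ ∫ t in (0 : ℝ)..T,
        pathEnergy T (g n) (fun s => Y' s p) (fun s => U' s p) t :=
      fun n => intervalIntegral.integral_nonneg hT fun s _ => pathEnergy_nonneg hT _ _ _ _
    have hs0 : 0 ≤ ∑ n ∈ Finset.range N,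
        ((∫ t in (0 : ℝ)..T, pathEnergy T (g n) (fun s => Y s p) (fun s => U s p) t) +
          ∫ t in (0 : ℝ)..T, pathEnergy T (g n) (fun s => Y' s p) (fun s => U' s p) t) :=
      Finset.sum_nonneg fun n _ => add_nonneg (hp0 n) (hp0' n)
    refine ⟨l1, (ENNReal.ofReal_le_ofReal (l2.trans (le_of_eq (b := c₁ + 8 * c₂ *
      (∑ n ∈ Finset.range N,
        ((∫ t in (0 : ℝ)..T, pathEnergy T (g n) (fun s => Y s p) (fun s => U s p) t) +
          ∫ t in (0 : ℝ)..T, pathEnergy T (g n) (fun s => Y' s p) (fun s => U' s p) t)) +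
      8 * T * c₃ * ((∫ s in (0 : ℝ)..T, ‖rem (Y s p)‖ ^ 2) +
        ∫ s in (0 : ℝ)..T, ‖rem (Y' s p)‖ ^ 2)) ?_))).trans ?_⟩
    · rw [hc₁, hc₂, hc₃]; ring
    rw [ENNReal.ofReal_add (by positivity) (by positivity),
      ENNReal.ofReal_add (by positivity) (by positivity),
      ENNReal.ofReal_mul (p := 8 * c₂) (by positivity),
      ENNReal.ofReal_mul (p := 8 * T * c₃) (by positivity)]
    gcongr
    · rw [ENNReal.ofReal_sum_of_nonneg fun n _ => add_nonneg (hp0 n) (hp0' n)]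
      refine Finset.sum_le_sum fun n _ => ?_
      rw [ENNReal.ofReal_add (hp0 n) (hp0' n)]
      exact add_le_add (ofReal_integral_pathEnergy_le hT (cg n))
        (ofReal_integral_pathEnergy_le hT (cg' n))
    · rw [ENNReal.ofReal_add hI hI']
      exact add_le_add
        (ofReal_integral_sq_le_flowEnergy (g := fun z => rem z.1) hT (hrem1.comp cZ.measurable))
        (ofReal_integral_sq_le_flowEnergy (g := fun z => rem z.1) hT (hrem1.comp cZ'.measurable))
  constructor
  · calc QFunctional T Ω δ Y U Y' U' ≤
        ∫⁻ p in Ω, ENNReal.ofReal (Real.log (D ^ 2 / δ ^ 2)) := by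
          refine lintegral_mono_ae (ae_restrict_of_ae (pointwise.mono fun p hp => ?_))
          exact ENNReal.ofReal_le_ofReal hp.1
      _ = _ := setLIntegral_const _ _
  have m : ∀ n, Measurable fun p => flowEnergy T (g n) Y U p + flowEnergy T (g n) Y' U' p := fun n =>
    (h.measurable_flowEnergy T (hgc n).measurable).add
      (h'.measurable_flowEnergy T (hgc n).measurable)
  have ms : Measurable fun p => ∑ n ∈ Finset.range N,
      (flowEnergy T (g n) Y U p + flowEnergy T (g n) Y' U' p) :=
    Finset.measurable_fun_sum _ fun n _ => m n
  have sq : ∀ n, ∫⁻ z, ‖g n z‖ₑ ^ 2 ∂(phaseMeasure d R) ≤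
      ENNReal.ofReal (K ^ 2) * frequencyEnergy a := fun n => by
    rw [lintegral_enorm_sq_eq_eLpNorm_sq, ENNReal.ofReal_pow hK0]
    calc _ ≤ (ENNReal.ofReal K * frequencyEnergy a ^ (1 / 2 : ℝ)) ^ 2 := by
          gcongr; exact hK _ (by positivity)
      _ = _ := by
          rw [mul_pow, ← ENNReal.rpow_natCast (_ ^ _), ← ENNReal.rpow_mul]
          norm_num
  calc QFunctional T Ω δ Y U Y' U' ≤ ∫⁻ p in Ω, (ENNReal.ofReal c₁ +
        ENNReal.ofReal (8 * c₂) * (∑ n ∈ Finset.range N,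
          (flowEnergy T (g n) Y U p + flowEnergy T (g n) Y' U' p)) +
        ENNReal.ofReal (8 * T * c₃) * (flowEnergy T (fun z => rem z.1) Y U p +
          flowEnergy T (fun z => rem z.1) Y' U' p)) :=
        lintegral_mono_ae (ae_restrict_of_ae (pointwise.mono fun p hp => hp.2))
    _ = ENNReal.ofReal c₁ * volume Ω + ENNReal.ofReal (8 * c₂) * (∑ n ∈ Finset.range N,
          ((∫⁻ p in Ω, flowEnergy T (g n) Y U p) + ∫⁻ p in Ω, flowEnergy T (g n) Y' U' p)) +
        ENNReal.ofReal (8 * T * c₃) * ((∫⁻ p in Ω, flowEnergy T (fun z => rem z.1) Y U p) +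
          ∫⁻ p in Ω, flowEnergy T (fun z => rem z.1) Y' U' p) := by
        have m1 : Measurable fun p => ENNReal.ofReal c₁ + ENNReal.ofReal (8 * c₂) *
            ∑ n ∈ Finset.range N, (flowEnergy T (g n) Y U p + flowEnergy T (g n) Y' U' p) :=
          measurable_const.add (ms.const_mul _)
        rw [lintegral_add_left m1, lintegral_add_left measurable_const, setLIntegral_const,
          lintegral_const_mul' _ _ ENNReal.ofReal_ne_top,
          lintegral_const_mul' _ _ ENNReal.ofReal_ne_top,
          lintegral_finsetSum _ fun n _ => m n,
          lintegral_add_left (h.measurable_flowEnergy T hrem1)]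
        simp_rw [fun n => lintegral_add_left (μ := volume.restrict Ω)
          (h.measurable_flowEnergy T (hgc n).measurable) (flowEnergy T (g n) Y' U')]
    _ ≤ _ := by
        refine add_le_add (add_le_add le_rfl ?_) ?_
        · refine mul_le_mul_right ?_ _
          refine (Finset.sum_le_card_nsmul _ _ (2 * (ENNReal.ofReal ((1 + T) * T + T) *
            (ENNReal.ofReal (K ^ 2) * frequencyEnergy a))) fun n _ => ?_).trans (le_of_eq ?_)
          · rw [two_mul]
            exact add_le_add
              ((h.lintegral_flowEnergy_le hT hR (hgc n).measurable).trans (by gcongr; exact sq n))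
              ((h'.lintegral_flowEnergy_le hT hR' (hgc n).measurable).trans (by gcongr; exact sq n))
          · rw [Finset.card_range, nsmul_eq_mul]
        · refine mul_le_mul_right ?_ _
          rw [two_mul]
          exact add_le_add (h.lintegral_flowEnergy_le hT hR hrem1)
            (h'.lintegral_flowEnergy_le hT hR' hrem1)

end Integration

/-! ### From eventual bounds to a continuous strictly increasing modulus -/

section Modulus

/-- Eventual bounds by arbitrarily small constants are a bound by a strictly increasing modulus. -/
theorem exists_strictMonoOn_modulus {P : ℝ → ℝ → Prop} {b B : ℝ} (hB : 0 < B)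
    (hmono : ∀ δ c c', c ≤ c' → P δ c → P δ c')
    (hPB : ∀ δ, 0 < δ → δ < b → P δ B)
    (hP : ∀ c, 0 < c → ∃ δ₀, 0 < δ₀ ∧ ∀ δ, 0 < δ → δ < b → δ < δ₀ → P δ c) :
    ∃ ε : ℝ → ℝ, ContinuousOn ε (Set.Ici 0) ∧ StrictMonoOn ε (Set.Ici 0) ∧ ε 0 = 0 ∧
      ∀ δ, 0 < δ → δ < b → P δ (ε δ) := by
  choose! δ₀ hδ₀ hPδ using hP
  -- The cap 1/(n+1) forces the thresholds to 0, so every δ > 0 is at least some θₙ.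
  set θ : ℕ → ℝ := fun n => min (δ₀ (B * (1 / 2) ^ n)) (1 / ((n : ℝ) + 1)) with hθ
  have hθ0 : ∀ n, 0 < θ n := fun n => lt_min (hδ₀ _ (by positivity)) (by positivity)
  -- Each ramp saturates at height 2B/2ⁿ once δ ≥ θₙ. The height is twice the constant of threshold
  -- n, because saturation at n will be used together with the bound available below the preceding
  -- threshold. Strict monotonicity is supplied by the summand δ added to the series.
  set u : ℕ → ℝ → ℝ := fun n δ => (2 * B) * (1 / 2) ^ n * min 1 (δ / θ n) with hu
  have hu0 : ∀ n δ, 0 ≤ δ → 0 ≤ u n δ := fun n δ hδ => by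
    have := (hθ0 n).le
    have : 0 ≤ min 1 (δ / θ n) := le_min zero_le_one (by positivity)
    positivity
  have hsum : Summable fun n : ℕ => (2 * B) * (1 / 2 : ℝ) ^ n :=
    summable_geometric_two.mul_left _
  have hub : ∀ n δ, u n δ ≤ (2 * B) * (1 / 2) ^ n := fun n δ =>
    mul_le_of_le_one_right (by positivity) (min_le_left _ _)
  have hus : ∀ δ, 0 ≤ δ → Summable fun n => u n δ := fun δ hδ =>
    Summable.of_nonneg_of_le (fun n => hu0 n δ hδ) (fun n => hub n δ) hsum
  refine ⟨fun δ => δ + ∑' n, u n δ, ?_, ?_, ?_, fun δ hδ hδb => ?_⟩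
  · refine continuousOn_id.add (continuousOn_tsum (fun n => ?_) hsum fun n δ hδ => ?_)
    · exact (by fun_prop : Continuous fun δ => (2 * B) * (1 / 2) ^ n * min 1 (δ / θ n)).continuousOn
    · rw [Real.norm_of_nonneg (hu0 n δ hδ)]; exact hub n δ
  · intro x hx y hy hxy
    refine add_lt_add_of_lt_of_le hxy ((hus x hx).tsum_le_tsum (fun n => ?_) (hus y hy))
    have := (hθ0 n).le
    simp only [hu]
    gcongr
  · simp [hu]
  · have hex : ∃ n, θ n ≤ δ := by
      obtain ⟨n, hn⟩ := exists_nat_one_div_lt hδ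
      exact ⟨n, (min_le_right _ _).trans hn.le⟩
    classical
    -- At the first saturated index m the modulus is at least 2B/2ᵐ. If m = 0 this exceeds B;
    -- otherwise δ < θ_{m-1}, where the property holds with constant B/2^{m-1} = 2B/2ᵐ.
    set m := Nat.find hex with hm
    have hfm : θ m ≤ δ := Nat.find_spec hex
    have hterm : (2 * B) * (1 / 2) ^ m ≤ δ + ∑' n, u n δ := by
      have h1 : u m δ = (2 * B) * (1 / 2) ^ m := by
        simp only [hu]
        rw [min_eq_left ((one_le_div (hθ0 m)).2 hfm), mul_one]
      have h2 := (hus δ hδ.le).le_tsum m fun n _ => hu0 n δ hδ.le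
      linarith
    rcases Nat.eq_zero_or_pos m with h0 | hpos
    · refine hmono _ _ _ ?_ (hPB δ hδ hδb)
      rw [h0] at hterm
      linarith
    · obtain ⟨k, hk⟩ := Nat.exists_eq_succ_of_ne_zero hpos.ne'
      have hlt : δ < θ k := not_le.1 (Nat.find_min hex (by omega))
      refine hmono _ _ _ ?_ (hPδ (B * (1 / 2) ^ k) (by positivity) δ hδ hδb
        (hlt.trans_le (min_le_left _ _)))
      rw [hk, pow_succ] at hterm
      linarith

end Modulus

/-! ### The two bounds on the functional for nearby solutions -/

section Stability

variable {d : ℕ} {T A : ℝ} {Ω : Set (Space d × Space d)} {f : Space d → ℝ}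

/-- The data of the stability estimate: two measure preserving solutions with nearby initial
values. -/
structure NearbySolutions (F : Space d → Space d) (A δ : ℝ)
    (X V X' V' : ℝ → Space d × Space d → Space d) : Prop where
  norm_le : ∀ᵐ x, ‖F x‖ ≤ A
  solution : IsNewtonSolution F X V
  measurePreserving : ∀ t, MeasurePreserving (fun p => (X t p, V t p)) volume volume
  solution' : IsNewtonSolution F X' V'
  measurePreserving' : ∀ t, MeasurePreserving (fun p => (X' t p, V' t p)) volume volume
  initial : ∀ᵐ p, V 0 p = p.2
  nearby : ∀ᵐ p, ‖X 0 p - X' 0 p‖ ≤ δ ∧ ‖V 0 p - V' 0 p‖ ≤ δ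

theorem QFunctional_congr {T δ : ℝ} {X V X' V' Y U Y' U' : ℝ → Space d × Space d → Space d}
    (h : ∀ᵐ p, ∀ t, Y t p = X t p ∧ U t p = V t p)
    (h' : ∀ᵐ p, ∀ t, Y' t p = X' t p ∧ U' t p = V' t p) :
    QFunctional T Ω δ Y U Y' U' = QFunctional T Ω δ X V X' V' := by
  refine lintegral_congr_ae (ae_restrict_of_ae ?_)
  filter_upwards [h, h'] with p hp hp'
  simp_rw [fun t => (hp t).1, fun t => (hp t).2, fun t => (hp' t).1, fun t => (hp' t).2]

/-- A measurable version of an essentially bounded field that is bounded everywhere. -/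
theorem exists_measurable_version {F : Space d → Space d} (hF : MemLp F 2 volume) (hA : 0 ≤ A)
    (h : ∀ᵐ x, ‖F x‖ ≤ A) : ∃ F' : Space d → Space d, Measurable F' ∧ (∀ x, ‖F' x‖ ≤ A) ∧
      F =ᵐ[volume] F' := by
  set G := hF.1.mk F
  have hG : Measurable G := hF.1.stronglyMeasurable_mk.measurable
  have hs : MeasurableSet {x | ‖G x‖ ≤ A} := measurableSet_le hG.norm measurable_const
  refine ⟨{x | ‖G x‖ ≤ A}.indicator G, hG.indicator hs, fun x => ?_, ?_⟩
  · by_cases hx : x ∈ {x | ‖G x‖ ≤ A}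
    · rw [Set.indicator_of_mem hx]; exact hx
    · rw [Set.indicator_of_notMem hx, norm_zero]; exact hA
  · filter_upwards [h, hF.1.ae_eq_mk] with x hx hxG
    have : x ∈ {x | ‖G x‖ ≤ A} := by
      change ‖G x‖ ≤ A
      rwa [show G x = F x from hxG.symm]
    rw [Set.indicator_of_mem this, hxG]

theorem forceL2_congr {F F' : Space d → Space d} (hF : MemLp F 2 volume) (hF' : MemLp F' 2 volume)
    (h : F =ᵐ[volume] F') : forceL2 F hF = forceL2 F' hF' :=
  MemLp.toLp_congr _ _ (h.mono fun x hx => by beta_reduce; rw [hx])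

/-- N is the integer part of log₂(D/δ), plus one. The condition δ < 1/e gives |log δ| > 1, which
absorbs the additive constants. -/
theorem exists_pow_two_mul_gt {D : ℝ} (hD : 1 ≤ D) : ∃ c : ℝ, 0 ≤ c ∧ ∀ δ : ℝ, 0 < δ →
    δ < 1 / Real.exp 1 → ∃ N : ℕ, D < 2 ^ N * δ ∧ (N : ℝ) ≤ c * |Real.log δ| := by
  have h2 : 0 < Real.log 2 := Real.log_pos one_lt_two
  have hlD : 0 ≤ Real.log D := Real.log_nonneg hD
  refine ⟨(Real.log D + 1) / Real.log 2 + 1, by positivity, fun δ hδ hδe => ?_⟩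
  have hL : Real.log δ < -1 := by
    have := Real.log_lt_log hδ hδe
    rwa [one_div, Real.log_inv, Real.log_exp] at this
  have hLa : |Real.log δ| = -Real.log δ := abs_of_neg (by linarith)
  set L := |Real.log δ|
  have hL1 : 1 < L := by rw [hLa]; linarith
  have hlog : Real.log (D / δ) = Real.log D + L := by
    rw [Real.log_div (by positivity) hδ.ne', hLa]; ring
  refine ⟨⌊Real.log (D / δ) / Real.log 2⌋₊ + 1, ?_, ?_⟩
  · rw [← div_lt_iff₀ hδ, ← Real.log_lt_log_iff (by positivity) (by positivity), Real.log_pow,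
      ← div_lt_iff₀ h2]
    push_cast
    exact Nat.lt_floor_add_one _
  · push_cast
    have h3 : (⌊Real.log (D / δ) / Real.log 2⌋₊ : ℝ) ≤ Real.log (D / δ) / Real.log 2 :=
      Nat.floor_le (div_nonneg (by rw [hlog]; positivity) h2.le)
    have h4 : Real.log (D / δ) / Real.log 2 ≤ (Real.log D + 1) / Real.log 2 * L := by
      rw [hlog, div_mul_eq_mul_div]
      gcongr
      nlinarith
    calc _ ≤ (Real.log D + 1) / Real.log 2 * L + 1 * L := by linarith
      _ = _ := by ring

theorem RegularFlow.norm_velocity_le {F : Space d → Space d} {δ R : ℝ} (hδ : δ ≤ 1)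
    {Y U Y' U' : ℝ → Space d × Space d → Space d} (hA : 0 ≤ A)
    (h : RegularFlow F A Y U) (h' : RegularFlow F A Y' U')
    (h0 : ∀ᵐ p, U 0 p = p.2) (hn : ∀ᵐ p, ‖Y 0 p - Y' 0 p‖ ≤ δ ∧ ‖U 0 p - U' 0 p‖ ≤ δ)
    (hR : ∀ p ∈ Ω, ‖p.2‖ ≤ R) :
    (∀ t ∈ Set.Icc 0 T, ∀ᵐ p, p ∈ Ω → ‖U t p‖ ≤ R + 1 + A * T) ∧
    (∀ t ∈ Set.Icc 0 T, ∀ᵐ p, p ∈ Ω → ‖U' t p‖ ≤ R + 1 + A * T) := by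
  constructor
  · intro t ht
    filter_upwards [h.trajectory, h0] with p hp hp0 hpΩ
    have h1 := hp.2.norm_sub_le t 0
    have h2 := norm_sub_norm_le (U t p) (U 0 p)
    have h3 := hR p hpΩ
    rw [sub_zero, abs_of_nonneg ht.1] at h1
    have h4 : A * t ≤ A * T := by gcongr; exact ht.2
    rw [← hp0] at h3
    linarith
  · intro t ht
    filter_upwards [h'.trajectory, h0, hn] with p hp hp0 hpn hpΩ
    have h1 := hp.2.norm_sub_le t 0
    have h2 := norm_sub_norm_le (U' t p) (U' 0 p)
    have h3 := hR p hpΩ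
    have h5 := norm_sub_norm_le (U' 0 p) (U 0 p)
    rw [norm_sub_rev] at h5
    rw [sub_zero, abs_of_nonneg ht.1] at h1
    have h4 : A * t ≤ A * T := by gcongr; exact ht.2
    rw [← hp0] at h3
    linarith [hpn.2]

/-- The two bounds on the logarithmic functional: the trivial one, and the one with a small
multiple of the energy. -/
theorem exists_QFunctional_le (hT : 0 < T) (hA : 0 < A) (hΩ : IsCompact Ω)
    (hf1 : ∀ k, 1 ≤ f k) (hf : Tendsto f (cocompact (Space d)) atTop) :
    ∃ C₁ : ℝ, 0 < C₁ ∧ ∀ η : ℝ, 0 < η → ∃ C₂ : ℝ, 0 ≤ C₂ ∧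
      ∀ (F : Space d → Space d) (hF : MemLp F 2 volume) (δ : ℝ), 0 < δ → δ < 1 / Real.exp 1 →
      ∀ X V X' V' : ℝ → Space d × Space d → Space d, NearbySolutions F A δ X V X' V' →
        QFunctional T Ω δ X V X' V' ≤ ENNReal.ofReal (C₁ * |Real.log δ|) ∧
        QFunctional T Ω δ X V X' V' ≤ ENNReal.ofReal C₂ +
          ENNReal.ofReal (|Real.log δ| * η) * weightedEnergy f F hF := by
  obtain ⟨ψ, C, hψ⟩ := exists_averagingKernel d
  obtain ⟨R₀, hR₀⟩ := hΩ.isBounded.exists_norm_le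
  have hR₀' : ∀ p ∈ Ω, ‖p.2‖ ≤ R₀ := fun p hp => (norm_snd_le p).trans (hR₀ p hp)
  -- Velocities start within R₀ on Ω, the second flow is off by at most δ ≤ 1 initially, and the
  -- acceleration contributes at most AT.
  set R := R₀ + 1 + A * T with hR
  obtain ⟨K, hK0, hK⟩ := exists_eLpNorm_scaleBound_le hψ R
  obtain ⟨K₁, hK₁, hdec⟩ := exists_force_decomposition hψ R
  obtain ⟨c, hc0, hc⟩ := exists_lintegral_fourier_eq_weightedEnergy d
  set D2 := 2 + 2 * T * ((1 + T * (1 + 2 * A * T)) * (1 + 2 * A * T)) + T * (1 + 2 * A * T) ^ 2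
    with hD2
  have hD20 : 1 ≤ D2 := by
    have : 0 ≤ 2 * T * ((1 + T * (1 + 2 * A * T)) * (1 + 2 * A * T)) + T * (1 + 2 * A * T) ^ 2 := by
      positivity
    linarith
  set D := √D2 with hD
  have hD1 : 1 ≤ D := Real.one_le_sqrt.2 hD20
  have hDD : D ^ 2 = D2 := Real.sq_sqrt (by linarith)
  obtain ⟨cN, hcN, hN⟩ := exists_pow_two_mul_gt hD1
  set m := volume.real Ω with hm
  have hm0 : 0 ≤ m := measureReal_nonneg
  have hmΩ : volume Ω = ENNReal.ofReal m := (ofReal_measureReal hΩ.measure_lt_top.ne).symm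
  have hlD : 0 ≤ Real.log D := Real.log_nonneg hD1
  set cT := (1 + T) * T + T with hcT
  set M := 8 * (7 * (1 + (1 + A) ^ 2 * T)) * (cN * (2 * (cT * (K ^ 2 * c)))) with hM
  have hM0 : 0 ≤ M := by positivity
  refine ⟨(2 * Real.log D + 2) * (m + 1), by positivity, fun η hη => ?_⟩
  -- The constant M is the total factor in front of |log δ| times the energy; dividing by M + 1
  -- leaves a coefficient of at most η. The scale r, and hence the Lipschitz constant entering C₂,
  -- depends on η but not on δ.
  obtain ⟨r, hr, hrE⟩ := exists_scale_frequencyEnergy_le hψ hf1 hf (η := η / (M + 1)) (by positivity)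
  refine ⟨(Real.log 2 + T + 8 * T * (1 + (K₁ * A / r * T) ^ 2)) * m + 8 * T * (2 * T) * (2 * cT), ?_,
    fun F hF δ hδ hδe X V X' V' hsol => ?_⟩
  · have : 0 ≤ Real.log 2 := Real.log_nonneg one_le_two
    positivity
  have hL : Real.log δ < -1 := by
    have := Real.log_lt_log hδ hδe
    rwa [one_div, Real.log_inv, Real.log_exp] at this
  have hLa : |Real.log δ| = -Real.log δ := abs_of_neg (by linarith)
  have hδ1 : δ ≤ 1 := by
    by_contra h
    have := Real.log_pos (not_le.1 h)
    linarith
  obtain ⟨N, hN1, hN2⟩ := hN δ hδ hδe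
  set L := |Real.log δ| with hLdef
  have hL1 : 1 < L := by rw [hLa]; linarith
  obtain ⟨F', hF'm, hF'A, hae⟩ := exists_measurable_version hF hA.le hsol.norm_le
  have hF' : MemLp F' 2 volume := hF.ae_eq hae
  obtain ⟨Y, U, hflow, hYX⟩ := hsol.solution.exists_regularFlow hsol.measurePreserving hF'm hF'A hae
  obtain ⟨Y', U', hflow', hYX'⟩ :=
    hsol.solution'.exists_regularFlow hsol.measurePreserving' hF'm hF'A hae
  rw [← QFunctional_congr hYX hYX']
  have hU0 : ∀ᵐ p, U 0 p = p.2 := by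
    filter_upwards [hYX, hsol.initial] with p hp hp0
    rw [(hp 0).2, hp0]
  have hnear : ∀ᵐ p, ‖Y 0 p - Y' 0 p‖ ≤ δ ∧ ‖U 0 p - U' 0 p‖ ≤ δ := by
    filter_upwards [hYX, hYX', hsol.nearby] with p hp hp' hpn
    rw [(hp 0).1, (hp 0).2, (hp' 0).1, (hp' 0).2]
    exact hpn
  obtain ⟨v, v'⟩ := RegularFlow.norm_velocity_le (T := T) (Ω := Ω) hδ1 hA.le hflow hflow' hU0
    hnear hR₀'
  -- The tolerance δ² for the remainder cancels its weight δ⁻². The frequency support and the sup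
  -- bound of the remainder may depend on δ, since no estimate involves them.
  obtain ⟨a, S, rem, ha, haξ, hS, hrem, ⟨B, hB⟩, hremε, hFdec⟩ :=
    hdec A F' hF' hF'm hF'A r hr (δ ^ 2) (by positivity)
  obtain ⟨b1, b2⟩ := ha.lintegral_log_functional_le (N := N) hψ hS (by positivity) hrem hB hFdec
    hA.le hflow hflow' hδ hδ1 hT.le (by linarith) hDD.ge hN1 hnear v v' hK0 (hK a ha)
  constructor
  · refine b1.trans ?_
    rw [hmΩ, ← ENNReal.ofReal_mul (Real.log_nonneg ?_)]
    · refine ENNReal.ofReal_le_ofReal ?_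
      have : Real.log (D ^ 2 / δ ^ 2) = 2 * Real.log D + 2 * L := by
        rw [Real.log_div (by positivity) (by positivity), Real.log_pow, Real.log_pow, hLa]
        push_cast; ring
      rw [this]
      have h1 : 2 * Real.log D + 2 * L ≤ (2 * Real.log D + 2) * L := by nlinarith
      calc _ ≤ (2 * Real.log D + 2) * L * (m + 1) := by gcongr; linarith
        _ = _ := by ring
    · rw [one_le_div (by positivity)]
      exact pow_le_pow_left₀ hδ.le (hδ1.trans hD1) 2
  · refine b2.trans ?_
    have hE : frequencyEnergy a ≤
        ENNReal.ofReal (η / (M + 1)) * (ENNReal.ofReal c * weightedEnergy f F hF) := by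
      rw [← hc f F hF, forceL2_congr hF hF' hae]
      exact hrE a _ haξ
    have e1 : ENNReal.ofReal (8 * T * (2 * T / δ ^ 2)) * (2 * (ENNReal.ofReal cT *
        ∫⁻ z, ‖rem z.1‖ₑ ^ 2 ∂(phaseMeasure d R))) ≤ ENNReal.ofReal (8 * T * (2 * T) * (2 * cT)) := by
      calc _ ≤ ENNReal.ofReal (8 * T * (2 * T / δ ^ 2)) * (ENNReal.ofReal 2 * (ENNReal.ofReal cT *
            ENNReal.ofReal (δ ^ 2))) := by
            rw [ENNReal.ofReal_ofNat]; gcongr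
        _ = _ := by
            rw [← ENNReal.ofReal_mul (by positivity), ← ENNReal.ofReal_mul (by positivity),
              ← ENNReal.ofReal_mul (by positivity)]
            congr 1; field_simp
    have e2 : ENNReal.ofReal (8 * (7 * (1 + (1 + A) ^ 2 * T))) * (N * (2 * (ENNReal.ofReal cT *
        (ENNReal.ofReal (K ^ 2) * frequencyEnergy a)))) ≤
        ENNReal.ofReal (L * η) * weightedEnergy f F hF := by
      calc _ ≤ ENNReal.ofReal (8 * (7 * (1 + (1 + A) ^ 2 * T))) * (ENNReal.ofReal (cN * L) *
            (ENNReal.ofReal 2 * (ENNReal.ofReal cT * (ENNReal.ofReal (K ^ 2) *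
              (ENNReal.ofReal (η / (M + 1)) * (ENNReal.ofReal c * weightedEnergy f F hF)))))) := by
            rw [ENNReal.ofReal_ofNat, ← ENNReal.ofReal_natCast]; gcongr
        _ = ENNReal.ofReal (L * (η * (M / (M + 1)))) * weightedEnergy f F hF := by
            simp only [← mul_assoc]
            rw [← ENNReal.ofReal_mul (by positivity), ← ENNReal.ofReal_mul (by positivity),
              ← ENNReal.ofReal_mul (by positivity), ← ENNReal.ofReal_mul (by positivity),
              ← ENNReal.ofReal_mul (by positivity), ← ENNReal.ofReal_mul (by positivity)]
            congr 2
            rw [hM]; ring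
        _ ≤ _ := by
            gcongr
            refine mul_le_of_le_one_right hη.le ?_
            rw [div_le_one (by positivity)]; linarith
    have hlog2 : 0 ≤ Real.log 2 := Real.log_nonneg one_le_two
    rw [hmΩ, ← ENNReal.ofReal_mul (by positivity),
      ENNReal.ofReal_add (q := 8 * T * (2 * T) * (2 * cT)) (by positivity) (by positivity)]
    exact (add_le_add (add_le_add le_rfl e2) e1).trans (le_of_eq (add_right_comm _ _ _))

end Stability

/-! ### Combination of the trivial and the small-coefficient bounds -/

theorem proposition2 (d : ℕ) (T A : ℝ) (hT : 0 < T) (hA : 0 < A)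
    (Ω : Set (Space d × Space d)) (hΩ : IsCompact Ω)
    (f : Space d → ℝ) (hf1 : ∀ k, 1 ≤ f k) (hf : Tendsto f (cocompact (Space d)) atTop) :
    ∃ ε : ℝ → ℝ, ContinuousOn ε (Set.Ici 0) ∧ StrictMonoOn ε (Set.Ici 0) ∧ ε 0 = 0 ∧
      ∀ (F : Space d → Space d) (hF : MemLp F 2 volume), ForceMemSobolev (3 / 4) F hF →
        (∀ᵐ x, ‖F x‖ ≤ A) →
      ∀ (δ : ℝ), 0 < δ → δ < 1 / Real.exp 1 →
      ∀ (X V Xδ Vδ : ℝ → Space d × Space d → Space d),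
        IsNewtonSolution F X V →
        (∀ t, InvertibleJacobianOne (fun p => (X t p, V t p))) →
        IsSemigroup X V →
        (∀ᵐ p, X 0 p = p.1 ∧ V 0 p = p.2) →
        IsNewtonSolution F Xδ Vδ →
        (∀ t, InvertibleJacobianOne (fun p => (Xδ t p, Vδ t p))) →
        (∀ᵐ p, ‖X 0 p - Xδ 0 p‖ ≤ δ ∧ ‖V 0 p - Vδ 0 p‖ ≤ δ) →
        QFunctional T Ω δ X V Xδ Vδ ≤
          ENNReal.ofReal (|Real.log δ| * ε δ) * (1 + weightedEnergy f F hF) ^ (1 / 2 : ℝ) := by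
  obtain ⟨C₁, hC₁, hQ⟩ := exists_QFunctional_le hT hA hΩ hf1 hf
  have hlog : ∀ δ : ℝ, 0 < δ → δ < 1 / Real.exp 1 → 1 < |Real.log δ| := fun δ hδ hδe => by
    have := Real.log_lt_log hδ hδe
    rw [one_div, Real.log_inv, Real.log_exp] at this
    rw [abs_of_neg (by linarith)]; linarith
  have key : ∃ ε : ℝ → ℝ, ContinuousOn ε (Set.Ici 0) ∧ StrictMonoOn ε (Set.Ici 0) ∧ ε 0 = 0 ∧
      ∀ δ, 0 < δ → δ < 1 / Real.exp 1 → ∀ (F : Space d → Space d) (hF : MemLp F 2 volume)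
        (X V X' V' : ℝ → Space d × Space d → Space d), NearbySolutions F A δ X V X' V' →
        QFunctional T Ω δ X V X' V' ≤
          ENNReal.ofReal (|Real.log δ| * ε δ) * (1 + weightedEnergy f F hF) ^ (1 / 2 : ℝ) := by
    refine exists_strictMonoOn_modulus hC₁ (P := fun δ c => ∀ (F : Space d → Space d)
      (hF : MemLp F 2 volume) (X V X' V' : ℝ → Space d × Space d → Space d),
      NearbySolutions F A δ X V X' V' → QFunctional T Ω δ X V X' V' ≤
        ENNReal.ofReal (|Real.log δ| * c) * (1 + weightedEnergy f F hF) ^ (1 / 2 : ℝ))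
      (fun δ c c' hcc' h F hF X V X' V' hs => (h F hF X V X' V' hs).trans (by gcongr))
      (fun δ hδ hδe F hF X V X' V' hs => ?_) fun c hc => ?_
    -- The trivial bound does not depend on η, so any value serves here.
    · obtain ⟨C₂, -, h⟩ := hQ 1 one_pos
      refine (h F hF δ hδ hδe X V X' V' hs).1.trans ?_
      rw [mul_comm C₁]
      refine le_mul_of_one_le_right zero_le ?_
      exact ENNReal.one_le_rpow (le_add_right le_rfl) (by norm_num)
    -- In the product of the two bounds the energy has coefficient C₁L·Lη, where L = |log δ|; this
    -- equals (Lc)² for η = c²/C₁. The threshold on δ says L ≥ C₁C₂/c², which makes the other term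
    -- C₁LC₂ at most (Lc)² as well.
    · obtain ⟨C₂, hC₂, h⟩ := hQ (c ^ 2 / C₁) (by positivity)
      refine ⟨Real.exp (-(C₁ * C₂ / c ^ 2)), Real.exp_pos _,
        fun δ hδ hδe hδ₀ F hF X V X' V' hs => ?_⟩
      obtain ⟨b1, b2⟩ := h F hF δ hδ hδe X V X' V' hs
      have hL1 := hlog δ hδ hδe
      have hL2 : C₁ * C₂ / c ^ 2 ≤ |Real.log δ| := by
        have := Real.log_lt_log hδ hδ₀
        rw [Real.log_exp] at this
        have h5 := neg_abs_le (Real.log δ)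
        have h6 : Real.log δ ≤ 0 := by
          have : 0 ≤ C₁ * C₂ / c ^ 2 := by positivity
          linarith
        rw [abs_of_nonpos h6]; linarith
      set L := |Real.log δ|
      set E := weightedEnergy f F hF
      set Q := QFunctional T Ω δ X V X' V'
      rcases eq_or_ne E ∞ with hE | hE
      · rw [hE, add_top, ENNReal.top_rpow_of_pos (by norm_num), ENNReal.mul_top]
        · exact le_top
        · rw [ne_eq, ENNReal.ofReal_eq_zero, not_le]; positivity
      -- Q is bounded as a geometric mean: Q² is at most the product of the trivial bound and the
      -- bound linear in the energy, which is where the power 1/2 originates.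
      have sq : Q ^ 2 ≤ (ENNReal.ofReal (L * c) * (1 + E) ^ (1 / 2 : ℝ)) ^ 2 := by
        calc Q ^ 2 ≤ ENNReal.ofReal (C₁ * L) *
              (ENNReal.ofReal C₂ + ENNReal.ofReal (L * (c ^ 2 / C₁)) * E) := by
              rw [sq]; exact mul_le_mul' b1 b2
          _ = ENNReal.ofReal (C₁ * L * C₂) + ENNReal.ofReal ((L * c) ^ 2) * E := by
              rw [mul_add, ← ENNReal.ofReal_mul (by positivity), ← mul_assoc,
                ← ENNReal.ofReal_mul (by positivity)]
              congr 3
              field_simp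
          _ ≤ ENNReal.ofReal ((L * c) ^ 2) + ENNReal.ofReal ((L * c) ^ 2) * E := by
              gcongr
              rw [div_le_iff₀ (by positivity)] at hL2
              calc C₁ * L * C₂ = L * (C₁ * C₂) := by ring
                _ ≤ L * (L * c ^ 2) := by gcongr
                _ = _ := by ring
          _ = _ := by
              have e : ((1 + E) ^ (1 / 2 : ℝ)) ^ 2 = 1 + E := by
                rw [← ENNReal.rpow_natCast, ← ENNReal.rpow_mul]
                norm_num
              rw [mul_pow (ENNReal.ofReal (L * c)), e, ENNReal.ofReal_pow (by positivity), mul_add,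
                mul_one]
      exact (ENNReal.pow_le_pow_left_iff two_ne_zero).1 sq
  obtain ⟨ε, h1, h2, h3, h4⟩ := key
  refine ⟨ε, h1, h2, h3, fun F hF _ hFA δ hδ hδe X V Xδ Vδ hs hJ _ h0 hs' hJ' hn => ?_⟩
  exact h4 δ hδ hδe F hF X V Xδ Vδ
    ⟨hFA, hs, fun t => (hJ t).1, hs', fun t => (hJ' t).1, h0.mono fun p hp => hp.2, hn⟩
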